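/- **Setting.** All random variables are square integrable on a probability space, with inner product $\langle\lambda,\mu\rangle=\mathrm E\{\lambda\mu\}$. On $[0,T]$, $T>0$, consider $$dx=A(t)x\,dt+B(t)\,dw,\qquad dy=C(t)x\,dt+D(t)\,dw,\quad y(0)=0,$$ with continuous matrix functions $A,B,C,D$, where $w$ is a centered process with orthogonal increments, $\mathrm E\{dw\,dw'\}=I\,dt$ (e.g. a Wiener process), $x(0)$ is centered and uncorrelated with $w$, and $R(t)=D(t)D(t)'$ is positive definite for all $t\in[0,T]$. Put $P(t)=\mathrm E\{x(t)x(t)'\}$, $\bar x(t)=P(t)^{-1}x(t)$, and let $\bar A=-A'$, $\bar B=P^{-1}B$, $\bar C=CP+DB'$, $D$ be the coefficients of the time-reversed model $d\bar x=\bar A\bar x\,dt+\bar B\,d\bar w$, $dy=\bar C\bar x\,dt+D\,d\bar w$. Assume the normalization $P(t)=I$, i.e. $x(t)=\bar x(t)$, for all $t\in[0,T]$. **Observations.** Let $\mathbf H_{[a,b]}(dy)$ be the closed span of the components of the increments of $y$ on $[a,b]$. Let $0=\tau_0<\dots<\tau_N=T$ be any partition in which on each interval $[\tau_{i-1},\tau_i]$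 either (a) $y$ is fully observed, or (b) only the increment $\Delta y=y(\tau_i)-y(\tau_{i-1})$ is known (a gap when $y$ itself is recorded), or (c) nothing is observed (a gap when only $dy$ is recorded). Let $\mathring{\mathbf H}$ be the closed span of the respective spaces $\mathbf H_{[\tau_{i-1},\tau_i]}(dy)$, $\mathrm{span}(\Delta y)$, $\{0\}$, and put $$\mathring{\mathbf H}{}_t^-=\mathring{\mathbf H}\cap\mathbf H_{[0,t]}(dy),\qquad \mathring{\mathbf H}{}_t^+=\mathring{\mathbf H}\cap\mathbf H_{[t,T]}(dy).$$ Let $x_-(t)$, $\bar x_+(t)$, $\hat x(t)$ be the componentwise orthogonal projections of $x(t)$ onto $\mathring{\mathbf H}{}_t^-$, of $\bar x(t)$ onto $\mathring{\mathbf H}{}_t^+$, and of $x(t)$ onto $\mathring{\mathbf H}{}_t^-\vee\mathring{\mathbf H}{}_t^+$, with error covariances $Q_-(t)$, $\bar Q_+(t)$, $Q(t)$. **Theorem.** For every such observation pattern the following hold. 1. For every $t\in[0,T]$ the matrices $Q_-(t),\bar Q_+(t),Q(t)$ are positive definite, and $$\hat x(t)=Q(t)\bigl(Q_-(t)^{-1}x_-(t)+\bar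 Q_+(t)^{-1}\bar x_+(t)\bigr),\qquad Q(t)^{-1}=Q_-(t)^{-1}+\bar Q_+(t)^{-1}-I.$$ 2. $\mathring{\mathbf H}{}_t^-\vee\mathring{\mathbf H}{}_t^+=\mathring{\mathbf H}$ whenever $t\in[0,T]$ is not interior to an interval of type (b); for these $t$, $\hat x(t)$ is thus the linear least-squares estimate of $x(t)$ from all observed data. 3. $(x_-,Q_-)$ satisfies $x_-(0)=0$, $Q_-(0)=I$ and the following cascade. On closed intervals of type (a), $$dx_-=Ax_-dt+K(dy-Cx_-dt),\qquad \dot Q_-=AQ_-+Q_-A'-KRK'+BB',$$ with $K=(Q_-C'+BD')R^{-1}$. On closed intervals of type (c), the same equations hold with $K=0$. On an interval $[a,b]$ of type (b), the equations with $K=0$ hold on $[a,b)$, and at $b$ $$x_-(b)=A_dx_-(a)+K_d\bigl(y(b)-y(a)-C_dx_-(a)\bigr),\qquad Q_-(b)=A_dQ_-(a)A_d'-K_dVK_d'+\Sigma_{11},$$ where $V=C_dQ_-(a)C_d'+\Sigma_{22}$ is invertible and $K_d=(A_dQ_-(a)C_d'+\Sigma_{12})V^{-1}$. Here, $\Phi(t,s)$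 being the transition matrix of $A$, $A_d=\Phi(b,a)$, $C_d=\int_a^bC(t)\Phi(t,a)\,dt$, $M(s)=\int_s^bC(t)\Phi(t,s)\,dt\,B(s)+D(s)$, and, with integrals over the interval between $a$ and $b$, $\Sigma_{11}=\int\Phi(b,s)BB'\Phi(b,s)'ds$, $\Sigma_{12}=\int\Phi(b,s)BM(s)'ds$, $\Sigma_{22}=\int MM'ds$. 4. $(\bar x_+,\bar Q_+)$ satisfies $\bar x_+(T)=0$, $\bar Q_+(T)=I$ and the backward cascade. On closed intervals of type (a), $$d\bar x_+=-A'\bar x_+dt+\bar K(dy-\bar C\bar x_+dt),\qquad \dot{\bar Q}_+=-A'\bar Q_+-\bar Q_+A+\bar KR\bar K'-\bar B\bar B',$$ with $\bar K=-(\bar Q_+\bar C'-\bar BD')R^{-1}$. On closed intervals of type (c), the same equations hold with $\bar K=0$. On an interval of type (b), the equations with $\bar K=0$ hold except at its left end, where the value is obtained from the value at the right end by the discrete step of item 3 for the model $(\bar A,\bar B,\bar C,D)$, with $a$ the right and $b$ the left end point ($\int_a^b=-\int_b^a$). -/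

import Mathlib

open MeasureTheory Set

noncomputable section

/-! ### Second-order random variables and vectors -/

/-- The Hilbert space of square-integrable real random variables, `⟪λ, μ⟫ = E{λ μ}`. -/
abbrev RV {Ω : Type*} [MeasurableSpace Ω] (ℙ : Measure Ω) : Type _ := Lp ℝ 2 ℙ

/-- The product `M v` of a deterministic matrix and a vector with entries in `E`
(typically a random vector). -/
def matAct {E : Type*} [AddCommGroup E] [Module ℝ E] {r q : ℕ}
    (M : Matrix (Fin r) (Fin q) ℝ) (v : Fin q → E) : Fin r → E :=
  fun i => ∑ j, M i j • v j

infixr:73 " ⊛ " => matAct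

/-- The matrix `E{u v'}`; for zero-mean `u`, `v` it is their cross-covariance. -/
def covMat {Ω : Type*} [MeasurableSpace Ω] {ℙ : Measure Ω} {r q : ℕ}
    (u : Fin r → RV ℙ) (v : Fin q → RV ℙ) : Matrix (Fin r) (Fin q) ℝ :=
  Matrix.of fun i j => inner ℝ (u i) (v j)

/-! ### Stochastic differentials (mean-square calculus) -/

/-- `∫_a^b M(t) dz(t) = I`, for a deterministic matrix function `M` and a vector process `z`: the
sums `∑ M(u_k) (z(u_{k+1}) - z(u_k))` over partitions `a = u_0 ≤ ⋯ ≤ u_N = b` converge in norm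
to `I` as the mesh tends to zero. With `z = w` a process with orthogonal increments and
`M` continuous, this is the Wiener integral. -/
def HasStochIntegral {E : Type*} [NormedAddCommGroup E] [NormedSpace ℝ E] {r q : ℕ}
    (M : ℝ → Matrix (Fin r) (Fin q) ℝ) (z : ℝ → Fin q → E) (a b : ℝ) (I : Fin r → E) : Prop :=
  ∀ ε > 0, ∃ δ > 0, ∀ (N : ℕ) (u : ℕ → ℝ), Monotone u → u 0 = a → u N = b →
    (∀ k < N, u (k + 1) - u k < δ) →
      ‖(∑ k ∈ Finset.range N, M (u k) ⊛ (z (u (k + 1)) - z (u k))) - I‖ < ε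

/-- `dx = f dt + M dz` on the interval `J`, that is,
`x(t) - x(s) = ∫_s^t f dτ + ∫_s^t M dz` for `s ≤ t` in `J`. -/
def HasStochDifferential {E : Type*} [NormedAddCommGroup E] [NormedSpace ℝ E] {r q : ℕ}
    (J : Set ℝ) (x f : ℝ → Fin r → E) (M : ℝ → Matrix (Fin r) (Fin q) ℝ)
    (z : ℝ → Fin q → E) : Prop :=
  ∀ s ∈ J, ∀ t ∈ J, s ≤ t → IntervalIntegrable f volume s t ∧
    HasStochIntegral M z s t (x t - x s - ∫ τ in s..t, f τ)

/-! ### The stochastic system -/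

/-- Coefficients of `dx = A x dt + B dw`, `dy = C x dt + D dw`. -/
structure LinModel (n m p : ℕ) where
  A : ℝ → Matrix (Fin n) (Fin n) ℝ
  B : ℝ → Matrix (Fin n) (Fin p) ℝ
  C : ℝ → Matrix (Fin m) (Fin n) ℝ
  D : ℝ → Matrix (Fin m) (Fin p) ℝ

/-- `R = D D'`. -/
def LinModel.R {n m p : ℕ} (S : LinModel n m p) (t : ℝ) : Matrix (Fin m) (Fin m) ℝ :=
  S.D t * (S.D t).transpose

/-- The coefficients are continuous on `[0, T]`. -/
structure LinModel.IsContinuousOn {n m p : ℕ} (S : LinModel n m p) (T : ℝ) : Prop where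
  A : ContinuousOn S.A (Icc 0 T)
  B : ContinuousOn S.B (Icc 0 T)
  C : ContinuousOn S.C (Icc 0 T)
  D : ContinuousOn S.D (Icc 0 T)

/-- The coefficients of the time-reversed model `dx̄ = -A' x̄ dt + B̄ dw̄`, `dy = C̄ x̄ dt + D dw̄`
with state `x̄ = P⁻¹ x`, where `B̄ = P⁻¹ B` and `C̄ = C P + D B'`. -/
def LinModel.backward {n m p : ℕ} (S : LinModel n m p)
    (P : ℝ → Matrix (Fin n) (Fin n) ℝ) : LinModel n m p where
  A := fun t => -(S.A t).transpose
  B := fun t => (P t)⁻¹ * S.B t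
  C := fun t => S.C t * P t + S.D t * (S.B t).transpose
  D := S.D

section System

variable {Ω : Type*} [MeasurableSpace Ω] {ℙ : Measure Ω} {n m p : ℕ}

/-- `w` is, on `[0, T]`, a centered process with orthogonal increments, normalized by
`E{dw dw'} = I dt` (for instance a standard Wiener process). -/
structure IsNormalizedNoise (T : ℝ) (w : ℝ → Fin p → RV ℙ) : Prop where
  centered : ∀ s ∈ Icc 0 T, ∀ t ∈ Icc 0 T, ∀ k, ∫ ω, (w t k - w s k : RV ℙ) ω ∂ℙ = 0
  normalized : ∀ s ∈ Icc 0 T, ∀ t ∈ Icc 0 T, s ≤ t →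
    covMat (w t - w s) (w t - w s) = (t - s) • (1 : Matrix (Fin p) (Fin p) ℝ)
  orthogonal : ∀ s ∈ Icc 0 T, ∀ t ∈ Icc 0 T, ∀ a ∈ Icc 0 T, ∀ b ∈ Icc 0 T,
    s ≤ t → t ≤ a → a ≤ b → covMat (w t - w s) (w b - w a) = 0

/-- `x` and `y` are the state and output processes of the stochastic system
`dx = A x dt + B dw`, `dy = C x dt + D dw`, `y(0) = 0` on `[0, T]`, with `w` normalized noise and
`x(0)` centered and uncorrelated with `w`. -/
structure IsLinearSystem (S : LinModel n m p) (T : ℝ) (w : ℝ → Fin p → RV ℙ)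
    (x : ℝ → Fin n → RV ℙ) (y : ℝ → Fin m → RV ℙ) : Prop where
  noise : IsNormalizedNoise T w
  centered : ∀ i, ∫ ω, x 0 i ω ∂ℙ = 0
  uncorrelated : ∀ s ∈ Icc 0 T, ∀ t ∈ Icc 0 T, covMat (x 0) (w t - w s) = 0
  state : HasStochDifferential (Icc 0 T) x (fun t => S.A t ⊛ x t) S.B w
  output_zero : y 0 = 0
  output : HasStochDifferential (Icc 0 T) y (fun t => S.C t ⊛ x t) S.D w

/-- The state covariance `P(t) = E{x(t) x(t)'}`. -/
def stateCov (x : ℝ → Fin n → RV ℙ) (t : ℝ) : Matrix (Fin n) (Fin n) ℝ :=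
  covMat (x t) (x t)

/-- The state `x̄(t) = P(t)⁻¹ x(t)` of the time-reversed system. -/
def backwardState (x : ℝ → Fin n → RV ℙ) (t : ℝ) : Fin n → RV ℙ :=
  (stateCov x t)⁻¹ ⊛ x t

/-! ### Observation patterns and observation spaces -/

/-- What is observed of `y` on one interval of the time axis: all of `y` (equivalently, all its
increments), or only the total increment `Δy` over the interval, or nothing. -/
inductive ObsMode
  | full
  | increment
  | lost

/-- An intermittent observation pattern on `[0, T]`: a partition `0 = τ_0 < ⋯ < τ_N = T`, with an
observation mode for each of its intervals.

If only `dy` is recorded, the intervals without observation have mode `lost`.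
If `y` itself is recorded, an interval without observation at whose two ends `y` is known has
mode `increment`. -/
structure ObsPattern (T : ℝ) where
  N : ℕ
  τ : Fin (N + 1) → ℝ
  strictMono : StrictMono τ
  first : τ 0 = 0
  last : τ (Fin.last N) = T
  mode : Fin N → ObsMode

/-- Left end of the `i`-th interval. -/
def ObsPattern.left {T : ℝ} (O : ObsPattern T) (i : Fin O.N) : ℝ := O.τ i.castSucc

/-- Right end of the `i`-th interval. -/
def ObsPattern.right {T : ℝ} (O : ObsPattern T) (i : Fin O.N) : ℝ := O.τ i.succ

/-- `H_{[a,b]}(dy)`: the closed subspace generated by the components of the increments of `y`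
over `[a, b]`. -/
def incrSpace (y : ℝ → Fin m → RV ℙ) (a b : ℝ) : ClosedSubmodule ℝ (RV ℙ) :=
  (Submodule.span ℝ {h | ∃ s ∈ Icc a b, ∃ t ∈ Icc a b, ∃ k, h = y t k - y s k}).closure

/-- The closed subspace spanned by what is observed over `[a, b]`. -/
def modeSpace (y : ℝ → Fin m → RV ℙ) (a b : ℝ) : ObsMode → ClosedSubmodule ℝ (RV ℙ)
  | .full => incrSpace y a b
  | .increment => (Submodule.span ℝ (range fun k => y b k - y a k)).closure
  | .lost => ⊥

/-- The space `H°` of all observed data. -/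
def obsSpace {T : ℝ} (O : ObsPattern T) (y : ℝ → Fin m → RV ℙ) : ClosedSubmodule ℝ (RV ℙ) :=
  ⨆ i : Fin O.N, modeSpace y (O.left i) (O.right i) (O.mode i)

/-- `H°_t^- = H° ∩ H_{[0,t]}(dy)`. -/
def obsPast {T : ℝ} (O : ObsPattern T) (y : ℝ → Fin m → RV ℙ) (t : ℝ) :
    ClosedSubmodule ℝ (RV ℙ) :=
  obsSpace O y ⊓ incrSpace y 0 t

/-- `H°_t^+ = H° ∩ H_{[t,T]}(dy)`. -/
def obsFuture {T : ℝ} (O : ObsPattern T) (y : ℝ → Fin m → RV ℙ) (t : ℝ) :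
    ClosedSubmodule ℝ (RV ℙ) :=
  obsSpace O y ⊓ incrSpace y t T

/-! ### Linear least-squares estimates -/

/-- Componentwise orthogonal projection of a random vector onto a closed subspace. -/
def estimate (K : ClosedSubmodule ℝ (RV ℙ)) (v : Fin n → RV ℙ) : Fin n → RV ℙ :=
  fun i => K.toSubmodule.starProjection (v i)

/-- The intermittent forward Kalman estimate `x_-(t)`, the projection of `x(t)` onto `H°_t^-`. -/
def forwardEst {T : ℝ} (O : ObsPattern T) (x : ℝ → Fin n → RV ℙ) (y : ℝ → Fin m → RV ℙ)
    (t : ℝ) : Fin n → RV ℙ :=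
  estimate (obsPast O y t) (x t)

/-- The intermittent backward Kalman estimate `x̄_+(t)`, the projection of `x̄(t)` onto `H°_t^+`. -/
def backwardEst {T : ℝ} (O : ObsPattern T) (x : ℝ → Fin n → RV ℙ) (y : ℝ → Fin m → RV ℙ)
    (t : ℝ) : Fin n → RV ℙ :=
  estimate (obsFuture O y t) (backwardState x t)

/-- The smoothing/interpolation estimate `x̂(t)`, the projection of `x(t)` onto the closed span
`H°_t^- ∨ H°_t^+` of the observed past and the observed future. -/
def smoothEst {T : ℝ} (O : ObsPattern T) (x : ℝ → Fin n → RV ℙ) (y : ℝ → Fin m → RV ℙ)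
    (t : ℝ) : Fin n → RV ℙ :=
  estimate (obsPast O y t ⊔ obsFuture O y t) (x t)

/-- `Q_-(t)`, the error covariance of `x_-(t)`. -/
def forwardErrCov {T : ℝ} (O : ObsPattern T) (x : ℝ → Fin n → RV ℙ) (y : ℝ → Fin m → RV ℙ)
    (t : ℝ) : Matrix (Fin n) (Fin n) ℝ :=
  covMat (x t - forwardEst O x y t) (x t - forwardEst O x y t)

/-- `Q̄_+(t)`, the error covariance of `x̄_+(t)`. -/
def backwardErrCov {T : ℝ} (O : ObsPattern T) (x : ℝ → Fin n → RV ℙ) (y : ℝ → Fin m → RV ℙ)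
    (t : ℝ) : Matrix (Fin n) (Fin n) ℝ :=
  covMat (backwardState x t - backwardEst O x y t) (backwardState x t - backwardEst O x y t)

/-- `Q(t)`, the error covariance of `x̂(t)`. -/
def smoothErrCov {T : ℝ} (O : ObsPattern T) (x : ℝ → Fin n → RV ℙ) (y : ℝ → Fin m → RV ℙ)
    (t : ℝ) : Matrix (Fin n) (Fin n) ℝ :=
  covMat (x t - smoothEst O x y t) (x t - smoothEst O x y t)

/-! ### Cascades of Kalman filters -/

/-- The forward filter `dz = A z dt + K (dy - C z dt)`,
`Q̇ = A Q + Q A' - K R K' + B B'` on the interval `J`. -/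
def ForwardFilterOn (S : LinModel n m p) (J : Set ℝ) (y : ℝ → Fin m → RV ℙ)
    (K : ℝ → Matrix (Fin n) (Fin m) ℝ)
    (z : ℝ → Fin n → RV ℙ) (Q : ℝ → Matrix (Fin n) (Fin n) ℝ) : Prop :=
  HasStochDifferential J z (fun t => S.A t ⊛ z t - K t ⊛ S.C t ⊛ z t) K y ∧
  ∀ t ∈ J, ∀ i j, HasDerivWithinAt (fun s => Q s i j)
    ((S.A t * Q t + Q t * (S.A t).transpose - K t * S.R t * (K t).transpose
      + S.B t * (S.B t).transpose) i j) J t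

/-- The forward Kalman gain `K_- = (Q C' + B D') R⁻¹`. -/
def forwardGain (S : LinModel n m p) (Q : ℝ → Matrix (Fin n) (Fin n) ℝ) (t : ℝ) :
    Matrix (Fin n) (Fin m) ℝ :=
  (Q t * (S.C t).transpose + S.B t * (S.D t).transpose) * (S.R t)⁻¹

/-- The backward filter `dz = Ā z dt + K (dy - C̄ z dt)`,
`Q̇ = Ā Q + Q Ā' + K R K' - B̄ B̄'` on the interval `J`, for a backward model `S̄` (whose `Ā` is
`-A'`). -/
def BackwardFilterOn (Sb : LinModel n m p) (J : Set ℝ) (y : ℝ → Fin m → RV ℙ)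
    (K : ℝ → Matrix (Fin n) (Fin m) ℝ)
    (z : ℝ → Fin n → RV ℙ) (Q : ℝ → Matrix (Fin n) (Fin n) ℝ) : Prop :=
  HasStochDifferential J z (fun t => Sb.A t ⊛ z t - K t ⊛ Sb.C t ⊛ z t) K y ∧
  ∀ t ∈ J, ∀ i j, HasDerivWithinAt (fun s => Q s i j)
    ((Sb.A t * Q t + Q t * (Sb.A t).transpose + K t * Sb.R t * (K t).transpose
      - Sb.B t * (Sb.B t).transpose) i j) J t

/-- The backward Kalman gain `K̄_+ = -(Q C̄' - B̄ D') R⁻¹`. -/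
def backwardGain (Sb : LinModel n m p) (Q : ℝ → Matrix (Fin n) (Fin n) ℝ) (t : ℝ) :
    Matrix (Fin n) (Fin m) ℝ :=
  -((Q t * (Sb.C t).transpose - Sb.B t * (Sb.D t).transpose) * (Sb.R t)⁻¹)

/-- Terms of the Peano–Baker series: `Φ_0 = I`, `Φ_{k+1}(t,s) = ∫_s^t A(τ) Φ_k(τ,s) dτ`. -/
def peanoBaker (A : ℝ → Matrix (Fin n) (Fin n) ℝ) (s : ℝ) :
    ℕ → ℝ → Matrix (Fin n) (Fin n) ℝ
  | 0 => fun _ => 1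
  | k + 1 => fun t => Matrix.of fun i j => ∫ τ in s..t, (A τ * peanoBaker A s k τ) i j

/-- The transition matrix `Φ(t,s)` of `A`: `∂Φ/∂t = A(t) Φ`, `Φ(s,s) = I`. -/
def transition (A : ℝ → Matrix (Fin n) (Fin n) ℝ) (t s : ℝ) : Matrix (Fin n) (Fin n) ℝ :=
  ∑' k, peanoBaker A s k t

/-- `C_d = ∫_a^b C(t) Φ(t,a) dt`. -/
def gapC (S : LinModel n m p) (a b : ℝ) : Matrix (Fin m) (Fin n) ℝ :=
  Matrix.of fun i j => ∫ t in a..b, (S.C t * transition S.A t a) i j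

/-- `M(s) = ∫_s^b C(t) Φ(t,s) dt B(s) + D(s)`, so that the effect of the noise on `y(b) - y(a)` is
`∫_a^b M dw`. -/
def gapM (S : LinModel n m p) (b s : ℝ) : Matrix (Fin m) (Fin p) ℝ :=
  gapC S s b * S.B s + S.D s

/-- `B_d B_d' = ∫ Φ(b,s) B B' Φ(b,s)' ds` over the interval with end points `a` and `b`. -/
def gapBB (S : LinModel n m p) (a b : ℝ) : Matrix (Fin n) (Fin n) ℝ :=
  Matrix.of fun i j => ∫ s in uIcc a b,
    (transition S.A b s * S.B s * (transition S.A b s * S.B s).transpose) i j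

/-- `B_d D_d' = ∫ Φ(b,s) B M(s)' ds` over the interval with end points `a` and `b`. -/
def gapBD (S : LinModel n m p) (a b : ℝ) : Matrix (Fin n) (Fin m) ℝ :=
  Matrix.of fun i j => ∫ s in uIcc a b,
    (transition S.A b s * S.B s * (gapM S b s).transpose) i j

/-- `D_d D_d' = ∫ M(s) M(s)' ds` over the interval with end points `a` and `b`. -/
def gapDD (S : LinModel n m p) (a b : ℝ) : Matrix (Fin m) (Fin m) ℝ :=
  Matrix.of fun i j => ∫ s in uIcc a b, (gapM S b s * (gapM S b s).transpose) i j

/-- Innovation covariance `C_d Q(a) C_d' + D_d D_d'` of the discrete-time step. -/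
def gapInnov (S : LinModel n m p) (Q : ℝ → Matrix (Fin n) (Fin n) ℝ) (a b : ℝ) :
    Matrix (Fin m) (Fin m) ℝ :=
  gapC S a b * Q a * (gapC S a b).transpose + gapDD S a b

/-- `K_d = (A_d Q(a) C_d' + B_d D_d') (C_d Q(a) C_d' + D_d D_d')⁻¹` with `A_d = Φ(b,a)`. -/
def gapGain (S : LinModel n m p) (Q : ℝ → Matrix (Fin n) (Fin n) ℝ) (a b : ℝ) :
    Matrix (Fin n) (Fin m) ℝ :=
  (transition S.A b a * Q a * (gapC S a b).transpose + gapBD S a b) * (gapInnov S Q a b)⁻¹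

/-- The discrete-time Kalman step from time `a` to time `b` across a gap over which only the
increment of `y` is known. It is used with `a < b` for a forward model and with `b < a` for a
backward one: the relations `x(b) = A_d x(a) + B_d v`, `y(b) - y(a) = C_d x(a) + D_d v` have the
same form in both directions, the noise being uncorrelated with `x(a)` and with the data that
were processed before. -/
def GapStep (S : LinModel n m p) (y : ℝ → Fin m → RV ℙ)
    (z : ℝ → Fin n → RV ℙ) (Q : ℝ → Matrix (Fin n) (Fin n) ℝ) (a b : ℝ) : Prop :=
  z b = transition S.A b a ⊛ z a + gapGain S Q a b ⊛ (y b - y a - gapC S a b ⊛ z a) ∧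
  Q b = transition S.A b a * Q a * (transition S.A b a).transpose
    - gapGain S Q a b * gapInnov S Q a b * (gapGain S Q a b).transpose + gapBB S a b

/-- `(z, Q)` is generated on `[0, T]` by the forward cascade with initial values
`z(0) = 0`, `Q(0) = Q₀`: the continuous-time Kalman filter where `y` is observed, the same filter
with zero gain where nothing is observed, and, across an interval of which only `Δy` is observed,
the filter with zero gain followed by a discrete-time step when its right end is reached. -/
structure ForwardCascade (S : LinModel n m p) {T : ℝ} (O : ObsPattern T)
    (y : ℝ → Fin m → RV ℙ) (Q₀ : Matrix (Fin n) (Fin n) ℝ)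
    (z : ℝ → Fin n → RV ℙ) (Q : ℝ → Matrix (Fin n) (Fin n) ℝ) : Prop where
  init_est : z 0 = 0
  init_cov : Q 0 = Q₀
  full : ∀ i, O.mode i = .full →
    ForwardFilterOn S (Icc (O.left i) (O.right i)) y (forwardGain S Q) z Q
  lost : ∀ i, O.mode i = .lost →
    ForwardFilterOn S (Icc (O.left i) (O.right i)) y 0 z Q
  increment : ∀ i, O.mode i = .increment →
    ForwardFilterOn S (Ico (O.left i) (O.right i)) y 0 z Q ∧
    IsUnit (gapInnov S Q (O.left i) (O.right i)) ∧
    GapStep S y z Q (O.left i) (O.right i)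

/-- `(z, Q)` is generated on `[0, T]` by the backward cascade, started from `z(T) = 0`,
`Q(T) = Q₁`, for the backward model `Sb`. -/
structure BackwardCascade (Sb : LinModel n m p) {T : ℝ} (O : ObsPattern T)
    (y : ℝ → Fin m → RV ℙ) (Q₁ : Matrix (Fin n) (Fin n) ℝ)
    (z : ℝ → Fin n → RV ℙ) (Q : ℝ → Matrix (Fin n) (Fin n) ℝ) : Prop where
  final_est : z T = 0
  final_cov : Q T = Q₁
  full : ∀ i, O.mode i = .full →
    BackwardFilterOn Sb (Icc (O.left i) (O.right i)) y (backwardGain Sb Q) z Q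
  lost : ∀ i, O.mode i = .lost →
    BackwardFilterOn Sb (Icc (O.left i) (O.right i)) y 0 z Q
  increment : ∀ i, O.mode i = .increment →
    BackwardFilterOn Sb (Ioc (O.left i) (O.right i)) y 0 z Q ∧
    IsUnit (gapInnov Sb Q (O.right i) (O.left i)) ∧
    GapStep Sb y z Q (O.right i) (O.left i)

end System

end

/-!
The theorem is one about second moments only, so the noise `w` is eliminated first. `Core` records
what remains: the noise `(x, y) - ∫ (A x, C x) dt` of the stacked process has orthogonal increments
with covariance density `(B; D)(B; D)'`, it is orthogonal to the past, and the state has unit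
covariance. `IsLinearSystem.core` derives this from the stochastic equations, with everything
extended by constants beyond `[0, T]` so that all functions are continuous on the line. Covariances
of driven processes are then governed by the product rule `inner_sub_inner_eq_integral`, and hence by
linear matrix differential equations.

*Filtering.* The Riccati equation has a global solution (`exists_riccati`), obtained from the
Hamiltonian linear system. For the linear filter whose gain is built from this solution, the
covariances of its error with the state and with the observed output solve linear equations, whose
uniqueness shows that the error is orthogonal to the data and that its covariance is the Riccati
solution (`Core.kalman`). Without observations the estimate is transported by the transition matrix;
across a gap over which only the increment of the output is known, one least-squares update
(`estimate_sup_span`) gives the discrete step (`Core.gapStep`).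

*The observed past.* The data space at time `t` is defined as an intersection of subspaces, and has
to be shown to grow interval by interval. Given `x(t)`, the past and the future increments of the
output are conditionally orthogonal (`Core.isSplitting`), and the error covariance given the whole
past is positive definite (`Core.posDef_errCov_past`). Together these yield a continuous oblique
projection onto the past along the future, so that future data contribute nothing to the past
(`IsSplitting.sup_inf_le`). The recursions `Core.obsPast_full`, `Core.obsPast_lost` and
`Core.obsPast_increment` follow, and with them the forward cascade `Core.taggedCascade`.

*The backward cascade.* The noise of the time-reversed process is explicit (`backNoise`), and
`Core.rev` shows that the reversed process satisfies the same second-order description. The forward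
cascade for it, transported back, is the backward cascade (`TaggedCascade.of_reflect`). Stochastic
integrals are treated as limits of arbitrarily tagged Riemann–Stieltjes sums throughout, because this
notion, unlike the one with tags at left end points, is invariant under time reversal.

*Two filters.* Conditional orthogonality of past and future given `x(t)` reduces the combination
formula to linear algebra (`IsSplitting.estimate_sup`); `Q(t)⁻¹` is positive definite because
`Q₋(t) ≤ 1`.
-/

section KalmanCascade

open Filter Topology Matrix

/-! ### Entrywise derivatives of matrix functions -/

/-- Entrywise derivative of a matrix function within a set. -/
def HasMatDeriv {ι κ : Type*} (M : ℝ → Matrix ι κ ℝ) (M' : Matrix ι κ ℝ) (s : Set ℝ) (t : ℝ) :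
    Prop :=
  ∀ i j, HasDerivWithinAt (fun τ => M τ i j) (M' i j) s t

namespace HasMatDeriv

variable {ι κ l : Type*} {M : ℝ → Matrix ι κ ℝ} {M' : Matrix ι κ ℝ}
  {N : ℝ → Matrix κ l ℝ} {N' : Matrix κ l ℝ} {s : Set ℝ} {t : ℝ}

theorem mul [Fintype κ] (hM : HasMatDeriv M M' s t) (hN : HasMatDeriv N N' s t) :
    HasMatDeriv (fun τ => M τ * N τ) (M' * N t + M t * N') s t := by
  intro i j
  simp only [Matrix.mul_apply, Matrix.add_apply, ← Finset.sum_add_distrib]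
  exact HasDerivWithinAt.fun_sum fun k _ => (hM i k).mul (hN k j)

theorem transpose (hM : HasMatDeriv M M' s t) : HasMatDeriv (fun τ => (M τ)ᵀ) M'ᵀ s t :=
  fun i j => hM j i

theorem add {M₂ : ℝ → Matrix ι κ ℝ} {M₂' : Matrix ι κ ℝ} (hM : HasMatDeriv M M' s t)
    (hN : HasMatDeriv M₂ M₂' s t) : HasMatDeriv (fun τ => M τ + M₂ τ) (M' + M₂') s t :=
  fun i j => (hM i j).add (hN i j)

theorem sub {M₂ : ℝ → Matrix ι κ ℝ} {M₂' : Matrix ι κ ℝ} (hM : HasMatDeriv M M' s t)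
    (hN : HasMatDeriv M₂ M₂' s t) : HasMatDeriv (fun τ => M τ - M₂ τ) (M' - M₂') s t :=
  fun i j => (hM i j).sub (hN i j)

theorem const (M₀ : Matrix ι κ ℝ) : HasMatDeriv (fun _ => M₀) 0 s t :=
  fun i j => hasDerivWithinAt_const t s (M₀ i j)

theorem mono {u : Set ℝ} (h : HasMatDeriv M M' s t) (hu : u ⊆ s) : HasMatDeriv M M' u t :=
  fun i j => (h i j).mono hu

theorem eq_of_deriv_eq_zero {a b : ℝ} (h : ∀ τ ∈ Icc a b, HasMatDeriv M 0 (Icc a b) τ)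
    (ht : t ∈ Icc a b) : M t = M a := by
  ext i j
  have hd : DifferentiableOn ℝ (fun τ => M τ i j) (Icc a b) :=
    fun τ hτ => (h τ hτ i j).differentiableWithinAt
  refine constant_of_derivWithin_zero hd (fun τ hτ => ?_) t ht
  have hτ' := Ico_subset_Icc_self hτ
  exact (h τ hτ' i j).derivWithin
    (uniqueDiffOn_Icc (lt_of_le_of_lt hτ.1 hτ.2) τ hτ')

/-- Two matrix functions with the same derivative on `[a, b]` have the same increments. -/
theorem sub_eq_sub {a b : ℝ} {M₂ : ℝ → Matrix ι κ ℝ} {D : ℝ → Matrix ι κ ℝ}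
    (h₁ : ∀ τ ∈ Icc a b, HasMatDeriv M (D τ) (Icc a b) τ)
    (h₂ : ∀ τ ∈ Icc a b, HasMatDeriv M₂ (D τ) (Icc a b) τ) (ht : t ∈ Icc a b) :
    M t - M a = M₂ t - M₂ a := by
  have := eq_of_deriv_eq_zero (M := fun τ => M τ - M₂ τ) (a := a) (b := b)
    (fun τ hτ => by simpa using (h₁ τ hτ).sub (h₂ τ hτ)) ht
  rw [sub_eq_sub_iff_sub_eq_sub, this]

end HasMatDeriv

/-- The entrywise integral of a continuous matrix function is a primitive of it. -/
theorem hasMatDeriv_integral {ι κ : Type*} {M : ℝ → Matrix ι κ ℝ} (hM : Continuous M) (a : ℝ)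
    (s : Set ℝ) (t : ℝ) :
    HasMatDeriv (fun τ => Matrix.of fun i j => ∫ σ in a..τ, M σ i j) (M t) s t := by
  intro i j
  have hc : Continuous fun σ => M σ i j := by fun_prop
  exact ((hc.integral_hasStrictDerivAt a t).hasDerivAt).hasDerivWithinAt

/-! ### The transition matrix -/

section Transition

variable {n : ℕ}

theorem peanoBaker_continuous {A : ℝ → Matrix (Fin n) (Fin n) ℝ} (hA : Continuous A) (s : ℝ)
    (k : ℕ) : Continuous (peanoBaker A s k) := by
  induction k with
  | zero => exact continuous_const
  | succ k ih =>
    refine continuous_matrix fun i j => ?_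
    have hc : Continuous fun τ => (A τ * peanoBaker A s k τ) i j := by fun_prop
    exact intervalIntegral.continuous_primitive (fun a b => hc.intervalIntegrable a b) s

/-- The factorial bound for the terms of the Peano–Baker series. -/
theorem abs_peanoBaker_le {A : ℝ → Matrix (Fin n) (Fin n) ℝ} {s r α : ℝ}
    (hα : ∀ τ, |τ - s| ≤ r → ∀ i j, |A τ i j| ≤ α) (k : ℕ) :
    ∀ t, |t - s| ≤ r → ∀ i j, |peanoBaker A s k t i j| ≤ (n * α * |t - s|) ^ k / k.factorial := by
  induction k with
  | zero =>
    intro t _ i j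
    by_cases h : i = j <;> simp [peanoBaker, Matrix.one_apply, h]
  | succ k ih =>
    intro t ht i j
    have hα0 : 0 ≤ α := (abs_nonneg _).trans (hα t ht i j)
    have hpt : ∀ τ ∈ uIoc s t, ‖(A τ * peanoBaker A s k τ) i j‖ ≤
        n * α * ((n * α * |τ - s|) ^ k / k.factorial) := by
      intro τ hτ
      have hτr : |τ - s| ≤ r := (abs_sub_left_of_mem_uIcc (uIoc_subset_uIcc hτ)).trans ht
      rw [Matrix.mul_apply]
      refine (norm_sum_le _ _).trans ?_
      calc ∑ l, ‖A τ i l * peanoBaker A s k τ l j‖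
          ≤ ∑ _l : Fin n, α * ((n * α * |τ - s|) ^ k / k.factorial) := by
            refine Finset.sum_le_sum fun l _ => ?_
            rw [norm_mul]
            exact mul_le_mul (hα τ hτr i l) (ih τ hτr l j) (norm_nonneg _) hα0
        _ = _ := by simp; ring
    have h1 : (fun τ => n * α * ((n * α * |τ - s|) ^ k / k.factorial)) =
        fun τ => (n * α) ^ (k + 1) / k.factorial * |τ - s| ^ k := by
      ext τ; rw [mul_pow]; ring
    calc |peanoBaker A s (k + 1) t i j|
        = ‖∫ τ in s..t, (A τ * peanoBaker A s k τ) i j‖ := rfl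
      _ ≤ |∫ τ in s..t, n * α * ((n * α * |τ - s|) ^ k / k.factorial)| := by
          refine intervalIntegral.norm_integral_le_abs_of_norm_le ?_ ?_
          · exact (ae_restrict_iff' measurableSet_uIoc).2 (Eventually.of_forall hpt)
          · exact Continuous.intervalIntegrable (by fun_prop) _ _
      _ = (n * α * |t - s|) ^ (k + 1) / (k + 1).factorial := by
          rw [h1, intervalIntegral.integral_const_mul, abs_mul,
            intervalIntegral.abs_intervalIntegral_eq, integral_pow_abs_sub_uIoc,
            abs_of_nonneg (by positivity), abs_of_nonneg (by positivity), Nat.factorial_succ]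
          push_cast
          field_simp
          rw [← mul_pow]

/-- Entries of a continuous matrix function are uniformly bounded on compact intervals. -/
theorem exists_entry_bound {ι κ : Type*} [Finite ι] [Finite κ] {A : ℝ → Matrix ι κ ℝ}
    (hA : Continuous A) {s : Set ℝ} (hs : IsCompact s) :
    ∃ α, 0 ≤ α ∧ ∀ τ ∈ s, ∀ i j, |A τ i j| ≤ α := by
  have := Fintype.ofFinite ι
  have := Fintype.ofFinite κ
  have hc : Continuous fun τ => ∑ i, ∑ j, |A τ i j| := by fun_prop
  obtain ⟨α, hα⟩ := hs.exists_bound_of_continuousOn hc.continuousOn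
  refine ⟨max α 0, le_max_right _ _, fun τ hτ i j => ?_⟩
  refine le_max_of_le_left (le_trans ?_ ((le_abs_self _).trans (hα τ hτ)))
  exact (Finset.single_le_sum (f := fun j => |A τ i j|) (fun j _ => abs_nonneg _)
    (Finset.mem_univ j)).trans
    (Finset.single_le_sum (f := fun i => ∑ j, |A τ i j|)
      (fun i _ => Finset.sum_nonneg fun j _ => abs_nonneg _) (Finset.mem_univ i))

theorem peanoBaker_bound {A : ℝ → Matrix (Fin n) (Fin n) ℝ} (hA : Continuous A) (s r : ℝ) :
    ∃ β : ℝ, 0 ≤ β ∧ ∀ k, ∀ t ∈ Icc (s - r) (s + r), ∀ i j,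
      |peanoBaker A s k t i j| ≤ β ^ k / k.factorial := by
  obtain ⟨α, hα0, hα⟩ := exists_entry_bound hA (isCompact_Icc (a := s - r) (b := s + r))
  refine ⟨n * α * |r|, by positivity, fun k t ht i j => ?_⟩
  have hmem : ∀ τ, |τ - s| ≤ r → τ ∈ Icc (s - r) (s + r) := fun τ hτ => by
    rw [abs_le] at hτ; constructor <;> linarith
  have ht' : |t - s| ≤ r := by rw [abs_le]; constructor <;> linarith [ht.1, ht.2]
  refine (abs_peanoBaker_le (fun τ hτ i j => hα τ (hmem τ hτ) i j) k t ht' i j).trans ?_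
  have : |t - s| ≤ |r| := ht'.trans (le_abs_self r)
  gcongr

theorem hasSum_transition {A : ℝ → Matrix (Fin n) (Fin n) ℝ} (hA : Continuous A) (s t : ℝ)
    (i j : Fin n) : HasSum (fun k => peanoBaker A s k t i j) (transition A t s i j) := by
  obtain ⟨β, hβ, h⟩ := peanoBaker_bound hA s |t - s|
  have ht : t ∈ Icc (s - |t - s|) (s + |t - s|) := by
    constructor <;> linarith [neg_abs_le (t - s), le_abs_self (t - s)]
  have hsum : Summable fun k => peanoBaker A s k t :=
    Pi.summable.2 fun i => Pi.summable.2 fun j =>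
      Summable.of_norm_bounded (Real.summable_pow_div_factorial β) fun k => h k t ht i j
  exact Pi.hasSum.1 (Pi.hasSum.1 hsum.hasSum i) j

theorem transition_continuous {A : ℝ → Matrix (Fin n) (Fin n) ℝ} (hA : Continuous A) (s : ℝ) :
    Continuous fun t => transition A t s := by
  refine continuous_matrix fun i j => continuous_iff_continuousAt.2 fun t => ?_
  obtain ⟨β, hβ, h⟩ := peanoBaker_bound hA s (|t - s| + 1)
  have heq : (fun t => transition A t s i j) = fun t => ∑' k, peanoBaker A s k t i j :=
    funext fun t => (hasSum_transition hA s t i j).tsum_eq.symm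
  rw [heq]
  refine (continuousOn_tsum (s := Icc (s - (|t - s| + 1)) (s + (|t - s| + 1)))
    (fun k => ((peanoBaker_continuous hA s k).matrix_elem i j).continuousOn)
    (Real.summable_pow_div_factorial β) fun k t ht => h k t ht i j).continuousAt ?_
  exact Icc_mem_nhds (by linarith [neg_abs_le (t - s)]) (by linarith [le_abs_self (t - s)])

theorem transition_eq_integral {A : ℝ → Matrix (Fin n) (Fin n) ℝ} (hA : Continuous A)
    (s t : ℝ) : transition A t s =
      1 + Matrix.of fun i j => ∫ τ in s..t, (A τ * transition A τ s) i j := by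
  ext i j
  obtain ⟨β, hβ, h⟩ := peanoBaker_bound hA s |t - s|
  obtain ⟨α, hα0, hα⟩ := exists_entry_bound hA (isCompact_uIcc (a := s) (b := t))
  have hmem : ∀ τ ∈ uIoc s t, τ ∈ Icc (s - |t - s|) (s + |t - s|) := fun τ hτ => by
    have := abs_le.1 (abs_sub_left_of_mem_uIcc (uIoc_subset_uIcc hτ))
    constructor <;> linarith
  have hs := intervalIntegral.hasSum_integral_of_dominated_convergence (μ := volume)
    (F := fun k τ => (A τ * peanoBaker A s k τ) i j) (a := s) (b := t)
    (f := fun τ => (A τ * transition A τ s) i j)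
    (fun k _ => n * (α * (β ^ k / k.factorial)))
    (fun k => by
      have := peanoBaker_continuous hA s k
      exact Continuous.aestronglyMeasurable (by fun_prop))
    (fun k => Eventually.of_forall fun τ hτ => by
      rw [Matrix.mul_apply]
      refine (norm_sum_le _ _).trans ((Finset.sum_le_sum (g := fun _ => α * (β ^ k / k.factorial))
        fun l _ => ?_).trans (by simp))
      rw [norm_mul]
      exact mul_le_mul (hα τ (uIoc_subset_uIcc hτ) i l) (h k τ (hmem τ hτ) l j)
        (norm_nonneg _) hα0)
    (Eventually.of_forall fun τ _ => ((Real.summable_pow_div_factorial β).mul_left α).mul_left _)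
    (by simp)
    (Eventually.of_forall fun τ _ => by
      simp only [Matrix.mul_apply]
      exact hasSum_sum fun l _ => (hasSum_transition hA s τ l j).mul_left _)
  have h0 := (hasSum_transition hA s t i j)
  have h1 : HasSum (fun k => peanoBaker A s (k + 1) t i j)
      (transition A t s i j - (1 : Matrix (Fin n) (Fin n) ℝ) i j) := by
    rw [hasSum_nat_add_iff (f := fun k => peanoBaker A s k t i j) 1]
    simpa [peanoBaker] using h0
  have := h1.unique hs
  simp only [Matrix.add_apply, Matrix.of_apply]
  linarith

theorem transition_self {A : ℝ → Matrix (Fin n) (Fin n) ℝ} (hA : Continuous A) (s : ℝ) :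
    transition A s s = 1 := by
  rw [transition_eq_integral hA]; ext i j; simp

theorem hasMatDeriv_transition {A : ℝ → Matrix (Fin n) (Fin n) ℝ} (hA : Continuous A)
    (r t : ℝ) (s : Set ℝ) :
    HasMatDeriv (fun τ => transition A τ r) (A t * transition A t r) s t := by
  have hc : Continuous fun τ => A τ * transition A τ r := hA.mul (transition_continuous hA r)
  have := (HasMatDeriv.const (s := s) (t := t) (1 : Matrix (Fin n) (Fin n) ℝ)).add
    (hasMatDeriv_integral hc r s t)
  simp only [zero_add] at this
  simpa only [← transition_eq_integral hA] using this

/-- If `Y' = -Y A` and `Z' = A Z`, then `Y Z` is constant. -/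
theorem eq_mul_of_hasMatDeriv {k : ℕ} {A Y : ℝ → Matrix (Fin n) (Fin n) ℝ}
    {Z : ℝ → Matrix (Fin n) (Fin k) ℝ} {a b t : ℝ}
    (hY : ∀ τ, HasMatDeriv Y (-(Y τ * A τ)) (Icc a b) τ)
    (hZ : ∀ τ ∈ Icc a b, HasMatDeriv Z (A τ * Z τ) (Icc a b) τ) (ht : t ∈ Icc a b) :
    Y t * Z t = Y a * Z a := by
  refine HasMatDeriv.eq_of_deriv_eq_zero (M := fun τ => Y τ * Z τ) (fun τ hτ => ?_) ht
  have := (hY τ).mul (hZ τ hτ)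
  rwa [Matrix.neg_mul, Matrix.mul_assoc, neg_add_cancel] at this

/-- The transition matrix factorizes through a fundamental solution `X` and its inverse `Y`. -/
structure IsFundamental (A X Y : ℝ → Matrix (Fin n) (Fin n) ℝ) : Prop where
  deriv_left : ∀ s t, HasMatDeriv X (A t * X t) s t
  deriv_right : ∀ s t, HasMatDeriv Y (-(Y t * A t)) s t
  mul_inv : ∀ t, X t * Y t = 1
  inv_mul : ∀ t, Y t * X t = 1
  cont_left : Continuous X
  cont_right : Continuous Y
  transition_eq : ∀ t s, transition A t s = X t * Y s

theorem exists_isFundamental {A : ℝ → Matrix (Fin n) (Fin n) ℝ} (hA : Continuous A) :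
    ∃ X Y, IsFundamental A X Y := by
  have hA' : Continuous fun t => -(A t)ᵀ := by fun_prop
  set X := fun t => transition A t 0
  set Y := fun t => (transition (fun t => -(A t)ᵀ) t 0)ᵀ
  have hX : ∀ s t, HasMatDeriv X (A t * X t) s t := fun s t => hasMatDeriv_transition hA 0 t s
  have hY : ∀ s t, HasMatDeriv Y (-(Y t * A t)) s t := fun s t => by
    have := (hasMatDeriv_transition hA' 0 t s).transpose
    simpa [Y, Matrix.transpose_mul] using this
  have hconst : ∀ t, Y t * X t = 1 := by
    have h0 : Y 0 * X 0 = 1 := by simp [X, Y, transition_self hA, transition_self hA']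
    have hd : ∀ a b, ∀ τ ∈ Icc a b, HasMatDeriv (fun τ => Y τ * X τ) 0 (Icc a b) τ := by
      intro a b τ _
      have := (hY (Icc a b) τ).mul (hX (Icc a b) τ)
      rwa [Matrix.neg_mul, Matrix.mul_assoc, neg_add_cancel] at this
    intro t
    rcases le_total 0 t with h | h
    · exact (HasMatDeriv.eq_of_deriv_eq_zero (hd 0 t) (right_mem_Icc.2 h)).trans h0
    · exact (HasMatDeriv.eq_of_deriv_eq_zero (hd t 0) (right_mem_Icc.2 h)).symm.trans h0
  refine ⟨X, Y, hX, hY, fun t => mul_eq_one_comm.1 (hconst t), hconst,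
    transition_continuous hA 0, (transition_continuous hA' 0).matrix_transpose, fun t s => ?_⟩
  have hd : ∀ τ, HasMatDeriv (fun τ => Y τ * transition A τ s) 0 univ τ := by
    intro τ
    have := (hY univ τ).mul (hasMatDeriv_transition hA s τ univ)
    rwa [Matrix.neg_mul, Matrix.mul_assoc, neg_add_cancel] at this
  have : Y t * transition A t s = Y s * transition A s s := by
    rcases le_total s t with h | h
    · exact HasMatDeriv.eq_of_deriv_eq_zero (fun τ _ => (hd τ).mono (subset_univ (Icc s t)))
        (right_mem_Icc.2 h)
    · exact (HasMatDeriv.eq_of_deriv_eq_zero (fun τ _ => (hd τ).mono (subset_univ (Icc t s)))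
        (right_mem_Icc.2 h)).symm
  rw [transition_self hA, Matrix.mul_one] at this
  rw [← this, ← Matrix.mul_assoc, mul_eq_one_comm.1 (hconst t), Matrix.one_mul]

end Transition

/-! ### Riemann–Stieltjes sums over tagged partitions -/

/-- A tagged partition: division points `u 0 ≤ ⋯ ≤ u N` and tags `τ k`. -/
structure TagPart where
  N : ℕ
  u : ℕ → ℝ
  τ : ℕ → ℝ

/-- `P` is a tagged partition of `[a, b]` of mesh less than `δ`. -/
structure TagPart.IsOn (P : TagPart) (a b δ : ℝ) : Prop where
  mono : Monotone P.u
  first : P.u 0 = a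
  last : P.u P.N = b
  mesh : ∀ k < P.N, P.u (k + 1) - P.u k < δ
  tag : ∀ k < P.N, P.τ k ∈ Icc (P.u k) (P.u (k + 1))

/-- The filter of tagged partitions of `[a, b]` whose mesh tends to zero. -/
def meshFilter (a b : ℝ) : Filter TagPart := ⨅ δ ∈ Ioi (0 : ℝ), 𝓟 {P | P.IsOn a b δ}

theorem TagPart.IsOn.weaken {P : TagPart} {a b δ δ' : ℝ} (h : P.IsOn a b δ) (hd : δ ≤ δ') :
    P.IsOn a b δ' :=
  ⟨h.mono, h.first, h.last, fun k hk => (h.mesh k hk).trans_le hd, h.tag⟩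

theorem meshFilter_hasBasis (a b : ℝ) :
    (meshFilter a b).HasBasis (fun δ : ℝ => 0 < δ) fun δ => {P | P.IsOn a b δ} := by
  refine hasBasis_biInf_principal' (ι := ℝ) (p := fun δ => 0 < δ) (fun δ hδ δ' hδ' => ?_)
    ⟨1, one_pos⟩
  exact ⟨min δ δ', lt_min hδ hδ', fun P hP => hP.weaken (min_le_left _ _),
    fun P hP => hP.weaken (min_le_right _ _)⟩

theorem eventually_isOn (a b : ℝ) {δ : ℝ} (hδ : 0 < δ) :
    ∀ᶠ P in meshFilter a b, P.IsOn a b δ :=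
  (meshFilter_hasBasis a b).mem_of_mem hδ

/-- Uniform partitions show that there are partitions of arbitrarily small mesh. -/
theorem meshFilter_neBot {a b : ℝ} (hab : a ≤ b) : (meshFilter a b).NeBot := by
  refine (meshFilter_hasBasis a b).neBot_iff.2 fun {δ} hδ => ?_
  obtain ⟨N, hN⟩ := exists_nat_gt ((b - a) / δ)
  have hN0 : (0 : ℝ) < N + 1 := by positivity
  have hstep : 0 ≤ (b - a) / (N + 1) := div_nonneg (sub_nonneg.2 hab) hN0.le
  refine ⟨⟨N + 1, fun k => a + k * ((b - a) / (N + 1)), fun k => a + k * ((b - a) / (N + 1))⟩,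
    ⟨fun k l hkl => ?_, by simp, ?_, fun k _ => ?_, fun k _ => ⟨le_rfl, ?_⟩⟩⟩
  · have : (k : ℝ) ≤ l := by exact_mod_cast hkl
    dsimp only; gcongr
  · push_cast; field_simp; ring
  · have : (b - a) / (N + 1) < δ := by
      rw [div_lt_iff₀ hδ] at hN
      rw [div_lt_iff₀ hN0]; nlinarith
    push_cast; linarith
  · push_cast; linarith

theorem TagPart.IsOn.u_mem {P : TagPart} {a b δ : ℝ} (h : P.IsOn a b δ) {k : ℕ} (hk : k ≤ P.N) :
    P.u k ∈ Icc a b := by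
  constructor
  · rw [← h.first]; exact h.mono (Nat.zero_le k)
  · rw [← h.last]; exact h.mono hk

theorem TagPart.IsOn.tag_mem {P : TagPart} {a b δ : ℝ} (h : P.IsOn a b δ) {k : ℕ} (hk : k < P.N) :
    P.τ k ∈ Icc a b :=
  ⟨(h.u_mem hk.le).1.trans (h.tag k hk).1, (h.tag k hk).2.trans (h.u_mem hk).2⟩

section RiemannSum

variable {E : Type*} [NormedAddCommGroup E]

/-- A bound proportional to the length of each cell adds up. -/
theorem TagPart.IsOn.norm_sum_le {P : TagPart} {a b δ c : ℝ} (h : P.IsOn a b δ) {r : ℕ → E}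
    (hr : ∀ k < P.N, ‖r k‖ ≤ c * (P.u (k + 1) - P.u k)) :
    ‖∑ k ∈ Finset.range P.N, r k‖ ≤ c * (b - a) := by
  refine (_root_.norm_sum_le _ _).trans ?_
  refine (Finset.sum_le_sum fun k hk => hr k (Finset.mem_range.1 hk)).trans ?_
  rw [← Finset.mul_sum, Finset.sum_range_sub, h.first, h.last]

/-- Uniform smallness of the cellwise errors makes the sums converge. -/
theorem tendsto_sum_of_cell_error {a b : ℝ} (hab : a ≤ b) {r : TagPart → ℕ → E} {v : E}
    (h : ∀ ε > 0, ∃ δ > 0, ∀ P : TagPart, P.IsOn a b δ →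
      ∃ q : ℕ → E, ∑ k ∈ Finset.range P.N, q k = v ∧
        ∀ k < P.N, ‖r P k - q k‖ ≤ ε * (P.u (k + 1) - P.u k)) :
    Tendsto (fun P => ∑ k ∈ Finset.range P.N, r P k) (meshFilter a b) (𝓝 v) := by
  rw [Metric.tendsto_nhds]
  intro ε hε
  have hpos : 0 < b - a + 1 := by linarith
  obtain ⟨δ, hδ, hP⟩ := h (ε / (b - a + 1)) (by positivity)
  filter_upwards [eventually_isOn a b hδ] with P hPon
  obtain ⟨q, hq, hk⟩ := hP P hPon
  rw [dist_eq_norm, ← hq, ← Finset.sum_sub_distrib]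
  refine (hPon.norm_sum_le hk).trans_lt ?_
  rw [div_mul_eq_mul_div, div_lt_iff₀ hpos]
  nlinarith

theorem exists_modulus {F : Type*} [NormedAddCommGroup F] {f : ℝ → F} (hf : Continuous f)
    (a b : ℝ) {ε : ℝ} (hε : 0 < ε) :
    ∃ δ > 0, ∀ s ∈ Icc a b, ∀ t ∈ Icc a b, |s - t| < δ → ‖f s - f t‖ ≤ ε := by
  have := (isCompact_Icc (a := a) (b := b)).uniformContinuousOn_of_continuous hf.continuousOn
  obtain ⟨δ, hδ, h⟩ := Metric.uniformContinuousOn_iff.1 this ε hε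
  exact ⟨δ, hδ, fun s hs t ht hst => by
    simpa [dist_eq_norm] using (h s hs t ht (by simpa [Real.dist_eq] using hst)).le⟩

variable [NormedSpace ℝ E]

/-- The Riemann–Stieltjes sum of `f dz` over a tagged partition. -/
def rsum (f : ℝ → ℝ) (z : ℝ → E) (P : TagPart) : E :=
  ∑ k ∈ Finset.range P.N, f (P.τ k) • (z (P.u (k + 1)) - z (P.u k))

/-- Riemann sums of `f dG` with `dG = g dt` converge to `∫ f g dt`. -/
theorem tendsto_rsum_primitive {a b : ℝ} (hab : a ≤ b) {f : ℝ → ℝ} {g G : ℝ → E}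
    (hf : Continuous f) (hg : Continuous g)
    (hG : ∀ s ∈ Icc a b, ∀ t ∈ Icc a b, s ≤ t → G t - G s = ∫ τ in s..t, g τ) :
    Tendsto (rsum f G) (meshFilter a b) (𝓝 (∫ τ in a..b, f τ • g τ)) := by
  obtain ⟨L, hL⟩ := (isCompact_Icc (a := a) (b := b)).exists_bound_of_continuousOn hg.continuousOn
  have hL0 : 0 ≤ L := (norm_nonneg _).trans (hL a (left_mem_Icc.2 hab))
  have hi : ∀ s t, IntervalIntegrable (fun τ => f τ • g τ) volume s t :=
    fun s t => (hf.smul hg).intervalIntegrable _ _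
  have hc : ∀ (v : ℝ) s t, IntervalIntegrable (fun τ => v • g τ) volume s t :=
    fun v s t => (hg.const_smul v).intervalIntegrable _ _
  refine tendsto_sum_of_cell_error hab fun ε hε => ?_
  obtain ⟨δ, hδ, hm⟩ := exists_modulus hf a b (ε := ε / (L + 1)) (by positivity)
  refine ⟨δ, hδ, fun P hP => ⟨fun k => ∫ τ in P.u k..P.u (k + 1), f τ • g τ, ?_, fun k hk => ?_⟩⟩
  · rw [intervalIntegral.sum_integral_adjacent_intervals (fun k _ => hi _ _), hP.first, hP.last]
  · have hle : P.u k ≤ P.u (k + 1) := hP.mono k.le_succ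
    dsimp only
    rw [hG _ (hP.u_mem hk.le) _ (hP.u_mem hk) hle, ← intervalIntegral.integral_smul,
      ← intervalIntegral.integral_sub (hc _ _ _) (hi _ _)]
    have := intervalIntegral.norm_integral_le_of_norm_le_const (a := P.u k) (b := P.u (k + 1))
      (f := fun τ => f (P.τ k) • g τ - f τ • g τ) (C := ε) fun τ hτ => ?_
    · rwa [abs_of_nonneg (sub_nonneg.2 hle)] at this
    · rw [uIoc_of_le hle] at hτ
      have hτ' : τ ∈ Icc a b := ⟨(hP.u_mem hk.le).1.trans hτ.1.le, hτ.2.trans (hP.u_mem hk).2⟩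
      have htag := hP.tag k hk
      have hmesh := hP.mesh k hk
      rw [← sub_smul, norm_smul]
      calc ‖f (P.τ k) - f τ‖ * ‖g τ‖ ≤ ε / (L + 1) * L := by
            refine mul_le_mul (hm _ (hP.tag_mem hk) _ hτ' ?_) (hL τ hτ') (norm_nonneg _)
              (by positivity)
            rw [abs_lt]; constructor <;> linarith [htag.1, htag.2, hτ.1, hτ.2]
        _ ≤ ε := by
            rw [div_mul_eq_mul_div, div_le_iff₀ (by positivity)]; nlinarith

variable [CompleteSpace E]

/-- Summation by parts: for a continuously differentiable integrand, the sums of `f dz` converge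
for every continuous `z`. -/
theorem tendsto_rsum_of_deriv {a b : ℝ} (hab : a ≤ b) {f f' : ℝ → ℝ} {z : ℝ → E}
    (hf : ∀ t, HasDerivAt f (f' t) t) (hf' : Continuous f') (hz : Continuous z) :
    Tendsto (rsum f z) (meshFilter a b)
      (𝓝 (f b • z b - f a • z a - ∫ τ in a..b, f' τ • z τ)) := by
  obtain ⟨L, hL⟩ := (isCompact_Icc (a := a) (b := b)).exists_bound_of_continuousOn hf'.continuousOn
  have hL0 : 0 ≤ L := (norm_nonneg _).trans (hL a (left_mem_Icc.2 hab))
  have hi : ∀ s t, IntervalIntegrable (fun τ => f' τ • z τ) volume s t :=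
    fun s t => (hf'.smul hz).intervalIntegrable _ _
  have hc : ∀ (v : E) s t, IntervalIntegrable (fun τ => f' τ • v) volume s t :=
    fun v s t => (hf'.smul continuous_const).intervalIntegrable _ _
  have hftc : ∀ s t, ∫ τ in s..t, f' τ = f t - f s := fun s t =>
    intervalIntegral.integral_eq_sub_of_hasDerivAt (fun τ _ => hf τ) (hf'.intervalIntegrable _ _)
  refine tendsto_sum_of_cell_error hab fun ε hε => ?_
  obtain ⟨δ, hδ, hm⟩ := exists_modulus hz a b (ε := ε / (L + 1)) (by positivity)
  refine ⟨δ, hδ, fun P hP => ⟨fun k => (f (P.u (k + 1)) • z (P.u (k + 1)) - f (P.u k) • z (P.u k))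
    - ∫ τ in P.u k..P.u (k + 1), f' τ • z τ, ?_, fun k hk => ?_⟩⟩
  · rw [Finset.sum_sub_distrib, Finset.sum_range_sub (fun k => f (P.u k) • z (P.u k)),
      intervalIntegral.sum_integral_adjacent_intervals (fun k _ => hi _ _), hP.first, hP.last]
  · have hle : P.u k ≤ P.u (k + 1) := hP.mono k.le_succ
    obtain ⟨h1, h2⟩ := hP.tag k hk
    -- the error is an integral of `f'` against oscillations of `z` within the cell
    have key : f (P.τ k) • (z (P.u (k + 1)) - z (P.u k)) -
        ((f (P.u (k + 1)) • z (P.u (k + 1)) - f (P.u k) • z (P.u k))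
          - ∫ τ in P.u k..P.u (k + 1), f' τ • z τ) =
        (∫ τ in P.u k..P.τ k, f' τ • (z τ - z (P.u k))) +
          ∫ τ in P.τ k..P.u (k + 1), f' τ • (z τ - z (P.u (k + 1))) := by
      simp only [smul_sub]
      rw [intervalIntegral.integral_sub (hi _ _) (hc _ _ _),
        intervalIntegral.integral_sub (hi _ _) (hc _ _ _),
        intervalIntegral.integral_smul_const, intervalIntegral.integral_smul_const, hftc, hftc,
        ← intervalIntegral.integral_add_adjacent_intervals (hi (P.u k) (P.τ k)) (hi _ _)]
      module
    have hosc : ∀ τ ∈ Icc (P.u k) (P.u (k + 1)), ∀ σ ∈ Icc (P.u k) (P.u (k + 1)),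
        ‖f' τ • (z τ - z σ)‖ ≤ ε := by
      intro τ hτ σ hσ
      have hmem : ∀ τ ∈ Icc (P.u k) (P.u (k + 1)), τ ∈ Icc a b := fun τ hτ =>
        ⟨(hP.u_mem hk.le).1.trans hτ.1, hτ.2.trans (hP.u_mem hk).2⟩
      have hmesh := hP.mesh k hk
      rw [norm_smul]
      calc ‖f' τ‖ * ‖z τ - z σ‖ ≤ L * (ε / (L + 1)) := by
            refine mul_le_mul (hL τ (hmem τ hτ)) (hm _ (hmem τ hτ) _ (hmem σ hσ) ?_)
              (norm_nonneg _) hL0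
            rw [abs_lt]; constructor <;> linarith [hτ.1, hτ.2, hσ.1, hσ.2]
        _ ≤ ε := by
            rw [mul_div_assoc', div_le_iff₀ (by positivity)]; nlinarith
    rw [key]
    have e1 := intervalIntegral.norm_integral_le_of_norm_le_const (a := P.u k) (b := P.τ k)
      (f := fun τ => f' τ • (z τ - z (P.u k))) (C := ε) fun τ hτ => by
        rw [uIoc_of_le h1] at hτ
        exact hosc _ ⟨hτ.1.le, hτ.2.trans h2⟩ _ (left_mem_Icc.2 hle)
    have e2 := intervalIntegral.norm_integral_le_of_norm_le_const (a := P.τ k) (b := P.u (k + 1))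
      (f := fun τ => f' τ • (z τ - z (P.u (k + 1)))) (C := ε) fun τ hτ => by
        rw [uIoc_of_le h2] at hτ
        exact hosc _ ⟨h1.trans hτ.1.le, hτ.2⟩ _ (right_mem_Icc.2 hle)
    rw [abs_of_nonneg (sub_nonneg.2 h1)] at e1
    rw [abs_of_nonneg (sub_nonneg.2 h2)] at e2
    refine (norm_add_le _ _).trans ((add_le_add e1 e2).trans (le_of_eq ?_))
    ring

end RiemannSum

/-! ### Mean-square integrals with respect to processes with orthogonal increments -/

/-- A function on `[a, b]` whose squared increments are at most linear is continuous, when extended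
by constants. -/
theorem continuous_of_norm_sq_le {E : Type*} [NormedAddCommGroup E] {z : ℝ → E} {a b κ : ℝ}
    (hab : a ≤ b)
    (h : ∀ s t, a ≤ s → s ≤ t → t ≤ b → ‖z t - z s‖ ^ 2 ≤ κ * (t - s)) :
    Continuous fun t => z (max a (min t b)) := by
  have hmem : ∀ t, max a (min t b) ∈ Icc a b :=
    fun t => ⟨le_max_left _ _, max_le hab (min_le_right _ _)⟩
  have habs : ∀ s ∈ Icc a b, ∀ t ∈ Icc a b, ‖z t - z s‖ ^ 2 ≤ κ * |t - s| := by
    intro s hs t ht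
    rcases le_total s t with hst | hst
    · rw [abs_of_nonneg (sub_nonneg.2 hst)]; exact h s t hs.1 hst ht.2
    · rw [abs_sub_comm, abs_of_nonneg (sub_nonneg.2 hst), norm_sub_rev]; exact h t s ht.1 hst hs.2
  rw [continuous_iff_continuousAt]
  intro t₀
  rw [ContinuousAt, tendsto_iff_norm_sub_tendsto_zero]
  have hlim : Tendsto (fun t => √(κ * |max a (min t b) - max a (min t₀ b)|)) (𝓝 t₀) (𝓝 0) := by
    have hc : Continuous fun t => √(κ * |max a (min t b) - max a (min t₀ b)|) := by fun_prop
    simpa using hc.tendsto t₀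
  refine squeeze_zero (fun _ => norm_nonneg _) (fun t => ?_) hlim
  exact Real.le_sqrt_of_sq_le (habs _ (hmem t₀) _ (hmem t))

section StochInt

variable {E : Type*} [NormedAddCommGroup E] [InnerProductSpace ℝ E]

/-- `z₁`, `z₂` have mutually orthogonal increments over non-overlapping intervals of `[a, b]`, and
`⟪Δz₁, Δz₂⟫ = ∫ γ dt` over each interval. -/
structure NoisePair (z₁ z₂ : ℝ → E) (γ : ℝ → ℝ) (a b : ℝ) : Prop where
  cont : Continuous γ
  cov : ∀ ⦃s t⦄, a ≤ s → s ≤ t → t ≤ b → inner ℝ (z₁ t - z₁ s) (z₂ t - z₂ s) = ∫ τ in s..t, γ τ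
  orth₁ : ∀ ⦃s t s' t'⦄, a ≤ s → s ≤ t → t ≤ s' → s' ≤ t' → t' ≤ b →
    inner ℝ (z₁ t - z₁ s) (z₂ t' - z₂ s') = 0
  orth₂ : ∀ ⦃s t s' t'⦄, a ≤ s → s ≤ t → t ≤ s' → s' ≤ t' → t' ≤ b →
    inner ℝ (z₁ t' - z₁ s') (z₂ t - z₂ s) = 0

variable {z z₁ z₂ : ℝ → E} {γ : ℝ → ℝ} {a b : ℝ} {f g : ℝ → ℝ}

theorem NoisePair.mono {a' b' : ℝ} (h : NoisePair z₁ z₂ γ a b) (ha : a ≤ a') (hb : b' ≤ b) :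
    NoisePair z₁ z₂ γ a' b' :=
  ⟨h.cont, fun _ _ h1 h2 h3 => h.cov (ha.trans h1) h2 (h3.trans hb),
    fun _ _ _ _ h1 h2 h3 h4 h5 => h.orth₁ (ha.trans h1) h2 h3 h4 (h5.trans hb),
    fun _ _ _ _ h1 h2 h3 h4 h5 => h.orth₂ (ha.trans h1) h2 h3 h4 (h5.trans hb)⟩

/-- Inner products of sums over one partition reduce to the diagonal. -/
theorem NoisePair.inner_rsum (h : NoisePair z₁ z₂ γ a b) {P : TagPart} {δ : ℝ}
    (hP : P.IsOn a b δ) :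
    inner ℝ (rsum f z₁ P) (rsum g z₂ P) =
      rsum (fun t => f t * g t) (fun t => ∫ τ in a..t, γ τ) P := by
  have hi : ∀ s t, IntervalIntegrable γ volume s t := fun s t => h.cont.intervalIntegrable s t
  simp only [rsum, sum_inner, inner_sum, real_inner_smul_left, real_inner_smul_right]
  refine Finset.sum_congr rfl fun k hk => ?_
  have hk' := Finset.mem_range.1 hk
  rw [Finset.sum_eq_single_of_mem k hk]
  · rw [h.cov (hP.u_mem hk'.le).1 (hP.mono k.le_succ) (hP.u_mem hk').2,
      intervalIntegral.integral_interval_sub_left (hi _ _) (hi _ _), smul_eq_mul]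
    ring
  · intro l hl hne
    have hl' := Finset.mem_range.1 hl
    rcases lt_or_gt_of_ne hne with hlk | hlk
    · rw [h.orth₁ (hP.u_mem hl'.le).1 (hP.mono l.le_succ) (hP.mono hlk) (hP.mono k.le_succ)
        (hP.u_mem hk').2]
      simp
    · rw [h.orth₂ (hP.u_mem hk'.le).1 (hP.mono k.le_succ) (hP.mono hlk) (hP.mono l.le_succ)
        (hP.u_mem hl').2]
      simp

/-- The sums are bounded, in norm, by the supremum of the integrand. -/
theorem NoisePair.norm_rsum_le (h : NoisePair z z γ a b) {P : TagPart} {δ c κ : ℝ}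
    (hP : P.IsOn a b δ) (hκ : ∀ t ∈ Icc a b, γ t ≤ κ) (hf : ∀ t ∈ Icc a b, |f t| ≤ c) :
    ‖rsum f z P‖ ^ 2 ≤ c ^ 2 * κ * (b - a) := by
  have hi : ∀ s t, IntervalIntegrable γ volume s t := fun s t => h.cont.intervalIntegrable s t
  rw [← real_inner_self_eq_norm_sq, h.inner_rsum hP]
  refine (le_abs_self _).trans ?_
  rw [← Real.norm_eq_abs]
  refine hP.norm_sum_le fun k hk => ?_
  have hle : P.u k ≤ P.u (k + 1) := hP.mono k.le_succ
  rw [intervalIntegral.integral_interval_sub_left (hi _ _) (hi _ _), norm_smul, Real.norm_eq_abs,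
    Real.norm_eq_abs]
  have hpos : 0 ≤ ∫ τ in P.u k..P.u (k + 1), γ τ := by
    rw [← h.cov (hP.u_mem hk.le).1 hle (hP.u_mem hk).2]; exact real_inner_self_nonneg
  have hle2 : ∫ τ in P.u k..P.u (k + 1), γ τ ≤ κ * (P.u (k + 1) - P.u k) := by
    have := intervalIntegral.integral_mono_on hle (hi _ _)
      (intervalIntegrable_const (c := κ)) fun t ht =>
        hκ t ⟨(hP.u_mem hk.le).1.trans ht.1, ht.2.trans (hP.u_mem hk).2⟩
    rwa [intervalIntegral.integral_const, smul_eq_mul, mul_comm] at this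
  have hft := hf _ (hP.tag_mem hk)
  rw [abs_of_nonneg hpos, abs_mul, mul_assoc (c ^ 2), sq]
  have hc0 : 0 ≤ c := (abs_nonneg _).trans hft
  gcongr

theorem rsum_sub (f g : ℝ → ℝ) (z : ℝ → E) (P : TagPart) :
    rsum f z P - rsum g z P = rsum (fun t => f t - g t) z P := by
  simp only [rsum, ← Finset.sum_sub_distrib, ← sub_smul]

/-- The integral `∫_a^b f dz`, as the limit of tagged Riemann–Stieltjes sums. -/
noncomputable def stochInt (f : ℝ → ℝ) (z : ℝ → E) (a b : ℝ) : E :=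
  limUnder (meshFilter a b) (rsum f z)

theorem exists_polynomial_approx (hf : Continuous f) (a b : ℝ) {ε : ℝ} (hε : 0 < ε) :
    ∃ p p' : ℝ → ℝ, (∀ t, HasDerivAt p (p' t) t) ∧ Continuous p' ∧ Continuous p ∧
      ∀ t ∈ Icc a b, |f t - p t| ≤ ε := by
  obtain ⟨p, hp⟩ := exists_polynomial_near_of_continuousOn a b f hf.continuousOn ε hε
  exact ⟨fun t => p.eval t, fun t => p.derivative.eval t, fun t => p.hasDerivAt t,
    p.derivative.continuous, p.continuous, fun t ht => by
      rw [abs_sub_comm]; exact (hp t ht).le⟩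

theorem NoisePair.exists_bound (h : NoisePair z₁ z₂ γ a b) :
    ∃ κ, 0 ≤ κ ∧ ∀ t ∈ Icc a b, |γ t| ≤ κ := by
  obtain ⟨κ, hκ⟩ := (isCompact_Icc (a := a) (b := b)).exists_bound_of_continuousOn
    h.cont.continuousOn
  exact ⟨max κ 0, le_max_right _ _, fun t ht => (hκ t ht).trans (le_max_left _ _)⟩

/-- Existence of the integral: polynomial integrands are handled by summation by parts, and the
orthogonality of the increments makes the approximation by polynomials uniform in the partition. -/
theorem NoisePair.tendsto_stochInt [CompleteSpace E] (h : NoisePair z z γ a b) (hz : Continuous z)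
    (hf : Continuous f) (hab : a ≤ b) :
    Tendsto (rsum f z) (meshFilter a b) (𝓝 (stochInt f z a b)) := by
  have := meshFilter_neBot hab
  obtain ⟨κ, hκ0, hκ⟩ := h.exists_bound
  refine tendsto_nhds_limUnder ?_
  refine cauchy_map_iff_exists_tendsto.1 (Metric.cauchy_iff.2 ⟨inferInstance, fun ε hε => ?_⟩)
  have hε' : 0 < (ε / 4) / (κ * (b - a) + 1) := by
    have : 0 ≤ κ * (b - a) := mul_nonneg hκ0 (by linarith)
    positivity
  obtain ⟨p, p', hp, hp', hpc, hpf⟩ := exists_polynomial_approx hf a b hε'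
  have hlim := tendsto_rsum_of_deriv hab hp hp' hz
  set v := p b • z b - p a • z a - ∫ τ in a..b, p' τ • z τ
  refine ⟨Metric.ball v (ε / 2), ?_, fun x hx y hy => ?_⟩
  · rw [mem_map]
    filter_upwards [Metric.tendsto_nhds.1 hlim (ε / 4) (by positivity),
      eventually_isOn a b one_pos] with P hP hPon
    have h2 := h.norm_rsum_le (f := fun t => f t - p t) hPon
      (fun t ht => (le_abs_self _).trans (hκ t ht)) hpf
    rw [← rsum_sub] at h2
    have hA : 0 ≤ κ * (b - a) := mul_nonneg hκ0 (by linarith)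
    have h3 : ‖rsum f z P - rsum p z P‖ ≤ ε / 4 := by
      refine le_of_sq_le_sq ?_ (by positivity)
      refine h2.trans ?_
      rw [div_pow, mul_assoc, div_mul_eq_mul_div, div_le_iff₀ (by positivity)]
      refine mul_le_mul_of_nonneg_left ?_ (by positivity)
      nlinarith
    rw [mem_preimage, Metric.mem_ball]
    calc dist (rsum f z P) v ≤ dist (rsum f z P) (rsum p z P) + dist (rsum p z P) v :=
          dist_triangle _ _ _
      _ < ε / 4 + ε / 4 := by rw [dist_eq_norm (rsum f z P)]; exact add_lt_add_of_le_of_lt h3 hP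
      _ = ε / 2 := by ring
  · calc dist x y ≤ dist x v + dist y v := dist_triangle_right _ _ _
      _ < ε := by rw [Metric.mem_ball] at hx hy; linarith

/-- The isometry property. -/
theorem NoisePair.inner_limit (h : NoisePair z₁ z₂ γ a b) (hf : Continuous f) (hg : Continuous g)
    (hab : a ≤ b) {I₁ I₂ : E} (h₁ : Tendsto (rsum f z₁) (meshFilter a b) (𝓝 I₁))
    (h₂ : Tendsto (rsum g z₂) (meshFilter a b) (𝓝 I₂)) :
    inner ℝ I₁ I₂ = ∫ τ in a..b, f τ * g τ * γ τ := by
  have := meshFilter_neBot hab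
  have hi : ∀ s t, IntervalIntegrable γ volume s t := fun s t => h.cont.intervalIntegrable s t
  have h3 := tendsto_rsum_primitive hab (hf.mul hg) h.cont (G := fun t => ∫ τ in a..t, γ τ)
    fun s _ t _ _ => intervalIntegral.integral_interval_sub_left (hi _ _) (hi _ _)
  refine tendsto_nhds_unique (h₁.inner h₂) (h3.congr' ?_)
  filter_upwards [eventually_isOn a b one_pos] with P hP
  exact (h.inner_rsum hP).symm

theorem rsum_one (z : ℝ → E) {P : TagPart} {δ : ℝ} (hP : P.IsOn a b δ) :
    rsum (fun _ => 1) z P = z b - z a := by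
  simp only [rsum, one_smul]
  rw [Finset.sum_range_sub (fun k => z (P.u k)), hP.first, hP.last]

theorem tendsto_rsum_one (z : ℝ → E) (a b : ℝ) :
    Tendsto (rsum (fun _ => 1) z) (meshFilter a b) (𝓝 (z b - z a)) := by
  refine tendsto_const_nhds.congr' ?_
  filter_upwards [eventually_isOn a b one_pos] with P hP
  exact (rsum_one z hP).symm

/-- `∫ f dz` inherits orthogonality relations from the increments of `z`. -/
theorem inner_limit_eq_zero {v I : E} (hab : a ≤ b)
    (hI : Tendsto (rsum f z) (meshFilter a b) (𝓝 I))
    (hv : ∀ s t, a ≤ s → s ≤ t → t ≤ b → inner ℝ v (z t - z s) = 0) : inner ℝ v I = 0 := by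
  have := meshFilter_neBot hab
  refine tendsto_nhds_unique (tendsto_const_nhds.inner hI) (tendsto_const_nhds.congr' ?_)
  filter_upwards [eventually_isOn a b one_pos] with P hP
  rw [rsum, inner_sum]
  refine (Finset.sum_eq_zero fun k hk => ?_).symm
  have hk' := Finset.mem_range.1 hk
  rw [real_inner_smul_right, hv _ _ (hP.u_mem hk'.le).1 (hP.mono k.le_succ) (hP.u_mem hk').2,
    mul_zero]

theorem NoisePair.norm_stochInt_sub_le [CompleteSpace E] (h : NoisePair z z γ a b)
    (hz : Continuous z) (hf : Continuous f) (hg : Continuous g) {κ c : ℝ} (hκ : ∀ t ∈ Icc a b, γ t ≤ κ)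
    (hc : ∀ t ∈ Icc a b, |f t - g t| ≤ c) (hab : a ≤ b) :
    ‖stochInt f z a b - stochInt g z a b‖ ^ 2 ≤ c ^ 2 * κ * (b - a) := by
  have := meshFilter_neBot hab
  refine le_of_tendsto
    (((h.tendsto_stochInt hz hf hab).sub (h.tendsto_stochInt hz hg hab)).norm.pow 2) ?_
  filter_upwards [eventually_isOn a b one_pos] with P hP
  rw [rsum_sub]
  exact h.norm_rsum_le hP hκ hc

/-- The integral is additive in the interval. For polynomial integrands this is read off from the
formula for integration by parts. -/
theorem NoisePair.stochInt_add [CompleteSpace E] (h : NoisePair z z γ a b) (hz : Continuous z)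
    (hf : Continuous f) {s t r : ℝ} (has : a ≤ s) (hst : s ≤ t) (htr : t ≤ r) (hrb : r ≤ b) :
    stochInt f z s t + stochInt f z t r = stochInt f z s r := by
  obtain ⟨κ, hκ0, hκ⟩ := h.exists_bound
  have hL : 0 ≤ κ * (b - a) := mul_nonneg hκ0 (by linarith)
  rw [← sub_eq_zero, ← norm_le_zero_iff]
  refine le_of_forall_pos_le_add fun ε hε => ?_
  have hε' : 0 < (ε / 3) / (κ * (b - a) + 1) := by positivity
  obtain ⟨p, p', hp, hp', hpc, hpf⟩ := exists_polynomial_approx hf a b hε'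
  have hI : ∀ s' t', a ≤ s' → s' ≤ t' → t' ≤ b →
      ‖stochInt f z s' t' - (p t' • z t' - p s' • z s' - ∫ τ in s'..t', p' τ • z τ)‖ ≤ ε / 3 := by
    intro s' t' h1 h2 h3
    have := meshFilter_neBot h2
    have hsub : Icc s' t' ⊆ Icc a b := Icc_subset_Icc h1 h3
    have h' := h.mono h1 h3
    rw [← tendsto_nhds_unique (h'.tendsto_stochInt hz hpc h2) (tendsto_rsum_of_deriv h2 hp hp' hz)]
    refine le_of_sq_le_sq ((h'.norm_stochInt_sub_le hz hf hpc
      (fun t ht => (le_abs_self _).trans (hκ t (hsub ht))) (fun t ht => hpf t (hsub ht)) h2).trans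
      ?_) (by positivity)
    rw [div_pow, mul_assoc, div_mul_eq_mul_div, div_le_iff₀ (by positivity)]
    refine mul_le_mul_of_nonneg_left ?_ (by positivity)
    have : κ * (t' - s') ≤ κ * (b - a) := by gcongr
    nlinarith
  have e1 := hI s t has hst (htr.trans hrb)
  have e2 := hI t r (has.trans hst) htr hrb
  have e3 := hI s r has (hst.trans htr) hrb
  have hi : ∀ s t, IntervalIntegrable (fun τ => p' τ • z τ) volume s t :=
    fun s t => (hp'.smul hz).intervalIntegrable _ _
  have hadd := intervalIntegral.integral_add_adjacent_intervals (hi s t) (hi t r)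
  have key : stochInt f z s t + stochInt f z t r - stochInt f z s r =
      (stochInt f z s t - (p t • z t - p s • z s - ∫ τ in s..t, p' τ • z τ)) +
      (stochInt f z t r - (p r • z r - p t • z t - ∫ τ in t..r, p' τ • z τ)) -
      (stochInt f z s r - (p r • z r - p s • z s - ∫ τ in s..r, p' τ • z τ)) := by
    rw [← hadd]; abel
  rw [key]
  refine (norm_sub_le _ _).trans ?_
  have := norm_add_le
    (stochInt f z s t - (p t • z t - p s • z s - ∫ τ in s..t, p' τ • z τ))
    (stochInt f z t r - (p r • z r - p t • z t - ∫ τ in t..r, p' τ • z τ))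
  linarith

/-- The process `t ↦ ∫_a^t f dz` on `[a, b]`, extended by constants. -/
noncomputable def stochPrim (f : ℝ → ℝ) (z : ℝ → E) (a b : ℝ) (t : ℝ) : E :=
  stochInt f z a (max a (min t b))

theorem NoisePair.stochPrim_sub [CompleteSpace E] (h : NoisePair z z γ a b) (hz : Continuous z)
    (hf : Continuous f) {s t : ℝ} (has : a ≤ s) (hst : s ≤ t) (htb : t ≤ b) :
    stochPrim f z a b t - stochPrim f z a b s = stochInt f z s t := by
  rw [stochPrim, stochPrim, min_eq_left htb, min_eq_left (hst.trans htb), max_eq_right has,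
    max_eq_right (has.trans hst), ← h.stochInt_add hz hf le_rfl has hst htb, add_sub_cancel_left]

theorem NoisePair.norm_stochInt_sq_le [CompleteSpace E] (h : NoisePair z z γ a b)
    (hz : Continuous z) (hf : Continuous f) {κ c : ℝ} (hκ : ∀ t ∈ Icc a b, γ t ≤ κ)
    (hc : ∀ t ∈ Icc a b, |f t| ≤ c) (hab : a ≤ b) :
    ‖stochInt f z a b‖ ^ 2 ≤ c ^ 2 * κ * (b - a) := by
  have := meshFilter_neBot hab
  refine le_of_tendsto ((h.tendsto_stochInt hz hf hab).norm.pow 2) ?_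
  filter_upwards [eventually_isOn a b one_pos] with P hP
  exact h.norm_rsum_le hP hκ hc

theorem NoisePair.continuous_stochPrim [CompleteSpace E] (h : NoisePair z z γ a b)
    (hz : Continuous z) (hf : Continuous f) (hab : a ≤ b) : Continuous (stochPrim f z a b) := by
  obtain ⟨κ, hκ0, hκ⟩ := h.exists_bound
  obtain ⟨c, hc⟩ := (isCompact_Icc (a := a) (b := b)).exists_bound_of_continuousOn hf.continuousOn
  have := continuous_of_norm_sq_le (z := stochPrim f z a b) (κ := c ^ 2 * κ) hab
    fun s t has hst htb => by
      have hsub : Icc s t ⊆ Icc a b := Icc_subset_Icc has htb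
      rw [h.stochPrim_sub hz hf has hst htb]
      exact (h.mono has htb).norm_stochInt_sq_le hz hf
        (fun t ht => (le_abs_self _).trans (hκ t (hsub ht))) (fun t ht => hc t (hsub ht)) hst
  refine this.congr fun t => ?_
  have hm : max a (min (max a (min t b)) b) = max a (min t b) := by
    rw [min_eq_left (max_le hab (min_le_right _ _)), max_eq_right (le_max_left _ _)]
  simp only [stochPrim, hm]

end StochInt

/-! ### Product rule for covariances -/

/-- A function whose increments are `O(|t - s|^{3/2})` is constant. -/
theorem eq_of_increment_le {g : ℝ → ℝ} {a b C : ℝ}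
    (h : ∀ s t, a ≤ s → s ≤ t → t ≤ b → |g t - g s| ≤ C * ((t - s) * √(t - s))) {t : ℝ}
    (ht : t ∈ Icc a b) : g t = g a := by
  have habs : ∀ s ∈ Icc a b, ∀ t ∈ Icc a b, |g t - g s| ≤ C * (|t - s| * √|t - s|) := by
    intro s hs t ht
    rcases le_total s t with hst | hst
    · rw [abs_of_nonneg (sub_nonneg.2 hst)]; exact h s t hs.1 hst ht.2
    · rw [abs_sub_comm (g t), abs_sub_comm t, abs_of_nonneg (sub_nonneg.2 hst)]
      exact h t s ht.1 hst hs.2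
  have hd : ∀ s ∈ Icc a b, HasDerivWithinAt g 0 (Icc a b) s := by
    intro s hs
    rw [hasDerivWithinAt_iff_isLittleO, Asymptotics.isLittleO_iff]
    intro c hc
    have hlim : Tendsto (fun t => C * √|t - s|) (𝓝[Icc a b] s) (𝓝 0) := by
      have hcont : Continuous fun t => C * √|t - s| := by fun_prop
      simpa using (hcont.tendsto s).mono_left nhdsWithin_le_nhds
    filter_upwards [hlim.eventually_lt_const hc, self_mem_nhdsWithin] with t ht htm
    rw [smul_zero, sub_zero, Real.norm_eq_abs, Real.norm_eq_abs]
    refine (habs s hs t htm).trans ?_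
    nlinarith [abs_nonneg (t - s)]
  refine constant_of_derivWithin_zero (fun s hs => (hd s hs).differentiableWithinAt)
    (fun s hs => ?_) t ht
  have hs' := Ico_subset_Icc_self hs
  exact (hd s hs').derivWithin (uniqueDiffOn_Icc (hs.1.trans_lt hs.2) s hs')

theorem hasDerivWithinAt_of_integral {φ h : ℝ → ℝ} {a b : ℝ} (hh : Continuous h)
    (hφ : ∀ t ∈ Icc a b, φ t - φ a = ∫ τ in a..t, h τ) {t : ℝ} (ht : t ∈ Icc a b) :
    HasDerivWithinAt φ (h t) (Icc a b) t := by
  have h1 := (((hh.integral_hasStrictDerivAt a t).hasDerivAt).hasDerivWithinAt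
    (s := Icc a b)).const_add (φ a)
  exact h1.congr (fun s hs => by rw [← hφ s hs]; ring) (by rw [← hφ t ht]; ring)

section ProductRule

variable {E : Type*} [NormedAddCommGroup E] [InnerProductSpace ℝ E]

theorem inner_intervalIntegral [CompleteSpace E] (v : E) {f : ℝ → E} (hf : Continuous f) (a b : ℝ) :
    inner ℝ v (∫ τ in a..b, f τ) = ∫ τ in a..b, inner ℝ v (f τ) :=
  ((innerSL ℝ v).intervalIntegral_comp_comm (hf.intervalIntegrable a b)).symm

theorem intervalIntegral_inner [CompleteSpace E] (v : E) {f : ℝ → E} (hf : Continuous f) (a b : ℝ) :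
    inner ℝ (∫ τ in a..b, f τ) v = ∫ τ in a..b, inner ℝ (f τ) v := by
  rw [real_inner_comm, inner_intervalIntegral v hf]
  simp only [real_inner_comm]

/-- A process with bounded drift and mean-square Lipschitz noise has increments `O(√h)`. -/
theorem norm_sub_le_sqrt {u f μ : ℝ → E} {a b L κ : ℝ} (hL0 : 0 ≤ L)
    (hu : ∀ s t, a ≤ s → s ≤ t → t ≤ b → u t - u s = (∫ τ in s..t, f τ) + (μ t - μ s))
    (hL : ∀ t ∈ Icc a b, ‖f t‖ ≤ L)
    (hκ : ∀ s t, a ≤ s → s ≤ t → t ≤ b → ‖μ t - μ s‖ ^ 2 ≤ κ * (t - s)) {s t : ℝ}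
    (has : a ≤ s) (hst : s ≤ t) (htb : t ≤ b) :
    ‖u t - u s‖ ≤ (L * √(b - a) + √κ) * √(t - s) := by
  have h1 : ‖∫ τ in s..t, f τ‖ ≤ L * (t - s) := by
    have := intervalIntegral.norm_integral_le_of_norm_le_const (a := s) (b := t) (f := f) (C := L)
      fun τ hτ => by
        rw [uIoc_of_le hst] at hτ
        exact hL τ ⟨has.trans hτ.1.le, hτ.2.trans htb⟩
    rwa [abs_of_nonneg (sub_nonneg.2 hst)] at this
  have h2 : ‖μ t - μ s‖ ≤ √κ * √(t - s) := by
    rw [← Real.sqrt_mul' _ (sub_nonneg.2 hst)]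
    exact Real.le_sqrt_of_sq_le (hκ s t has hst htb)
  have h3 : t - s ≤ √(b - a) * √(t - s) := by
    have hh : √(t - s) ≤ √(b - a) := Real.sqrt_le_sqrt (by linarith)
    nlinarith [Real.mul_self_sqrt (sub_nonneg.2 hst), Real.sqrt_nonneg (t - s)]
  rw [hu s t has hst htb]
  refine (norm_add_le _ _).trans ?_
  nlinarith [mul_le_mul_of_nonneg_left h3 hL0]

/-- Product rule: if `du = f dt + dμ` and `dv = g dt + dν`, where the increments of the noises are
orthogonal to the past of `u` and `v` and `E{dμ dν} = γ dt`, then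
`d⟪u, v⟫ = (⟪f, v⟫ + ⟪u, g⟫ + γ) dt`. -/
theorem inner_sub_inner_eq_integral [CompleteSpace E] {u v f g μ ν : ℝ → E} {γ : ℝ → ℝ} {a b κ : ℝ}
    (hfc : Continuous f) (hgc : Continuous g) (huc : Continuous u) (hvc : Continuous v)
    (hγ : Continuous γ)
    (hu : ∀ s t, a ≤ s → s ≤ t → t ≤ b → u t - u s = (∫ τ in s..t, f τ) + (μ t - μ s))
    (hv : ∀ s t, a ≤ s → s ≤ t → t ≤ b → v t - v s = (∫ τ in s..t, g τ) + (ν t - ν s))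
    (hμv : ∀ s t, a ≤ s → s ≤ t → t ≤ b → inner ℝ (v s) (μ t - μ s) = 0)
    (huν : ∀ s t, a ≤ s → s ≤ t → t ≤ b → inner ℝ (u s) (ν t - ν s) = 0)
    (hμν : ∀ s t, a ≤ s → s ≤ t → t ≤ b →
      inner ℝ (μ t - μ s) (ν t - ν s) = ∫ τ in s..t, γ τ)
    (hμ : ∀ s t, a ≤ s → s ≤ t → t ≤ b → ‖μ t - μ s‖ ^ 2 ≤ κ * (t - s))
    (hν : ∀ s t, a ≤ s → s ≤ t → t ≤ b → ‖ν t - ν s‖ ^ 2 ≤ κ * (t - s))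
    {t : ℝ} (ht : t ∈ Icc a b) :
    inner ℝ (u t) (v t) - inner ℝ (u a) (v a) =
      ∫ τ in a..t, (inner ℝ (f τ) (v τ) + inner ℝ (u τ) (g τ) + γ τ) := by
  have hab : a ≤ b := ht.1.trans ht.2
  obtain ⟨L₁, hL₁⟩ :=
    (isCompact_Icc (a := a) (b := b)).exists_bound_of_continuousOn hfc.continuousOn
  obtain ⟨L₂, hL₂⟩ :=
    (isCompact_Icc (a := a) (b := b)).exists_bound_of_continuousOn hgc.continuousOn
  set L := max L₁ L₂
  have hLf : ∀ t ∈ Icc a b, ‖f t‖ ≤ L := fun t ht => (hL₁ t ht).trans (le_max_left _ _)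
  have hLg : ∀ t ∈ Icc a b, ‖g t‖ ≤ L := fun t ht => (hL₂ t ht).trans (le_max_right _ _)
  have hL0 : 0 ≤ L := (norm_nonneg _).trans (hLf a (left_mem_Icc.2 hab))
  set c := L * √(b - a) + √κ
  have hc0 : 0 ≤ c := by positivity
  have hi : ∀ {h : ℝ → ℝ}, Continuous h → ∀ s t, IntervalIntegrable h volume s t :=
    fun h s t => h.intervalIntegrable s t
  have hcont : Continuous fun τ => inner ℝ (f τ) (v τ) + inner ℝ (u τ) (g τ) + γ τ := by fun_prop
  have key := eq_of_increment_le (a := a) (b := b) (C := 2 * (L * c) + √κ * L)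
    (g := fun t => inner ℝ (u t) (v t) -
      ∫ τ in a..t, (inner ℝ (f τ) (v τ) + inner ℝ (u τ) (g τ) + γ τ)) (fun s t has hst htb => ?_) ht
  · simp only [intervalIntegral.integral_same, sub_zero] at key
    linarith
  · have hsub : ∀ τ ∈ Ioc s t, τ ∈ Icc a b := fun τ hτ => ⟨has.trans hτ.1.le, hτ.2.trans htb⟩
    have e0 : (inner ℝ (u t) (v t) - ∫ τ in a..t, (inner ℝ (f τ) (v τ) + inner ℝ (u τ) (g τ) + γ τ))
        - (inner ℝ (u s) (v s) - ∫ τ in a..s, (inner ℝ (f τ) (v τ) + inner ℝ (u τ) (g τ) + γ τ)) =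
        (∫ τ in s..t, inner ℝ (u s - u τ) (g τ)) + (∫ τ in s..t, inner ℝ (f τ) (v t - v τ)) +
          inner ℝ (μ t - μ s) (∫ τ in s..t, g τ) := by
      have hI := intervalIntegral.integral_interval_sub_left (hi hcont a t) (hi hcont a s)
      have h1 : inner ℝ (u t) (v t) - inner ℝ (u s) (v s) =
          inner ℝ (u s) (v t - v s) + inner ℝ (u t - u s) (v t) := by
        rw [inner_sub_right, inner_sub_left]; ring
      have h2 : inner ℝ (μ t - μ s) (v t) =
          inner ℝ (μ t - μ s) (∫ τ in s..t, g τ) + ∫ τ in s..t, γ τ := by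
        have : v t = v s + ((∫ τ in s..t, g τ) + (ν t - ν s)) := by
          rw [← hv s t has hst htb]; abel
        rw [this, inner_add_right, inner_add_right, hμν s t has hst htb, real_inner_comm,
          hμv s t has hst htb, zero_add]
      have h3 : ∫ τ in s..t, inner ℝ (u s - u τ) (g τ) =
          inner ℝ (u s) (∫ τ in s..t, g τ) - ∫ τ in s..t, inner ℝ (u τ) (g τ) := by
        rw [inner_intervalIntegral _ hgc, ← intervalIntegral.integral_sub (hi (by fun_prop) _ _)
          (hi (by fun_prop) _ _)]
        simp only [inner_sub_left]
      have h4 : ∫ τ in s..t, inner ℝ (f τ) (v t - v τ) =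
          inner ℝ (∫ τ in s..t, f τ) (v t) - ∫ τ in s..t, inner ℝ (f τ) (v τ) := by
        rw [intervalIntegral_inner _ hfc, ← intervalIntegral.integral_sub (hi (by fun_prop) _ _)
          (hi (by fun_prop) _ _)]
        simp only [inner_sub_right]
      have h5 : ∫ τ in s..t, (inner ℝ (f τ) (v τ) + inner ℝ (u τ) (g τ) + γ τ) =
          (∫ τ in s..t, inner ℝ (f τ) (v τ)) + (∫ τ in s..t, inner ℝ (u τ) (g τ)) +
            ∫ τ in s..t, γ τ := by
        rw [intervalIntegral.integral_add (hi (by fun_prop) _ _) (hi hγ _ _),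
          intervalIntegral.integral_add (hi (by fun_prop) _ _) (hi (by fun_prop) _ _)]
      rw [h3, h4]
      rw [h5] at hI
      rw [hu s t has hst htb, hv s t has hst htb, inner_add_right, huν s t has hst htb,
        inner_add_left, h2] at h1
      linarith
    rw [e0]
    have b1 := intervalIntegral.norm_integral_le_of_norm_le_const (a := s) (b := t)
      (f := fun τ => inner ℝ (u s - u τ) (g τ)) (C := c * √(t - s) * L) fun τ hτ => by
        rw [uIoc_of_le hst] at hτ
        refine (norm_inner_le_norm _ _).trans (mul_le_mul ?_ (hLg τ (hsub τ hτ)) (norm_nonneg _)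
          (by positivity))
        rw [norm_sub_rev]
        refine (norm_sub_le_sqrt hL0 hu hLf hμ has hτ.1.le (hτ.2.trans htb)).trans ?_
        have : √(τ - s) ≤ √(t - s) := Real.sqrt_le_sqrt (by linarith [hτ.2])
        gcongr
    have b2 := intervalIntegral.norm_integral_le_of_norm_le_const (a := s) (b := t)
      (f := fun τ => inner ℝ (f τ) (v t - v τ)) (C := L * (c * √(t - s))) fun τ hτ => by
        rw [uIoc_of_le hst] at hτ
        refine (norm_inner_le_norm _ _).trans (mul_le_mul (hLf τ (hsub τ hτ)) ?_ (norm_nonneg _)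
          hL0)
        refine (norm_sub_le_sqrt hL0 hv hLg hν (has.trans hτ.1.le) hτ.2 htb).trans ?_
        have : √(t - τ) ≤ √(t - s) := Real.sqrt_le_sqrt (by linarith [hτ.1])
        gcongr
    have b3 : ‖inner ℝ (μ t - μ s) (∫ τ in s..t, g τ)‖ ≤ √κ * √(t - s) * (L * (t - s)) := by
      refine (norm_inner_le_norm _ _).trans (mul_le_mul ?_ ?_ (norm_nonneg _) (by positivity))
      · rw [← Real.sqrt_mul' _ (sub_nonneg.2 hst)]
        exact Real.le_sqrt_of_sq_le (hμ s t has hst htb)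
      · have := intervalIntegral.norm_integral_le_of_norm_le_const (a := s) (b := t) (f := g)
          (C := L) fun τ hτ => by
            rw [uIoc_of_le hst] at hτ
            exact hLg τ (hsub τ hτ)
        rwa [abs_of_nonneg (sub_nonneg.2 hst)] at this
    rw [abs_of_nonneg (sub_nonneg.2 hst)] at b1 b2
    rw [← Real.norm_eq_abs]
    refine (norm_add_le _ _).trans ((add_le_add ((norm_add_le _ _).trans (add_le_add b1 b2))
      b3).trans (le_of_eq ?_))
    ring

end ProductRule

/-! ### Linear systems in terms of the covariances of their noise -/

section Core

variable {E : Type*} [NormedAddCommGroup E] [InnerProductSpace ℝ E] {n m p : ℕ}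

/-- The stacked drift coefficient, with rows of `A` followed by rows of `C`. -/
def stackA (S : LinModel n m p) (t : ℝ) : Matrix (Fin n ⊕ Fin m) (Fin n) ℝ :=
  Matrix.of fun i j => Sum.elim (fun i => S.A t i j) (fun i => S.C t i j) i

/-- The stacked noise coefficient, with rows of `B` followed by rows of `D`. -/
def stackB (S : LinModel n m p) (t : ℝ) : Matrix (Fin n ⊕ Fin m) (Fin p) ℝ :=
  Matrix.of fun i j => Sum.elim (fun i => S.B t i j) (fun i => S.D t i j) i

/-- The stacked process `(x, y)`, by components. -/
def stackX (x : ℝ → Fin n → E) (y : ℝ → Fin m → E) (i : Fin n ⊕ Fin m) (t : ℝ) : E :=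
  Sum.elim (x t) (y t) i

/-- Drift of the stacked process. -/
def stackDrift (S : LinModel n m p) (x : ℝ → Fin n → E) (i : Fin n ⊕ Fin m) (t : ℝ) : E :=
  ∑ j, stackA S t i j • x t j

/-- The driving noise `(x, y) - ∫ (A x, C x) dt` of the stacked process. -/
noncomputable def sysNoise (S : LinModel n m p) (x : ℝ → Fin n → E) (y : ℝ → Fin m → E)
    (i : Fin n ⊕ Fin m) (t : ℝ) : E :=
  stackX x y i t - ∫ τ in (0 : ℝ)..t, stackDrift S x i τ

/-- The second-order description of a normalized linear system on `[0, T]`: the noise of the stacked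
process has orthogonal increments with covariance density `(B; D)(B; D)'`, orthogonal to the past,
and the state has unit covariance. Coefficients and processes are continuous on the whole line,
which is achieved by extending them by constants. The noise `w` itself does not appear, which makes
the notion invariant under time reversal. -/
structure Core (S : LinModel n m p) (T : ℝ) (x : ℝ → Fin n → E) (y : ℝ → Fin m → E) : Prop where
  contA : Continuous S.A
  contB : Continuous S.B
  contC : Continuous S.C
  contD : Continuous S.D
  posR : ∀ t, (S.R t).PosDef
  contX : ∀ i, Continuous (stackX x y i)
  noise : ∀ i j, NoisePair (sysNoise S x y i) (sysNoise S x y j)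
    (fun t => (stackB S t * (stackB S t)ᵀ) i j) 0 T
  past_state : ∀ i k ⦃r s t⦄, 0 ≤ r → r ≤ s → s ≤ t → t ≤ T →
    inner ℝ (x r k) (sysNoise S x y i t - sysNoise S x y i s) = 0
  past_output : ∀ i k ⦃r s t⦄, 0 ≤ r → r ≤ s → s ≤ t → t ≤ T →
    inner ℝ (y r k - y 0 k) (sysNoise S x y i t - sysNoise S x y i s) = 0
  cov_state : ∀ t ∈ Icc 0 T, ∀ i j, inner ℝ (x t i) (x t j) = (1 : Matrix (Fin n) (Fin n) ℝ) i j

variable {S : LinModel n m p} {T : ℝ} {x : ℝ → Fin n → E} {y : ℝ → Fin m → E}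

/-- The vectors orthogonal to all increments of the noise after time `s`. -/
noncomputable def pastSpace (S : LinModel n m p) (T : ℝ) (x : ℝ → Fin n → E) (y : ℝ → Fin m → E)
    (s : ℝ) : ClosedSubmodule ℝ E :=
  { (Submodule.span ℝ {v | ∃ i a b, s ≤ a ∧ a ≤ b ∧ b ≤ T ∧
      v = sysNoise S x y i b - sysNoise S x y i a})ᗮ with
    isClosed' := Submodule.isClosed_orthogonal _ }

theorem mem_pastSpace {s : ℝ} {v : E} : v ∈ pastSpace S T x y s ↔
    ∀ i a b, s ≤ a → a ≤ b → b ≤ T → inner ℝ v (sysNoise S x y i b - sysNoise S x y i a) = 0 := by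
  change v ∈ (Submodule.span ℝ {v | ∃ i a b, s ≤ a ∧ a ≤ b ∧ b ≤ T ∧
    v = sysNoise S x y i b - sysNoise S x y i a})ᗮ ↔ _
  constructor
  · intro h i a b h1 h2 h3
    have hmem : sysNoise S x y i b - sysNoise S x y i a ∈ Submodule.span ℝ {v | ∃ i a b, s ≤ a ∧ a ≤ b ∧
        b ≤ T ∧ v = sysNoise S x y i b - sysNoise S x y i a} :=
      Submodule.subset_span ⟨i, a, b, h1, h2, h3, rfl⟩
    exact Submodule.inner_left_of_mem_orthogonal hmem h
  · intro h
    rw [Submodule.mem_orthogonal']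
    intro u hu
    induction hu using Submodule.span_induction with
    | mem u hu => obtain ⟨i, a, b, h1, h2, h3, rfl⟩ := hu; exact h i a b h1 h2 h3
    | zero => simp
    | add u v _ _ hu hv => rw [inner_add_right, hu, hv, add_zero]
    | smul c u _ hu => rw [real_inner_smul_right, hu, mul_zero]

theorem pastSpace_mono {s t : ℝ} (h : s ≤ t) : pastSpace S T x y s ≤ pastSpace S T x y t :=
  fun _ hv => mem_pastSpace.2 fun i a b h1 => mem_pastSpace.1 hv i a b (h.trans h1)

theorem gapC_eq (hC : Continuous S.C) {X Y : ℝ → Matrix (Fin n) (Fin n) ℝ}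
    (hXY : IsFundamental S.A X Y) (a b : ℝ) :
    gapC S a b = (Matrix.of fun i j => ∫ t in a..b, (S.C t * X t) i j) * Y a := by
  have hX := hXY.cont_left
  ext i j
  simp only [gapC, Matrix.of_apply, hXY.transition_eq, ← Matrix.mul_assoc]
  simp only [Matrix.mul_apply (M := S.C _ * X _), Matrix.mul_apply (N := Y a), Matrix.of_apply]
  rw [intervalIntegral.integral_finsetSum]
  · simp only [intervalIntegral.integral_mul_const]
  · intro k _
    exact Continuous.intervalIntegrable (by fun_prop) _ _

namespace Core

theorem cont_stackA (h : Core S T x y) : Continuous (stackA S) :=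
  continuous_matrix fun i j => by
    rcases i with i | i
    · exact h.contA.matrix_elem i j
    · exact h.contC.matrix_elem i j

theorem cont_stackB (h : Core S T x y) : Continuous (stackB S) :=
  continuous_matrix fun i j => by
    rcases i with i | i
    · exact h.contB.matrix_elem i j
    · exact h.contD.matrix_elem i j

theorem cont_state (h : Core S T x y) (k : Fin n) : Continuous fun t => x t k :=
  h.contX (Sum.inl k)

theorem cont_drift (h : Core S T x y) (i) : Continuous (stackDrift S x i) :=
  continuous_finsetSum _ fun j _ => (h.cont_stackA.matrix_elem i j).smul (h.cont_state j)

theorem cont_noise (h : Core S T x y) (i) : Continuous (sysNoise S x y i) :=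
  (h.contX i).sub (intervalIntegral.continuous_primitive
    (fun a b => (h.cont_drift i).intervalIntegrable a b) 0)

theorem sub_eq (h : Core S T x y) (i) (s t : ℝ) : stackX x y i t - stackX x y i s =
    (∫ τ in s..t, stackDrift S x i τ) + (sysNoise S x y i t - sysNoise S x y i s) := by
  have hi : ∀ a b, IntervalIntegrable (stackDrift S x i) volume a b :=
    fun a b => (h.cont_drift i).intervalIntegrable a b
  rw [← intervalIntegral.integral_interval_sub_left (hi 0 t) (hi 0 s), sysNoise, sysNoise]
  abel

theorem exists_noise_bound (h : Core S T x y) : ∃ κ, 0 ≤ κ ∧ ∀ i s t, 0 ≤ s → s ≤ t → t ≤ T →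
    ‖sysNoise S x y i t - sysNoise S x y i s‖ ^ 2 ≤ κ * (t - s) := by
  obtain ⟨κ, hκ0, hκ⟩ := exists_entry_bound (A := fun t => stackB S t * (stackB S t)ᵀ)
    (h.cont_stackB.matrix_mul h.cont_stackB.matrix_transpose) (isCompact_Icc (a := 0) (b := T))
  refine ⟨κ, hκ0, fun i s t hs hst ht => ?_⟩
  rw [← real_inner_self_eq_norm_sq, (h.noise i i).cov hs hst ht]
  have := intervalIntegral.integral_mono_on (μ := volume) hst
      ((h.noise i i).cont.intervalIntegrable s t) (intervalIntegrable_const (c := κ)) fun τ hτ =>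
        (le_abs_self _).trans (hκ τ ⟨hs.trans hτ.1, hτ.2.trans ht⟩ i i)
  rwa [intervalIntegral.integral_const, smul_eq_mul, mul_comm] at this

theorem state_mem (h : Core S T x y) {r s : ℝ} (hr : 0 ≤ r) (hrs : r ≤ s) (k : Fin n) :
    x r k ∈ pastSpace S T x y s :=
  mem_pastSpace.2 fun i _ _ h1 h2 h3 => h.past_state i k hr (hrs.trans h1) h2 h3

theorem output_mem (h : Core S T x y) {q r s : ℝ} (hq : 0 ≤ q) (hqs : q ≤ s) (hr : 0 ≤ r)
    (hrs : r ≤ s) (k : Fin m) : y r k - y q k ∈ pastSpace S T x y s := by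
  have : ∀ r, 0 ≤ r → r ≤ s → y r k - y 0 k ∈ pastSpace S T x y s := fun r h0 h1 =>
    mem_pastSpace.2 fun i _ _ h2 h3 h4 => h.past_output i k h0 (h1.trans h2) h3 h4
  rw [← sub_sub_sub_cancel_right _ _ (y 0 k)]
  exact (pastSpace S T x y s).toSubmodule.sub_mem (this r hr hrs) (this q hq hqs)

variable [CompleteSpace E]

theorem inner_sub_of_mem_past (h : Core S T x y) {s t₁ t₂ : ℝ} {v : E}
    (hv : v ∈ pastSpace S T x y s) (h1 : s ≤ t₁) (h2 : t₁ ≤ t₂) (h3 : t₂ ≤ T) (i) :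
    inner ℝ v (stackX x y i t₂) - inner ℝ v (stackX x y i t₁) =
      ∫ τ in t₁..t₂, ∑ j, stackA S τ i j * inner ℝ v (x τ j) := by
  rw [← inner_sub_right, h.sub_eq, inner_add_right, mem_pastSpace.1 hv i _ _ h1 h2 h3, add_zero,
    inner_intervalIntegral _ (h.cont_drift i)]
  simp only [stackDrift, inner_sum, real_inner_smul_right]

/-- Covariances of the later states with a vector of the past propagate by the transition
matrix. -/
theorem inner_state_of_mem_past (h : Core S T x y) {X Y : ℝ → Matrix (Fin n) (Fin n) ℝ}
    (hXY : IsFundamental S.A X Y) {s t : ℝ} {v : E}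
    (hv : v ∈ pastSpace S T x y s) (hst : s ≤ t) (ht : t ≤ T) (i : Fin n) :
    inner ℝ v (x t i) = ∑ j, (X t * Y s) i j * inner ℝ v (x s j) := by
  set Z : ℝ → Matrix (Fin n) (Fin 1) ℝ := fun τ => Matrix.of fun i _ => inner ℝ v (x τ i)
  have hZ : ∀ τ ∈ Icc s T, HasMatDeriv Z (S.A τ * Z τ) (Icc s T) τ := by
    intro τ hτ i j
    have hc : ∀ k, Continuous fun t => x t k := h.cont_state
    have hA := h.contA
    have := hasDerivWithinAt_of_integral (φ := fun τ => inner ℝ v (x τ i)) (a := s) (b := T)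
      (h := fun τ => ∑ j, S.A τ i j * inner ℝ v (x τ j)) (by fun_prop)
      (fun t ht => h.inner_sub_of_mem_past hv le_rfl ht.1 ht.2 (Sum.inl i)) hτ
    simpa [Z, Matrix.mul_apply] using this
  have hy := eq_mul_of_hasMatDeriv (fun τ => hXY.deriv_right (Icc s T) τ) hZ
    (t := t) ⟨hst, ht⟩
  have : Z t = X t * Y s * Z s := by
    rw [Matrix.mul_assoc, ← hy, ← Matrix.mul_assoc, hXY.mul_inv, Matrix.one_mul]
  have := congrFun (congrFun this i) 0
  simpa [Z, Matrix.mul_apply] using this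

/-- Covariances of the later output increments with a vector of the past. -/
theorem inner_output_of_mem_past (h : Core S T x y) {s t : ℝ} {v : E}
    (hv : v ∈ pastSpace S T x y s) (hst : s ≤ t) (ht : t ≤ T) (i : Fin m) :
    inner ℝ v (y t i - y s i) = ∑ j, gapC S s t i j * inner ℝ v (x s j) := by
  obtain ⟨X, Y, hXY⟩ := exists_isFundamental h.contA
  have hX := hXY.cont_left
  have hC := h.contC
  have h1 := h.inner_sub_of_mem_past hv le_rfl hst ht (Sum.inr i)
  rw [inner_sub_right]
  refine h1.trans ?_
  have h2 : ∫ τ in s..t, ∑ j, stackA S τ (Sum.inr i) j * inner ℝ v (x τ j) =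
      ∫ τ in s..t, ∑ j, (S.C τ * transition S.A τ s) i j * inner ℝ v (x s j) := by
    refine intervalIntegral.integral_congr fun τ hτ => ?_
    rw [uIcc_of_le hst] at hτ
    simp only [hXY.transition_eq, Matrix.mul_apply (M := S.C τ), Finset.sum_mul]
    rw [Finset.sum_comm]
    refine Finset.sum_congr rfl fun k _ => ?_
    rw [h.inner_state_of_mem_past hXY hv hτ.1 (hτ.2.trans ht) k, Finset.mul_sum]
    exact Finset.sum_congr rfl fun l _ => by simp [stackA, mul_assoc]
  rw [h2, intervalIntegral.integral_finsetSum]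
  · simp only [intervalIntegral.integral_mul_const, gapC, Matrix.of_apply]
  · intro k _
    simp only [hXY.transition_eq]
    exact Continuous.intervalIntegrable (by fun_prop) _ _

end Core

end Core

/-! ### Driven processes and the time-reversed system -/

section Driven

theorem intervalIntegral_mem {E : Type*} [NormedAddCommGroup E] [InnerProductSpace ℝ E]
    [CompleteSpace E] (K : ClosedSubmodule ℝ E) {s t : ℝ} (hst : s ≤ t) {f : ℝ → E}
    (hf : Continuous f) (hmem : ∀ τ, s ≤ τ → τ ≤ t → f τ ∈ K) : ∫ τ in s..t, f τ ∈ K := by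
  have h1 := K.toSubmodule.starProjection.intervalIntegral_comp_comm (μ := volume)
    (hf.intervalIntegrable s t)
  refine (Submodule.starProjection_eq_self_iff (K := K.toSubmodule)).1 (h1.symm.trans ?_)
  refine intervalIntegral.integral_congr fun τ hτ => ?_
  rw [uIcc_of_le hst] at hτ
  exact (Submodule.starProjection_eq_self_iff (K := K.toSubmodule)).2 (hmem τ hτ.1 hτ.2)

variable {E : Type*} [NormedAddCommGroup E] [InnerProductSpace ℝ E]

/-- `du = f dt + dμ` on `[a, c]`, where `u` is adapted to the family of subspaces `F` and the
increments of the mean-square Lipschitz noise `μ` are orthogonal to the past. -/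
structure IsDriven (F : ℝ → ClosedSubmodule ℝ E) (a c : ℝ) (u f μ : ℝ → E) : Prop where
  cont : Continuous u
  cont_drift : Continuous f
  drift : ∀ s t, a ≤ s → s ≤ t → t ≤ c → u t - u s = (∫ τ in s..t, f τ) + (μ t - μ s)
  adapted : ∀ s, a ≤ s → s ≤ c → u s ∈ F s
  orth : ∀ s t, a ≤ s → s ≤ t → t ≤ c → ∀ v ∈ F s, inner ℝ v (μ t - μ s) = 0
  bound : ∃ κ, ∀ s t, a ≤ s → s ≤ t → t ≤ c → ‖μ t - μ s‖ ^ 2 ≤ κ * (t - s)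

/-- Product rule for two driven processes. -/
theorem IsDriven.inner_sub_inner [CompleteSpace E] {F : ℝ → ClosedSubmodule ℝ E} {a c : ℝ}
    {u f μ v g ν : ℝ → E} {γ : ℝ → ℝ} (hu : IsDriven F a c u f μ) (hv : IsDriven F a c v g ν)
    (hγ : Continuous γ)
    (hμν : ∀ s t, a ≤ s → s ≤ t → t ≤ c → inner ℝ (μ t - μ s) (ν t - ν s) = ∫ τ in s..t, γ τ)
    {t : ℝ} (ht : t ∈ Icc a c) :
    inner ℝ (u t) (v t) - inner ℝ (u a) (v a) =
      ∫ τ in a..t, (inner ℝ (f τ) (v τ) + inner ℝ (u τ) (g τ) + γ τ) := by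
  obtain ⟨κ₁, h₁⟩ := hu.bound
  obtain ⟨κ₂, h₂⟩ := hv.bound
  refine inner_sub_inner_eq_integral (κ := max κ₁ κ₂) hu.cont_drift hv.cont_drift hu.cont hv.cont
    hγ hu.drift hv.drift
    (fun s t h1 h2 h3 => hu.orth s t h1 h2 h3 _ (hv.adapted s h1 (h2.trans h3)))
    (fun s t h1 h2 h3 => hv.orth s t h1 h2 h3 _ (hu.adapted s h1 (h2.trans h3))) hμν
    (fun s t h1 h2 h3 => (h₁ s t h1 h2 h3).trans ?_)
    (fun s t h1 h2 h3 => (h₂ s t h1 h2 h3).trans ?_) ht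
  · exact mul_le_mul_of_nonneg_right (le_max_left _ _) (by linarith)
  · exact mul_le_mul_of_nonneg_right (le_max_right _ _) (by linarith)

theorem IsDriven.hasDerivWithinAt [CompleteSpace E] {F : ℝ → ClosedSubmodule ℝ E} {a c : ℝ}
    {u f μ v g ν : ℝ → E} {γ : ℝ → ℝ} (hu : IsDriven F a c u f μ) (hv : IsDriven F a c v g ν)
    (hγ : Continuous γ)
    (hμν : ∀ s t, a ≤ s → s ≤ t → t ≤ c → inner ℝ (μ t - μ s) (ν t - ν s) = ∫ τ in s..t, γ τ)
    {t : ℝ} (ht : t ∈ Icc a c) :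
    HasDerivWithinAt (fun t => inner ℝ (u t) (v t))
      (inner ℝ (f t) (v t) + inner ℝ (u t) (g t) + γ t) (Icc a c) t := by
  have h1 := hu.cont
  have h2 := hu.cont_drift
  have h3 := hv.cont
  have h4 := hv.cont_drift
  exact hasDerivWithinAt_of_integral
    (h := fun t => inner ℝ (f t) (v t) + inner ℝ (u t) (g t) + γ t) (by fun_prop)
    (fun t ht => hu.inner_sub_inner hv hγ hμν ht) ht

end Driven

section CoreCov

variable {E : Type*} [NormedAddCommGroup E] [InnerProductSpace ℝ E] {n m p : ℕ}
  {S : LinModel n m p} {T : ℝ} {x : ℝ → Fin n → E} {y : ℝ → Fin m → E}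

/-- Covariance density of the noise of the stacked process. -/
def stackΓ (S : LinModel n m p) (t : ℝ) : Matrix (Fin n ⊕ Fin m) (Fin n ⊕ Fin m) ℝ :=
  stackB S t * (stackB S t)ᵀ

namespace Core

theorem cont_stackΓ (h : Core S T x y) : Continuous (stackΓ S) :=
  h.cont_stackB.matrix_mul h.cont_stackB.matrix_transpose

/-- The stacked process, with the output counted from time `a`, is driven by the noise. -/
theorem isDriven (h : Core S T x y) {a : ℝ} (ha : 0 ≤ a) (i : Fin n ⊕ Fin m) :
    IsDriven (pastSpace S T x y) a T (fun t => stackX x y i t - Sum.elim (fun _ => 0) (y a) i)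
      (stackDrift S x i) (sysNoise S x y i) where
  cont := (h.contX i).sub continuous_const
  cont_drift := h.cont_drift i
  drift s t _ _ _ := by rw [sub_sub_sub_cancel_right]; exact h.sub_eq i s t
  adapted s has _ := by
    rcases i with i | i
    · simpa [stackX] using h.state_mem (ha.trans has) le_rfl i
    · exact h.output_mem ha has (ha.trans has) le_rfl i
  orth s t _ hst htT v hv := mem_pastSpace.1 hv i s t le_rfl hst htT
  bound := by
    obtain ⟨κ, _, hκ⟩ := h.exists_noise_bound
    exact ⟨κ, fun s t h1 h2 h3 => hκ i s t (ha.trans h1) h2 h3⟩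

theorem isDriven_state (h : Core S T x y) {a : ℝ} (ha : 0 ≤ a) (k : Fin n) :
    IsDriven (pastSpace S T x y) a T (fun t => x t k)
      (stackDrift S x (Sum.inl k)) (sysNoise S x y (Sum.inl k)) := by
  simpa [stackX] using h.isDriven ha (Sum.inl k)

variable [CompleteSpace E]

/-- The unit state covariance forces `A + A' + B B' = 0`. -/
theorem add_transpose_add (h : Core S T x y) (hT : 0 < T) {t : ℝ} (ht : t ∈ Icc 0 T) :
    S.A t + (S.A t)ᵀ + S.B t * (S.B t)ᵀ = 0 := by
  ext i j
  have h1 := (h.isDriven_state le_rfl i).hasDerivWithinAt (h.isDriven_state le_rfl j)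
    (h.noise _ _).cont (fun s t h1 h2 h3 => (h.noise _ _).cov h1 h2 h3) ht
  have h2 : HasDerivWithinAt (fun t => inner ℝ (x t i) (x t j)) 0 (Icc 0 T) t :=
    (hasDerivWithinAt_const t (Icc 0 T) ((1 : Matrix (Fin n) (Fin n) ℝ) i j)).congr
      (fun s hs => h.cov_state s hs i j) (h.cov_state t ht i j)
  have h3 := (uniqueDiffOn_Icc hT t ht).eq_deriv _ h1 h2
  simp only [stackDrift, sum_inner, inner_sum, real_inner_smul_left, real_inner_smul_right,
    h.cov_state t ht] at h3
  simpa [Matrix.one_apply, stackA, stackB, Matrix.mul_apply] using h3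

end Core

/-- The increment over `[s, t]` of the noise of the time-reversed system. Subtracting `∫ Γ_{i,x} x dτ`,
where `Γ_{i,x}` is the joint density of the `i`-th noise and the state noise, makes it orthogonal
to the future instead of the past. -/
noncomputable def backNoise (S : LinModel n m p) (x : ℝ → Fin n → E) (y : ℝ → Fin m → E)
    (i : Fin n ⊕ Fin m) (s t : ℝ) : E :=
  sysNoise S x y i t - sysNoise S x y i s - ∫ τ in s..t, ∑ j, stackΓ S τ i (Sum.inl j) • x τ j

/-- Drift of the increment of the backward noise as a function of its right end point. -/
def backDrift (S : LinModel n m p) (x : ℝ → Fin n → E) (i : Fin n ⊕ Fin m) (t : ℝ) : E :=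
  -∑ j, stackΓ S t i (Sum.inl j) • x t j

namespace Core

theorem backNoise_self (i) (s : ℝ) : backNoise S x y i s s = 0 := by simp [backNoise]

theorem cont_backDrift (h : Core S T x y) (i) : Continuous (backDrift S x i) := by
  have h1 := h.cont_stackΓ
  have h2 := h.cont_state
  unfold backDrift
  exact (continuous_finsetSum _ fun j _ => (h1.matrix_elem i (Sum.inl j)).smul (h2 j)).neg

theorem backNoise_eq (i) (s t : ℝ) : backNoise S x y i s t =
    sysNoise S x y i t - sysNoise S x y i s + ∫ τ in s..t, backDrift S x i τ := by
  rw [backNoise, sub_eq_add_neg, ← intervalIntegral.integral_neg]; rfl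

theorem inner_backDrift_right (i) (t : ℝ) (v : E) : inner ℝ v (backDrift S x i t) =
    -∑ j, stackΓ S t i (Sum.inl j) * inner ℝ v (x t j) := by
  simp only [backDrift, inner_neg_right, inner_sum, real_inner_smul_right]

theorem drift_mem_past (h : Core S T x y) {s t : ℝ} (hs : 0 ≤ s) (hst : s ≤ t) (i) :
    stackDrift S x i s ∈ pastSpace S T x y t :=
  (pastSpace S T x y t).toSubmodule.sum_mem fun j _ =>
    (pastSpace S T x y t).toSubmodule.smul_mem _ (h.state_mem hs hst j)

theorem backDrift_mem_past (h : Core S T x y) {s t : ℝ} (hs : 0 ≤ s) (hst : s ≤ t) (i) :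
    backDrift S x i s ∈ pastSpace S T x y t :=
  (pastSpace S T x y t).toSubmodule.neg_mem ((pastSpace S T x y t).toSubmodule.sum_mem fun j _ =>
    (pastSpace S T x y t).toSubmodule.smul_mem _ (h.state_mem hs hst j))

variable [CompleteSpace E]

theorem noise_mem_past (h : Core S T x y) {s t : ℝ} (hs : 0 ≤ s) (hst : s ≤ t) (i) :
    sysNoise S x y i t - sysNoise S x y i s ∈ pastSpace S T x y t := by
  have h1 : stackX x y i t - stackX x y i s ∈ pastSpace S T x y t := by
    rcases i with i | i
    · exact (pastSpace S T x y t).toSubmodule.sub_mem (h.state_mem (hs.trans hst) le_rfl i)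
        (h.state_mem hs hst i)
    · exact h.output_mem hs hst (hs.trans hst) le_rfl i
  have h2 := intervalIntegral_mem _ hst (h.cont_drift i)
    fun τ h1 h2 => h.drift_mem_past (hs.trans h1) h2 i
  rw [← add_sub_cancel_left (∫ τ in s..t, stackDrift S x i τ)
    (sysNoise S x y i t - sysNoise S x y i s), ← h.sub_eq]
  exact (pastSpace S T x y t).toSubmodule.sub_mem h1 h2

/-- For a fixed left end point, the increment of the backward noise is a driven process. -/
theorem isDriven_backNoise (h : Core S T x y) {s : ℝ} (hs : 0 ≤ s) (i) :
    IsDriven (pastSpace S T x y) s T (backNoise S x y i s) (backDrift S x i)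
      (sysNoise S x y i) where
  cont := by
    have h1 := h.cont_noise i
    have h2 : Continuous fun t => ∫ τ in s..t, backDrift S x i τ :=
      intervalIntegral.continuous_primitive
        (fun a b => (h.cont_backDrift i).intervalIntegrable a b) s
    simp only [funext (backNoise_eq (S := S) (x := x) (y := y) i s)]
    fun_prop
  cont_drift := h.cont_backDrift i
  drift a b _ _ _ := by
    have hi : ∀ a b, IntervalIntegrable (backDrift S x i) volume a b :=
      fun a b => (h.cont_backDrift i).intervalIntegrable a b
    rw [backNoise_eq, backNoise_eq, ← intervalIntegral.integral_interval_sub_left (hi s b) (hi s a)]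
    abel
  adapted t hst htT := by
    rw [backNoise_eq]
    exact (pastSpace S T x y t).toSubmodule.add_mem (h.noise_mem_past hs hst i)
      (intervalIntegral_mem _ hst (h.cont_backDrift i)
        fun τ h1 h2 => h.backDrift_mem_past (hs.trans h1) h2 i)
  orth a b _ h2 h3 v hv := mem_pastSpace.1 hv i a b le_rfl h2 h3
  bound := (h.isDriven hs i).bound

/-- The backward noise is orthogonal to the present state. -/
theorem inner_backNoise_state (h : Core S T x y) {s t : ℝ} (hs : 0 ≤ s) (hst : s ≤ t) (htT : t ≤ T)
    (i) (k : Fin n) : inner ℝ (backNoise S x y i s t) (x t k) = 0 := by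
  obtain ⟨X, Y, hXY⟩ := exists_isFundamental h.contA
  set Z : ℝ → Matrix (Fin n) (Fin 1) ℝ :=
    fun τ => Matrix.of fun k _ => inner ℝ (backNoise S x y i s τ) (x τ k)
  have hZ : ∀ τ ∈ Icc s T, HasMatDeriv Z (S.A τ * Z τ) (Icc s T) τ := by
    intro τ hτ k j
    have := (h.isDriven_backNoise hs i).hasDerivWithinAt (h.isDriven_state hs k)
      (h.noise _ _).cont (fun s t h1 h2 h3 => (h.noise _ _).cov (hs.trans h1) h2 h3) hτ
    refine this.congr_deriv ?_
    rw [real_inner_comm, inner_backDrift_right]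
    simp only [stackDrift, inner_sum, real_inner_smul_right, h.cov_state τ ⟨hs.trans hτ.1, hτ.2⟩,
      Matrix.mul_apply, Z, Matrix.of_apply]
    simp [Matrix.one_apply, stackA, stackΓ, Matrix.mul_apply]
  have hy := eq_mul_of_hasMatDeriv (fun τ => hXY.deriv_right (Icc s T) τ) hZ (t := t) ⟨hst, htT⟩
  have h0 : Z s = 0 := by ext k j; simp [Z, backNoise_self]
  rw [h0, Matrix.mul_zero] at hy
  have : Z t = 0 := by
    rw [← Matrix.one_mul (Z t), ← hXY.mul_inv t, Matrix.mul_assoc, hy, Matrix.mul_zero]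
  exact congrFun (congrFun this k) 0

/-- The backward noise is orthogonal to all later states. -/
theorem inner_backNoise_later_state (h : Core S T x y) {s t r : ℝ} (hs : 0 ≤ s) (hst : s ≤ t)
    (htr : t ≤ r) (hrT : r ≤ T) (i) (k : Fin n) :
    inner ℝ (backNoise S x y i s t) (x r k) = 0 := by
  obtain ⟨X, Y, hXY⟩ := exists_isFundamental h.contA
  rw [h.inner_state_of_mem_past hXY ((h.isDriven_backNoise hs i).adapted t hst (htr.trans hrT))
    htr hrT]
  simp [h.inner_backNoise_state hs hst (htr.trans hrT)]

/-- The backward noise is orthogonal to all later increments of the stacked process. -/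
theorem inner_backNoise_later (h : Core S T x y) {s t a b : ℝ} (hs : 0 ≤ s) (hst : s ≤ t)
    (hta : t ≤ a) (hab : a ≤ b) (hbT : b ≤ T) (i j) :
    inner ℝ (backNoise S x y i s t) (stackX x y j b - stackX x y j a) = 0 := by
  have hm := (h.isDriven_backNoise hs i).adapted t hst (hta.trans (hab.trans hbT))
  rw [inner_sub_right, h.inner_sub_of_mem_past hm hta hab hbT]
  refine intervalIntegral.integral_zero_ae (Eventually.of_forall fun τ hτ => ?_)
  rw [uIoc_of_le hab] at hτ
  exact Finset.sum_eq_zero fun k _ => by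
    rw [h.inner_backNoise_later_state hs hst (hta.trans hτ.1.le) (hτ.2.trans hbT), mul_zero]

theorem inner_backNoise_backNoise_later (h : Core S T x y) {s t a b : ℝ} (hs : 0 ≤ s)
    (hst : s ≤ t) (hta : t ≤ a) (hab : a ≤ b) (hbT : b ≤ T) (i j) :
    inner ℝ (backNoise S x y i s t) (backNoise S x y j a b) = 0 := by
  have h1 := h.inner_backNoise_later hs hst hta hab hbT i j
  have hz : ∀ (k : Fin n) τ, τ ∈ uIoc a b → inner ℝ (backNoise S x y i s t) (x τ k) = 0 := by
    intro k τ hτ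
    rw [uIoc_of_le hab] at hτ
    exact h.inner_backNoise_later_state hs hst (hta.trans hτ.1.le) (hτ.2.trans hbT) i k
  rw [h.sub_eq, inner_add_right, inner_intervalIntegral _ (h.cont_drift j)] at h1
  rw [backNoise_eq (i := j), inner_add_right, inner_intervalIntegral _ (h.cont_backDrift j)]
  have e1 : ∫ τ in a..b, inner ℝ (backNoise S x y i s t) (stackDrift S x j τ) = 0 :=
    intervalIntegral.integral_zero_ae (Eventually.of_forall fun τ hτ => by
      simp [stackDrift, inner_sum, real_inner_smul_right, hz _ τ hτ])
  have e2 : ∫ τ in a..b, inner ℝ (backNoise S x y i s t) (backDrift S x j τ) = 0 :=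
    intervalIntegral.integral_zero_ae (Eventually.of_forall fun τ hτ => by
      simp [inner_backDrift_right, hz _ τ hτ])
  rw [e1, zero_add] at h1
  rw [e2, h1, add_zero]

/-- The backward noise has the same covariance density as the forward noise. -/
theorem inner_backNoise_backNoise (h : Core S T x y) {s t : ℝ} (hs : 0 ≤ s)
    (hst : s ≤ t) (htT : t ≤ T) (i j) :
    inner ℝ (backNoise S x y i s t) (backNoise S x y j s t) = ∫ τ in s..t, stackΓ S τ i j := by
  have := (h.isDriven_backNoise hs i).inner_sub_inner (h.isDriven_backNoise hs j)
      (h.noise _ _).cont (fun s t h1 h2 h3 => (h.noise _ _).cov (hs.trans h1) h2 h3)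
      (t := t) ⟨hst, htT⟩
  rw [backNoise_self, inner_zero_left, sub_zero] at this
  rw [this]
  refine intervalIntegral.integral_congr fun τ hτ => ?_
  rw [uIcc_of_le hst] at hτ
  have e1 := h.inner_backNoise_state hs hτ.1 (hτ.2.trans htT) i
  have e2 := h.inner_backNoise_state hs hτ.1 (hτ.2.trans htT) j
  change _ + _ + stackΓ S τ i j = _
  rw [real_inner_comm, inner_backDrift_right, inner_backDrift_right]
  simp [e1, e2]

end Core

/-- The model of the time-reversed process `t ↦ (x (T - t), y (T - t))`. -/
def revModel (S : LinModel n m p) (T : ℝ) : LinModel n m p where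
  A t := (S.A (T - t))ᵀ
  B t := S.B (T - t)
  C t := -(S.C (T - t) + S.D (T - t) * (S.B (T - t))ᵀ)
  D t := S.D (T - t)

namespace Core

theorem cont_rev (h : Core S T x y) : Continuous (revModel S T).A ∧ Continuous (revModel S T).B ∧
    Continuous (revModel S T).C ∧ Continuous (revModel S T).D := by
  have h1 := h.contA
  have h2 := h.contB
  have h3 := h.contC
  have h4 := h.contD
  refine ⟨?_, ?_, ?_, ?_⟩ <;> (dsimp only [revModel]; fun_prop)

variable [CompleteSpace E]

theorem stackDrift_rev (h : Core S T x y) (hT : 0 < T) {t : ℝ} (ht : t ∈ Icc 0 T) (i) :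
    stackDrift (revModel S T) (fun t => x (T - t)) i t =
      -(stackDrift S x i (T - t) - backDrift S x i (T - t)) := by
  have ht' : T - t ∈ Icc 0 T := ⟨by linarith [ht.2], by linarith [ht.1]⟩
  have hA := h.add_transpose_add hT ht'
  have hA' : (S.A (T - t))ᵀ = -(S.A (T - t) + S.B (T - t) * (S.B (T - t))ᵀ) := by
    rw [eq_neg_iff_add_eq_zero, ← hA]; abel
  rw [stackDrift, stackDrift, backDrift, sub_neg_eq_add, ← Finset.sum_add_distrib,
    ← Finset.sum_neg_distrib]
  refine Finset.sum_congr rfl fun j _ => ?_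
  rw [← add_smul, ← neg_smul]
  congr 1
  rcases i with i | i
  · have := congrFun (congrFun hA' i) j
    simp only [Matrix.neg_apply, Matrix.add_apply, Matrix.mul_apply, Matrix.transpose_apply] at this
    simp [stackA, revModel, stackΓ, stackB, Matrix.mul_apply, this]
  · simp [stackA, revModel, stackΓ, stackB, Matrix.mul_apply]

/-- The noise of the reversed model is the backward noise, with reversed sign. -/
theorem sysNoise_rev_sub (h : Core S T x y) (hT : 0 < T) {s t : ℝ} (hs : 0 ≤ s) (hst : s ≤ t)
    (ht : t ≤ T) (i) :
    sysNoise (revModel S T) (fun t => x (T - t)) (fun t => y (T - t)) i t -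
      sysNoise (revModel S T) (fun t => x (T - t)) (fun t => y (T - t)) i s =
      -backNoise S x y i (T - t) (T - s) := by
  have hr := h.cont_rev
  have hi : ∀ a b, IntervalIntegrable (stackDrift (revModel S T) (fun t => x (T - t)) i)
      volume a b := fun a b => by
    have hA : Continuous (stackA (revModel S T)) := continuous_matrix fun i j => by
      rcases i with i | i
      · exact hr.1.matrix_elem i j
      · exact hr.2.2.1.matrix_elem i j
    exact Continuous.intervalIntegrable (continuous_finsetSum _ fun j _ =>
      (hA.matrix_elem i j).smul ((h.cont_state j).comp (continuous_const.sub continuous_id))) a b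
  have h1 : ∫ τ in s..t, stackDrift (revModel S T) (fun t => x (T - t)) i τ =
      -∫ τ in (T - t)..(T - s), (stackDrift S x i τ - backDrift S x i τ) := by
    rw [← intervalIntegral.integral_comp_sub_left
      (fun τ => stackDrift S x i τ - backDrift S x i τ) T, ← intervalIntegral.integral_neg]
    refine intervalIntegral.integral_congr fun τ hτ => ?_
    rw [uIcc_of_le hst] at hτ
    exact h.stackDrift_rev hT ⟨hs.trans hτ.1, hτ.2.trans ht⟩ i
  have h2 := h.sub_eq i (T - t) (T - s)
  rw [intervalIntegral.integral_sub ((h.cont_drift i).intervalIntegrable _ _)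
    ((h.cont_backDrift i).intervalIntegrable _ _)] at h1
  rw [sysNoise, sysNoise, backNoise_eq, sub_sub_sub_comm,
    intervalIntegral.integral_interval_sub_left (hi _ _) (hi _ _), h1]
  change stackX x y i (T - t) - stackX x y i (T - s) - _ = _
  rw [← neg_sub (stackX x y i (T - s)), h2]
  abel

/-- The time-reversed process is again a normalized linear system. -/
theorem rev (h : Core S T x y) (hT : 0 < T) :
    Core (revModel S T) T (fun t => x (T - t)) (fun t => y (T - t)) where
  contA := h.cont_rev.1
  contB := h.cont_rev.2.1
  contC := h.cont_rev.2.2.1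
  contD := h.cont_rev.2.2.2
  posR t := h.posR (T - t)
  contX i := (h.contX i).comp (continuous_const.sub continuous_id)
  noise i j :=
    { cont := (h.noise i j).cont.comp (continuous_const.sub continuous_id)
      cov := fun s t hs hst ht => by
        rw [h.sysNoise_rev_sub hT hs hst ht, h.sysNoise_rev_sub hT hs hst ht, inner_neg_neg,
          h.inner_backNoise_backNoise (by linarith) (by linarith) (by linarith),
          ← intervalIntegral.integral_comp_sub_left (fun τ => stackΓ S τ i j)]
        rfl
      orth₁ := fun s t s' t' hs hst hts hst' ht' => by
        rw [h.sysNoise_rev_sub hT hs hst (by linarith),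
          h.sysNoise_rev_sub hT (by linarith) hst' ht', inner_neg_neg, real_inner_comm,
          h.inner_backNoise_backNoise_later (by linarith) (by linarith) (by linarith)
            (by linarith) (by linarith)]
      orth₂ := fun s t s' t' hs hst hts hst' ht' => by
        rw [h.sysNoise_rev_sub hT hs hst (by linarith),
          h.sysNoise_rev_sub hT (by linarith) hst' ht', inner_neg_neg,
          h.inner_backNoise_backNoise_later (by linarith) (by linarith) (by linarith)
            (by linarith) (by linarith)] }
  past_state i k r s t hr hrs hst ht := by
    rw [h.sysNoise_rev_sub hT (hr.trans hrs) hst ht, inner_neg_right, real_inner_comm,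
      h.inner_backNoise_later_state (by linarith) (by linarith) (by linarith) (by linarith),
      neg_zero]
  past_output i k r s t hr hrs hst ht := by
    rw [h.sysNoise_rev_sub hT (hr.trans hrs) hst ht, inner_neg_right, real_inner_comm]
    have := h.inner_backNoise_later (s := T - t) (t := T - s) (a := T - r) (b := T - 0)
      (by linarith) (by linarith) (by linarith) (by linarith) (by linarith) i (Sum.inr k)
    simp only [stackX, Sum.elim_inr] at this
    rw [← neg_sub (y (T - 0) k), inner_neg_right, this, neg_zero, neg_zero]
  cov_state t ht i j := h.cov_state (T - t) ⟨by linarith [ht.2], by linarith [ht.1]⟩ i j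

end Core
end CoreCov

/-! ### Integrals with respect to the noise of the system -/

section Tools

variable {E : Type*} [NormedAddCommGroup E] [InnerProductSpace ℝ E]

/-- The closed subspace of vectors orthogonal to `v`. -/
noncomputable def orthTo (v : E) : ClosedSubmodule ℝ E :=
  { (ℝ ∙ v)ᗮ with isClosed' := Submodule.isClosed_orthogonal _ }

theorem mem_orthTo {v w : E} : w ∈ orthTo v ↔ inner ℝ v w = 0 :=
  Submodule.mem_orthogonal_singleton_iff_inner_right

/-- Uniqueness for the linear matrix equation `Z' = M Z + Z N'`. -/
theorem eq_zero_of_hasMatDeriv {n k : ℕ} {M : ℝ → Matrix (Fin n) (Fin n) ℝ}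
    {N : ℝ → Matrix (Fin k) (Fin k) ℝ} {Z : ℝ → Matrix (Fin n) (Fin k) ℝ} {a b t : ℝ}
    (hM : Continuous M) (hN : Continuous N)
    (hZ : ∀ τ ∈ Icc a b, HasMatDeriv Z (M τ * Z τ + Z τ * (N τ)ᵀ) (Icc a b) τ) (h0 : Z a = 0)
    (ht : t ∈ Icc a b) : Z t = 0 := by
  obtain ⟨X, Y, hXY⟩ := exists_isFundamental hM
  obtain ⟨X', Y', hXY'⟩ := exists_isFundamental hN
  have h1 := HasMatDeriv.eq_of_deriv_eq_zero (M := fun τ => Y τ * Z τ * (Y' τ)ᵀ) (a := a) (b := b)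
    (fun τ hτ => by
      have := ((hXY.deriv_right (Icc a b) τ).mul (hZ τ hτ)).mul
        (hXY'.deriv_right (Icc a b) τ).transpose
      have e : (-(Y τ * M τ) * Z τ + Y τ * (M τ * Z τ + Z τ * (N τ)ᵀ)) * (Y' τ)ᵀ +
          Y τ * Z τ * (-(Y' τ * N τ))ᵀ = 0 := by
        simp only [Matrix.transpose_neg, Matrix.transpose_mul, Matrix.mul_add, Matrix.add_mul,
          Matrix.neg_mul, Matrix.mul_neg, Matrix.mul_assoc]
        abel
      rwa [e] at this) ht
  simp only [h0, Matrix.mul_zero, Matrix.zero_mul] at h1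
  have h2 : (Y' t)ᵀ * (X' t)ᵀ = 1 := by rw [← Matrix.transpose_mul, hXY'.mul_inv]; simp
  calc Z t = X t * (Y t * Z t * (Y' t)ᵀ) * (X' t)ᵀ := by
        rw [Matrix.mul_assoc (X t), Matrix.mul_assoc (Y t * Z t), h2, Matrix.mul_one,
          ← Matrix.mul_assoc, hXY.mul_inv, Matrix.one_mul]
    _ = 0 := by rw [h1]; simp

variable [CompleteSpace E]

/-- Covariances of a linearly driven process with a vector of the past propagate by the transition
matrix. -/
theorem IsDriven.inner_eq_of_mem {n : ℕ} {F : ℝ → ClosedSubmodule ℝ E} {a c : ℝ}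
    {u μ : Fin n → ℝ → E} {M X Y : ℝ → Matrix (Fin n) (Fin n) ℝ}
    (hu : ∀ i, IsDriven F a c (u i) (fun t => ∑ j, M t i j • u j t) (μ i))
    (hM : Continuous M) (hXY : IsFundamental M X Y) {s t : ℝ} {v : E} (hv : v ∈ F s)
    (has : a ≤ s) (hst : s ≤ t) (htc : t ≤ c) (i : Fin n) :
    inner ℝ v (u i t) = ∑ j, (X t * Y s) i j * inner ℝ v (u j s) := by
  have hc : ∀ i, Continuous (u i) := fun i => (hu i).cont
  set Z : ℝ → Matrix (Fin n) (Fin 1) ℝ := fun τ => Matrix.of fun i _ => inner ℝ v (u i τ)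
  have hZ : ∀ τ ∈ Icc s c, HasMatDeriv Z (M τ * Z τ) (Icc s c) τ := by
    intro τ hτ i j
    have := hasDerivWithinAt_of_integral (φ := fun τ => inner ℝ v (u i τ)) (a := s) (b := c)
      (h := fun τ => ∑ j, M τ i j * inner ℝ v (u j τ)) (by fun_prop)
      (fun t ht => by
        rw [← inner_sub_right, (hu i).drift s t has ht.1 ht.2, inner_add_right,
          (hu i).orth s t has ht.1 ht.2 v hv, add_zero,
          inner_intervalIntegral _ (hu i).cont_drift]
        simp only [inner_sum, real_inner_smul_right]) hτ
    simpa [Z, Matrix.mul_apply] using this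
  have hy := eq_mul_of_hasMatDeriv (fun τ => hXY.deriv_right (Icc s c) τ) hZ
    (t := t) ⟨hst, htc⟩
  have : Z t = X t * Y s * Z s := by
    rw [Matrix.mul_assoc, ← hy, ← Matrix.mul_assoc, hXY.mul_inv, Matrix.one_mul]
  have := congrFun (congrFun this i) 0
  simpa [Z, Matrix.mul_apply] using this

theorem NoisePair.stochInt_const {z : ℝ → E} {γ : ℝ → ℝ} {a b : ℝ} (h : NoisePair z z γ a b)
    (hz : Continuous z) (hab : a ≤ b) (r : ℝ) :
    stochInt (fun _ => r) z a b = r • (z b - z a) := by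
  have := meshFilter_neBot hab
  refine tendsto_nhds_unique (h.tendsto_stochInt hz continuous_const hab)
    (((tendsto_rsum_one z a b).const_smul r).congr fun P => ?_)
  simp only [rsum, one_smul, Finset.smul_sum]

theorem NoisePair.stochInt_neg {z : ℝ → E} {γ f : ℝ → ℝ} {a b : ℝ} (h : NoisePair z z γ a b)
    (hz : Continuous z) (hf : Continuous f) (hab : a ≤ b) :
    stochInt (fun t => -f t) z a b = -stochInt f z a b := by
  have := meshFilter_neBot hab
  refine tendsto_nhds_unique (h.tendsto_stochInt hz hf.neg hab)
    ((h.tendsto_stochInt hz hf hab).neg.congr fun P => ?_)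
  simp [rsum, Finset.sum_neg_distrib]

end Tools

section Wiener

variable {E : Type*} [NormedAddCommGroup E] [InnerProductSpace ℝ E] [CompleteSpace E] {n m p : ℕ}
  {S : LinModel n m p} {T : ℝ} {x : ℝ → Fin n → E} {y : ℝ → Fin m → E}

/-- The process `∑ i, ∫_a^t f i dζ i` for the noise `ζ` of the stacked process. -/
noncomputable def wiener (S : LinModel n m p) (x : ℝ → Fin n → E) (y : ℝ → Fin m → E)
    (f : Fin n ⊕ Fin m → ℝ → ℝ) (a c t : ℝ) : E :=
  ∑ i, stochPrim (f i) (sysNoise S x y i) a c t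

namespace Core

theorem wiener_sub (h : Core S T x y) {f : Fin n ⊕ Fin m → ℝ → ℝ}
    (hf : ∀ i, Continuous (f i)) {a c s t : ℝ} (ha : 0 ≤ a) (hc : c ≤ T) (has : a ≤ s)
    (hst : s ≤ t) (htc : t ≤ c) : wiener S x y f a c t - wiener S x y f a c s =
      ∑ i, stochInt (f i) (sysNoise S x y i) s t := by
  rw [wiener, wiener, ← Finset.sum_sub_distrib]
  exact Finset.sum_congr rfl fun i _ =>
    ((h.noise i i).mono ha hc).stochPrim_sub (h.cont_noise i) (hf i) has hst htc

theorem inner_wiener (h : Core S T x y) {f g : Fin n ⊕ Fin m → ℝ → ℝ}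
    (hf : ∀ i, Continuous (f i)) (hg : ∀ i, Continuous (g i)) {s t : ℝ} (hs : 0 ≤ s)
    (hst : s ≤ t) (htT : t ≤ T) :
    inner ℝ (∑ i, stochInt (f i) (sysNoise S x y i) s t)
      (∑ i, stochInt (g i) (sysNoise S x y i) s t) =
      ∫ τ in s..t, ∑ i, ∑ j, f i τ * stackΓ S τ i j * g j τ := by
  have hΓ := h.cont_stackΓ
  rw [intervalIntegral.integral_finsetSum fun i _ => Continuous.intervalIntegrable (by fun_prop) _ _,
    sum_inner]
  refine Finset.sum_congr rfl fun i _ => ?_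
  rw [intervalIntegral.integral_finsetSum fun j _ => Continuous.intervalIntegrable (by fun_prop) _ _,
    inner_sum]
  refine Finset.sum_congr rfl fun j _ => ?_
  rw [((h.noise i j).mono hs htT).inner_limit (hf i) (hg j) hst
    (((h.noise i i).mono hs htT).tendsto_stochInt (h.cont_noise i) (hf i) hst)
    (((h.noise j j).mono hs htT).tendsto_stochInt (h.cont_noise j) (hg j) hst)]
  exact intervalIntegral.integral_congr fun τ _ => by simp only [stackΓ]; ring

theorem inner_wiener_of_mem_past (h : Core S T x y) {f : Fin n ⊕ Fin m → ℝ → ℝ}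
    (hf : ∀ i, Continuous (f i)) {s t : ℝ} (hs : 0 ≤ s) (hst : s ≤ t) (htT : t ≤ T) {v : E}
    (hv : v ∈ pastSpace S T x y s) :
    inner ℝ v (∑ i, stochInt (f i) (sysNoise S x y i) s t) = 0 := by
  rw [inner_sum]
  refine Finset.sum_eq_zero fun i _ => ?_
  exact inner_limit_eq_zero hst
    (((h.noise i i).mono hs htT).tendsto_stochInt (h.cont_noise i) (hf i) hst)
    fun a b h1 h2 h3 => mem_pastSpace.1 hv i a b h1 h2 (h3.trans htT)

theorem wiener_bound (h : Core S T x y) {f : Fin n ⊕ Fin m → ℝ → ℝ}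
    (hf : ∀ i, Continuous (f i)) {a c : ℝ} (ha : 0 ≤ a) (hc : c ≤ T) :
    ∃ κ, ∀ s t, a ≤ s → s ≤ t → t ≤ c →
      ‖wiener S x y f a c t - wiener S x y f a c s‖ ^ 2 ≤ κ * (t - s) := by
  have hΓ := h.cont_stackΓ
  have hcont : Continuous fun τ => ∑ i, ∑ j, f i τ * stackΓ S τ i j * f j τ := by fun_prop
  obtain ⟨κ, hκ⟩ := (isCompact_Icc (a := a) (b := c)).exists_bound_of_continuousOn
    hcont.continuousOn
  refine ⟨κ, fun s t h1 h2 h3 => ?_⟩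
  rw [h.wiener_sub hf ha hc h1 h2 h3, ← real_inner_self_eq_norm_sq,
    h.inner_wiener hf hf (ha.trans h1) h2 (h3.trans hc)]
  have := intervalIntegral.integral_mono_on (μ := volume) h2
      (hcont.intervalIntegrable s t) (intervalIntegrable_const (c := κ)) fun τ hτ =>
        (le_abs_self _).trans (hκ τ ⟨h1.trans hτ.1, hτ.2.trans h3⟩)
  rwa [intervalIntegral.integral_const, smul_eq_mul, mul_comm] at this

/-- The noise itself is the integral of a unit vector. -/
theorem noise_sub_eq (h : Core S T x y) {s t : ℝ} (hs : 0 ≤ s) (hst : s ≤ t) (htT : t ≤ T) (j) :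
    sysNoise S x y j t - sysNoise S x y j s =
      ∑ i, stochInt (fun _ => if i = j then 1 else 0) (sysNoise S x y i) s t := by
  rw [Finset.sum_congr rfl fun i _ =>
    ((h.noise i i).mono hs htT).stochInt_const (h.cont_noise i) hst _]
  simp

end Core
end Wiener

/-! ### Linear filters driven by the output -/

theorem rsum_add {E : Type*} [NormedAddCommGroup E] [NormedSpace ℝ E] (f : ℝ → ℝ) (z₁ z₂ : ℝ → E)
    (P : TagPart) : rsum f (fun t => z₁ t + z₂ t) P = rsum f z₁ P + rsum f z₂ P := by
  simp only [rsum, ← Finset.sum_add_distrib, ← smul_add]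
  exact Finset.sum_congr rfl fun k _ => by congr 1; abel

section Filter

variable {Ω : Type*} [MeasurableSpace Ω] {ℙ : Measure Ω} {n m p : ℕ}
  {S : LinModel n m p} {T : ℝ} {x : ℝ → Fin n → RV ℙ} {y : ℝ → Fin m → RV ℙ}

/-- The process `∫_a^t K dy`, split into its drift and its noise part. -/
noncomputable def obsInt (S : LinModel n m p) (x : ℝ → Fin n → RV ℙ) (y : ℝ → Fin m → RV ℙ)
    (K : ℝ → Matrix (Fin n) (Fin m) ℝ) (a c : ℝ) (i : Fin n) (t : ℝ) : RV ℙ :=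
  ∑ k, (stochPrim (fun τ => K τ i k) (sysNoise S x y (Sum.inr k)) a c t +
    ∫ τ in a..t, K τ i k • stackDrift S x (Sum.inr k) τ)

/-- The solution of `dz = F z dt + K dy`, `z(a) = z₀`, where `X` is a fundamental matrix of `F` and
`Y` its inverse. The process `z - ∫ K dy` solves an ordinary differential equation. -/
noncomputable def filt (S : LinModel n m p) (x : ℝ → Fin n → RV ℙ) (y : ℝ → Fin m → RV ℙ)
    (K : ℝ → Matrix (Fin n) (Fin m) ℝ) (F X Y : ℝ → Matrix (Fin n) (Fin n) ℝ) (a c : ℝ)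
    (z₀ : Fin n → RV ℙ) (t : ℝ) (i : Fin n) : RV ℙ :=
  obsInt S x y K a c i t + ∑ j, X t i j • (∑ l, Y a j l • z₀ l +
    ∫ τ in a..t, ∑ l, (Y τ * F τ) j l • obsInt S x y K a c l τ)

theorem mem_incrSpace {y : ℝ → Fin m → RV ℙ} {a b s t : ℝ} (hs : s ∈ Icc a b) (ht : t ∈ Icc a b)
    (k : Fin m) : y t k - y s k ∈ incrSpace y a b :=
  Submodule.le_topologicalClosure _ (Submodule.subset_span ⟨s, hs, t, ht, k, rfl⟩)

theorem incrSpace_le {y : ℝ → Fin m → RV ℙ} {a b : ℝ} {K : ClosedSubmodule ℝ (RV ℙ)}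
    (h : ∀ s ∈ Icc a b, ∀ t ∈ Icc a b, ∀ k, y t k - y s k ∈ K) : incrSpace y a b ≤ K := by
  rw [incrSpace, Submodule.closure_le, Submodule.span_le]
  rintro _ ⟨s, hs, t, ht, k, rfl⟩
  exact h s hs t ht k

theorem incrSpace_mono {y : ℝ → Fin m → RV ℙ} {a b a' b' : ℝ} (h : Icc a b ⊆ Icc a' b') :
    incrSpace y a b ≤ incrSpace y a' b' :=
  incrSpace_le fun _ hs _ ht k => mem_incrSpace (h hs) (h ht) k

namespace Core

theorem incrSpace_le_past (h : Core S T x y) {a s : ℝ} (ha : 0 ≤ a) :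
    incrSpace y a s ≤ pastSpace S T x y s :=
  incrSpace_le fun _ hs _ ht k => h.output_mem (ha.trans hs.1) hs.2 (ha.trans ht.1) ht.2 k

variable {K : ℝ → Matrix (Fin n) (Fin m) ℝ} {a c : ℝ}

theorem continuous_obsInt (h : Core S T x y) (hK : Continuous K) (ha : 0 ≤ a) (hac : a ≤ c)
    (hc : c ≤ T) (i : Fin n) : Continuous (obsInt S x y K a c i) :=
  continuous_finsetSum _ fun k _ =>
    (((h.noise _ _).mono ha hc).continuous_stochPrim (h.cont_noise _) (hK.matrix_elem i k) hac).add
      (intervalIntegral.continuous_primitive (fun s t =>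
        ((hK.matrix_elem i k).smul (h.cont_drift (Sum.inr k))).intervalIntegrable s t) a)

theorem obsInt_sub (h : Core S T x y) (hK : Continuous K) (ha : 0 ≤ a) (hc : c ≤ T) {s t : ℝ}
    (has : a ≤ s) (hst : s ≤ t) (htc : t ≤ c) (i : Fin n) :
    obsInt S x y K a c i t - obsInt S x y K a c i s =
      ∑ k, (stochInt (fun τ => K τ i k) (sysNoise S x y (Sum.inr k)) s t +
        ∫ τ in s..t, K τ i k • stackDrift S x (Sum.inr k) τ) := by
  have hi : ∀ k a b, IntervalIntegrable (fun τ => K τ i k • stackDrift S x (Sum.inr k) τ)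
    volume a b := fun k a b =>
      ((hK.matrix_elem i k).smul (h.cont_drift (Sum.inr k))).intervalIntegrable a b
  rw [obsInt, obsInt, ← Finset.sum_sub_distrib]
  refine Finset.sum_congr rfl fun k _ => ?_
  rw [← ((h.noise _ _).mono ha hc).stochPrim_sub (h.cont_noise _) (hK.matrix_elem i k) has hst htc,
    ← intervalIntegral.integral_interval_sub_left (hi k a t) (hi k a s)]
  abel

theorem obsInt_self (h : Core S T x y) (hK : Continuous K) (ha : 0 ≤ a) (hac : a ≤ c) (hc : c ≤ T)
    (i : Fin n) : obsInt S x y K a c i a = 0 := by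
  refine Finset.sum_eq_zero fun k _ => ?_
  have := ((h.noise (Sum.inr k) (Sum.inr k)).mono ha hc).stochInt_add (h.cont_noise _)
    (hK.matrix_elem i k) le_rfl le_rfl le_rfl hac
  rw [intervalIntegral.integral_same, add_zero, stochPrim, min_eq_left hac, max_self]
  simpa using this

/-- `∫_s^t K dy` is the limit of its tagged Riemann–Stieltjes sums. -/
theorem tendsto_obsInt (h : Core S T x y) (hK : Continuous K) (ha : 0 ≤ a) (hc : c ≤ T) {s t : ℝ}
    (has : a ≤ s) (hst : s ≤ t) (htc : t ≤ c) (i : Fin n) :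
    Tendsto (fun P => ∑ k, rsum (fun τ => K τ i k) (fun τ => y τ k) P) (meshFilter s t)
      (𝓝 (obsInt S x y K a c i t - obsInt S x y K a c i s)) := by
  rw [h.obsInt_sub hK ha hc has hst htc]
  refine tendsto_finsetSum _ fun k _ => ?_
  have hi : ∀ a b, IntervalIntegrable (stackDrift S x (Sum.inr k)) volume a b := fun a b =>
    (h.cont_drift (Sum.inr k)).intervalIntegrable a b
  have h1 := ((h.noise (Sum.inr k) (Sum.inr k)).mono (ha.trans has) (htc.trans hc)).tendsto_stochInt
    (h.cont_noise _) (hK.matrix_elem i k) hst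
  have h2 := tendsto_rsum_primitive hst (hK.matrix_elem i k) (h.cont_drift (Sum.inr k))
    (G := fun t => ∫ τ in (0 : ℝ)..t, stackDrift S x (Sum.inr k) τ)
    fun s _ t _ _ => intervalIntegral.integral_interval_sub_left (hi _ _) (hi _ _)
  refine (h1.add h2).congr fun P => ?_
  rw [← rsum_add]
  congr 1
  ext1 τ
  simp [sysNoise, stackX]

theorem obsInt_mem (h : Core S T x y) (hK : Continuous K) (ha : 0 ≤ a) (hc : c ≤ T) {t : ℝ}
    (hat : a ≤ t) (htc : t ≤ c) (i : Fin n) : obsInt S x y K a c i t ∈ incrSpace y a t := by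
  have := meshFilter_neBot hat
  have h1 := h.tendsto_obsInt hK ha hc le_rfl hat htc i
  rw [h.obsInt_self hK ha (hat.trans htc) hc, sub_zero] at h1
  refine (incrSpace y a t).isClosed.mem_of_tendsto h1 ?_
  filter_upwards [eventually_isOn a t one_pos] with P hP
  exact (incrSpace y a t).toSubmodule.sum_mem fun k _ =>
    (incrSpace y a t).toSubmodule.sum_mem fun l hl =>
      (incrSpace y a t).toSubmodule.smul_mem _
        (mem_incrSpace (hP.u_mem (Finset.mem_range.1 hl).le) (hP.u_mem (Finset.mem_range.1 hl)) k)

variable {F X Y : ℝ → Matrix (Fin n) (Fin n) ℝ} {z₀ : Fin n → RV ℙ}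

theorem filt_aux_cont (h : Core S T x y) (hK : Continuous K) (hF : Continuous F)
    (hXY : IsFundamental F X Y) (ha : 0 ≤ a) (hac : a ≤ c) (hc : c ≤ T) (j : Fin n) :
    Continuous fun τ => ∑ l, (Y τ * F τ) j l • obsInt S x y K a c l τ := by
  have h1 := hXY.cont_right
  have h2 := h.continuous_obsInt hK ha hac hc
  exact continuous_finsetSum _ fun l _ => ((h1.matrix_mul hF).matrix_elem j l).smul (h2 l)

theorem continuous_filt (h : Core S T x y) (hK : Continuous K) (hF : Continuous F)
    (hXY : IsFundamental F X Y) (ha : 0 ≤ a) (hac : a ≤ c) (hc : c ≤ T) (i : Fin n) :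
    Continuous fun t => filt S x y K F X Y a c z₀ t i := by
  refine (h.continuous_obsInt hK ha hac hc i).add (continuous_finsetSum _ fun j _ =>
    (hXY.cont_left.matrix_elem i j).smul (continuous_const.add ?_))
  exact intervalIntegral.continuous_primitive
    (fun s t => (h.filt_aux_cont hK hF hXY ha hac hc j).intervalIntegrable s t) a

theorem filt_self (h : Core S T x y) (hK : Continuous K)
    (hXY : IsFundamental F X Y) (ha : 0 ≤ a) (hac : a ≤ c) (hc : c ≤ T) :
    filt S x y K F X Y a c z₀ a = z₀ := by
  ext1 i
  simp only [filt, h.obsInt_self hK ha hac hc, intervalIntegral.integral_same, add_zero, zero_add,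
    Finset.smul_sum, smul_smul]
  rw [Finset.sum_comm]
  simp only [← Finset.sum_smul, ← Matrix.mul_apply, hXY.mul_inv]
  simp [Matrix.one_apply]

theorem filt_sub (h : Core S T x y) (hK : Continuous K) (hF : Continuous F)
    (hXY : IsFundamental F X Y) (ha : 0 ≤ a) (hac : a ≤ c) (hc : c ≤ T) (s t : ℝ) (i : Fin n) :
    filt S x y K F X Y a c z₀ t i - filt S x y K F X Y a c z₀ s i =
      (∫ τ in s..t, ∑ j, F τ i j • filt S x y K F X Y a c z₀ τ j) +
        (obsInt S x y K a c i t - obsInt S x y K a c i s) := by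
  set g := obsInt S x y K a c
  set w : Fin n → ℝ → RV ℙ := fun j t => ∑ l, Y a j l • z₀ l +
    ∫ τ in a..t, ∑ l, (Y τ * F τ) j l • g l τ
  have hw : ∀ j t, HasDerivAt (w j) (∑ l, (Y t * F t) j l • g l t) t := fun j t =>
    (((h.filt_aux_cont hK hF hXY ha hac hc j).integral_hasStrictDerivAt a t).hasDerivAt).const_add _
  have hu : ∀ t, HasDerivAt (fun t => ∑ j, X t i j • w j t)
      (∑ j, F t i j • filt S x y K F X Y a c z₀ t j) t := by
    intro t
    have h1 : HasDerivAt (fun t => ∑ j, X t i j • w j t)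
        (∑ j, (X t i j • (∑ l, (Y t * F t) j l • g l t) + (F t * X t) i j • w j t)) t :=
      HasDerivAt.fun_sum fun j _ =>
        (((hXY.deriv_left univ t) i j).hasDerivAt univ_mem).smul (hw j t)
    refine h1.congr_deriv ?_
    have e1 : ∑ j, X t i j • (∑ l, (Y t * F t) j l • g l t) = ∑ l, F t i l • g l t := by
      simp only [Finset.smul_sum, smul_smul]
      rw [Finset.sum_comm]
      simp only [← Finset.sum_smul, ← Matrix.mul_apply, ← Matrix.mul_assoc, hXY.mul_inv,
        Matrix.one_mul]
    have e2 : ∑ j, (F t * X t) i j • w j t = ∑ l, F t i l • ∑ j, X t l j • w j t := by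
      simp only [Finset.smul_sum, smul_smul]
      rw [Finset.sum_comm]
      simp only [← Finset.sum_smul, ← Matrix.mul_apply]
    rw [Finset.sum_add_distrib, e1, e2, ← Finset.sum_add_distrib]
    simp only [← smul_add]
    rfl
  have hz : Continuous fun t => ∑ j, F t i j • filt S x y K F X Y a c z₀ t j :=
    continuous_finsetSum _ fun j _ => (hF.matrix_elem i j).smul
      (h.continuous_filt hK hF hXY ha hac hc j)
  rw [intervalIntegral.integral_eq_sub_of_hasDerivAt (fun τ _ => hu τ) (hz.intervalIntegrable _ _)]
  change g i t + ∑ j, X t i j • w j t - (g i s + ∑ j, X s i j • w j s) = _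
  abel

theorem filt_mem (h : Core S T x y) (hK : Continuous K) (hF : Continuous F)
    (hXY : IsFundamental F X Y) (ha : 0 ≤ a) (hc : c ≤ T) {Ka : ClosedSubmodule ℝ (RV ℙ)}
    (hz₀ : ∀ i, z₀ i ∈ Ka) {t : ℝ} (hat : a ≤ t) (htc : t ≤ c) (i : Fin n) :
    filt S x y K F X Y a c z₀ t i ∈ Ka ⊔ incrSpace y a t := by
  set L := Ka ⊔ incrSpace y a t
  have hle : ∀ s, a ≤ s → s ≤ t → ∀ j, obsInt S x y K a c j s ∈ L := fun s has hst j =>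
    (le_sup_right : incrSpace y a t ≤ L) (incrSpace_mono (Icc_subset_Icc_right hst)
      (h.obsInt_mem hK ha hc has (hst.trans htc) j))
  refine L.toSubmodule.add_mem (hle t hat le_rfl i) (L.toSubmodule.sum_mem fun j _ =>
    L.toSubmodule.smul_mem _ (L.toSubmodule.add_mem (L.toSubmodule.sum_mem fun l _ =>
      L.toSubmodule.smul_mem _ ((le_sup_left : Ka ≤ L) (hz₀ l))) ?_))
  exact intervalIntegral_mem L hat (h.filt_aux_cont hK hF hXY ha (hat.trans htc) hc j)
    fun τ h1 h2 => L.toSubmodule.sum_mem fun l _ => L.toSubmodule.smul_mem _ (hle τ h1 h2 l)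

/-- Noise coefficients of the estimation error of a filter with gain `K`. -/
def _root_.errCoef (K : ℝ → Matrix (Fin n) (Fin m) ℝ) (i : Fin n) (j : Fin n ⊕ Fin m) (t : ℝ) : ℝ :=
  Sum.elim (fun j => if j = i then 1 else 0) (fun k => -K t i k) j

theorem _root_.continuous_errCoef (hK : Continuous K) (i : Fin n) (j) :
    Continuous (errCoef K i j) := by
  rcases j with j | j
  · exact continuous_const
  · exact (hK.matrix_elem i j).neg

/-- The error of a filter with closed-loop matrix `A - K C` is driven by the noise alone. -/
theorem isDriven_error (h : Core S T x y) (hK : Continuous K) (hF : F = fun t => S.A t - K t * S.C t)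
    (hXY : IsFundamental F X Y) (ha : 0 ≤ a) (hac : a ≤ c) (hc : c ≤ T)
    {Ka : ClosedSubmodule ℝ (RV ℙ)} (hKa : Ka ≤ pastSpace S T x y a) (hz₀ : ∀ i, z₀ i ∈ Ka)
    (i : Fin n) :
    IsDriven (pastSpace S T x y) a c (fun t => x t i - filt S x y K F X Y a c z₀ t i)
      (fun t => ∑ j, F t i j • (x t j - filt S x y K F X Y a c z₀ t j))
      (wiener S x y (errCoef K i) a c) := by
  have hFc : Continuous F := by
    have h1 := h.contA
    have h2 := h.contC
    rw [hF]; fun_prop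
  have hfc : ∀ j, Continuous fun t => filt S x y K F X Y a c z₀ t j :=
    h.continuous_filt hK hFc hXY ha hac hc
  have hec := continuous_errCoef hK i
  refine ⟨(h.cont_state i).sub (hfc i), continuous_finsetSum _ fun j _ =>
    (hFc.matrix_elem i j).smul ((h.cont_state j).sub (hfc j)), fun s t has hst htc => ?_,
    fun s has hsc => ?_, fun s t has hst htc v hv => ?_, h.wiener_bound hec ha hc⟩
  · have hs0 := ha.trans has
    have htT := htc.trans hc
    have hx := h.sub_eq (Sum.inl i) s t
    have hw : wiener S x y (errCoef K i) a c t - wiener S x y (errCoef K i) a c s =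
        (sysNoise S x y (Sum.inl i) t - sysNoise S x y (Sum.inl i) s) -
          ∑ k, stochInt (fun τ => K τ i k) (sysNoise S x y (Sum.inr k)) s t := by
      rw [h.wiener_sub hec ha hc has hst htc, Fintype.sum_sum_type, sub_eq_add_neg,
        ← Finset.sum_neg_distrib]
      congr 1
      · rw [Finset.sum_eq_single i]
        · have := ((h.noise (Sum.inl i) (Sum.inl i)).mono hs0 htT).stochInt_const
            (h.cont_noise _) hst 1
          have he : errCoef K i (Sum.inl i) = fun _ => 1 := by ext; simp [errCoef]
          rw [he, this, one_smul]
        · intro j _ hj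
          have := ((h.noise (Sum.inl j) (Sum.inl j)).mono hs0 htT).stochInt_const
            (h.cont_noise _) hst 0
          have he : errCoef K i (Sum.inl j) = fun _ => 0 := by ext; simp [errCoef, hj]
          rw [he, this, zero_smul]
        · simp
      · refine Finset.sum_congr rfl fun k _ => ?_
        exact ((h.noise _ _).mono hs0 htT).stochInt_neg (h.cont_noise _) (hK.matrix_elem i k) hst
    rw [hw, sub_sub_sub_comm, h.filt_sub hK hFc hXY ha hac hc,
      h.obsInt_sub hK ha hc has hst htc, Finset.sum_add_distrib]
    have hi1 : IntervalIntegrable (stackDrift S x (Sum.inl i)) volume s t :=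
      (h.cont_drift _).intervalIntegrable _ _
    have hi2 : ∀ k ∈ Finset.univ, IntervalIntegrable
        (fun τ => K τ i k • stackDrift S x (Sum.inr k) τ) volume s t := fun k _ =>
      ((hK.matrix_elem i k).smul (h.cont_drift (Sum.inr k))).intervalIntegrable _ _
    have hi3 : IntervalIntegrable (fun τ => ∑ j, F τ i j • filt S x y K F X Y a c z₀ τ j)
        volume s t := (continuous_finsetSum _ fun j _ =>
          (hFc.matrix_elem i j).smul (hfc j)).intervalIntegrable _ _
    have hdrift : ∫ τ in s..t, ∑ j, F τ i j • (x τ j - filt S x y K F X Y a c z₀ τ j) =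
        (∫ τ in s..t, stackDrift S x (Sum.inl i) τ) -
          (∑ k, ∫ τ in s..t, K τ i k • stackDrift S x (Sum.inr k) τ) -
          ∫ τ in s..t, ∑ j, F τ i j • filt S x y K F X Y a c z₀ τ j := by
      have hi4 : IntervalIntegrable (fun τ => ∑ k, K τ i k • stackDrift S x (Sum.inr k) τ)
          volume s t := (continuous_finsetSum _ fun k _ =>
            (hK.matrix_elem i k).smul (h.cont_drift (Sum.inr k))).intervalIntegrable _ _
      rw [← intervalIntegral.integral_finsetSum hi2,
        ← intervalIntegral.integral_sub hi1 hi4,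
        ← intervalIntegral.integral_sub (hi1.sub hi4) hi3]
      refine intervalIntegral.integral_congr fun τ _ => ?_
      have e1 : ∑ k, K τ i k • stackDrift S x (Sum.inr k) τ = ∑ j, (K τ * S.C τ) i j • x τ j := by
        simp only [stackDrift, Finset.smul_sum, smul_smul]
        rw [Finset.sum_comm]
        simp only [← Finset.sum_smul]
        exact Finset.sum_congr rfl fun j _ => by simp [Matrix.mul_apply, stackA]
      simp only [e1]
      simp only [smul_sub, Finset.sum_sub_distrib]
      congr 1
      rw [stackDrift, ← Finset.sum_sub_distrib]
      refine Finset.sum_congr rfl fun j _ => ?_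
      rw [← sub_smul, hF]
      simp [stackA]
    rw [hdrift]
    change x t i - x s i = _ at hx
    rw [hx]
    abel
  · refine (pastSpace S T x y s).toSubmodule.sub_mem (h.state_mem (ha.trans has) le_rfl i) ?_
    exact (sup_le (hKa.trans (pastSpace_mono has)) (h.incrSpace_le_past ha))
      (h.filt_mem hK hFc hXY ha hc hz₀ has hsc i)
  · rw [h.wiener_sub hec ha hc has hst htc]
    exact h.inner_wiener_of_mem_past hec (ha.trans has) hst (htc.trans hc) hv

end Core
end Filter

/-! ### The Kalman–Bucy filter -/

section Estimates

variable {Ω : Type*} [MeasurableSpace Ω] {ℙ : Measure Ω} {n m p : ℕ}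

theorem estimate_mem (K : ClosedSubmodule ℝ (RV ℙ)) (v : Fin n → RV ℙ) (i : Fin n) :
    estimate K v i ∈ K :=
  Submodule.starProjection_apply_mem _ _

theorem inner_sub_estimate {K : ClosedSubmodule ℝ (RV ℙ)} (v : Fin n → RV ℙ) (i : Fin n)
    {w : RV ℙ} (hw : w ∈ K) : inner ℝ w (v i - estimate K v i) = 0 := by
  rw [real_inner_comm]
  exact Submodule.starProjection_inner_eq_zero _ _ hw

theorem estimate_eq_of_inner_eq_zero {K : ClosedSubmodule ℝ (RV ℙ)} {v z : Fin n → RV ℙ}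
    (hz : ∀ i, z i ∈ K) (h : ∀ i, ∀ w ∈ K, inner ℝ w (v i - z i) = 0) : estimate K v = z := by
  ext1 i
  exact Submodule.eq_starProjection_of_mem_of_inner_eq_zero (hz i) fun w hw => by
    rw [real_inner_comm]; exact h i w hw

/-- The error covariance is the covariance of the error with the estimated vector. -/
theorem covMat_sub_estimate (K : ClosedSubmodule ℝ (RV ℙ)) (v : Fin n → RV ℙ) :
    covMat (v - estimate K v) (v - estimate K v) = covMat (v - estimate K v) v := by
  ext i j
  simp only [covMat, Matrix.of_apply, Pi.sub_apply]
  rw [inner_sub_right, real_inner_comm (estimate K v j),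
    inner_sub_estimate v i (estimate_mem K v j), sub_zero]

theorem dotProduct_covMat (u : Fin n → RV ℙ) (v : Fin n → ℝ) :
    v ⬝ᵥ (covMat u u *ᵥ v) = ‖∑ i, v i • u i‖ ^ 2 := by
  rw [← real_inner_self_eq_norm_sq]
  simp only [dotProduct, Matrix.mulVec, covMat, Matrix.of_apply, sum_inner, inner_sum,
    real_inner_smul_left, real_inner_smul_right, Finset.mul_sum]
  exact Finset.sum_congr rfl fun i _ => Finset.sum_congr rfl fun j _ => by
    rw [real_inner_comm]; ring

theorem transpose_covMat {k : ℕ} (u : Fin n → RV ℙ) (v : Fin k → RV ℙ) :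
    (covMat u v)ᵀ = covMat v u := by
  ext i j
  exact real_inner_comm (v i) (u j)

theorem posSemidef_covMat (u : Fin n → RV ℙ) : (covMat u u).PosSemidef :=
  Matrix.PosSemidef.of_dotProduct_mulVec_nonneg (transpose_covMat u u) fun v => by
    rw [star_trivial, dotProduct_covMat]; positivity

theorem posDef_covMat_iff {u : Fin n → RV ℙ} :
    (covMat u u).PosDef ↔ ∀ v : Fin n → ℝ, ∑ i, v i • u i = 0 → v = 0 := by
  constructor
  · intro h v hv
    by_contra hne
    have := h.dotProduct_mulVec_pos hne
    rw [star_trivial, dotProduct_covMat, hv] at this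
    simp at this
  · intro h
    refine Matrix.PosDef.of_dotProduct_mulVec_pos (transpose_covMat u u) fun v hv => ?_
    rw [star_trivial, dotProduct_covMat]
    have : ∑ i, v i • u i ≠ 0 := fun h0 => hv (h v h0)
    positivity

end Estimates

theorem IsDriven.mono {E : Type*} [NormedAddCommGroup E] [InnerProductSpace ℝ E]
    {F : ℝ → ClosedSubmodule ℝ E} {a c c' : ℝ} {u f μ : ℝ → E} (h : IsDriven F a c u f μ)
    (hc : c' ≤ c) : IsDriven F a c' u f μ where
  cont := h.cont
  cont_drift := h.cont_drift
  drift s t h1 h2 h3 := h.drift s t h1 h2 (h3.trans hc)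
  adapted s h1 h2 := h.adapted s h1 (h2.trans hc)
  orth s t h1 h2 h3 := h.orth s t h1 h2 (h3.trans hc)
  bound := by
    obtain ⟨κ, hκ⟩ := h.bound
    exact ⟨κ, fun s t h1 h2 h3 => hκ s t h1 h2 (h3.trans hc)⟩

section Gain

variable {n m p : ℕ} {S : LinModel n m p}

theorem continuous_matrix_inv {k : ℕ} {R : ℝ → Matrix (Fin k) (Fin k) ℝ} (hR : Continuous R)
    (hdet : ∀ t, (R t).det ≠ 0) : Continuous fun t => (R t)⁻¹ := by
  simp only [Matrix.inv_def, Ring.inverse_eq_inv']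
  exact (hR.matrix_det.inv₀ hdet).smul hR.matrix_adjugate

theorem sum_errCoef (K : ℝ → Matrix (Fin n) (Fin m) ℝ) (i : Fin n) (t : ℝ)
    (v : Fin n ⊕ Fin m → ℝ) :
    ∑ ι, errCoef K i ι t * v ι = v (Sum.inl i) - ∑ k, K t i k * v (Sum.inr k) := by
  simp [errCoef, sub_eq_add_neg]

end Gain

section Kalman

variable {Ω : Type*} [MeasurableSpace Ω] {ℙ : Measure Ω} {n m p : ℕ}
  {S : LinModel n m p} {T : ℝ} {x : ℝ → Fin n → RV ℙ} {y : ℝ → Fin m → RV ℙ}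

namespace Core

theorem continuous_forwardGain (h : Core S T x y) {Q : ℝ → Matrix (Fin n) (Fin n) ℝ}
    (hQ : Continuous Q) : Continuous (forwardGain S Q) := by
  have h1 := h.contB
  have h2 := h.contC
  have h3 := h.contD
  have h4 : Continuous S.R := h3.matrix_mul h3.matrix_transpose
  have h5 := continuous_matrix_inv h4 fun t => (h.posR t).det_pos.ne'
  unfold forwardGain
  fun_prop

theorem forwardGain_mul_R (h : Core S T x y) (Q : ℝ → Matrix (Fin n) (Fin n) ℝ) (t : ℝ) :
    forwardGain S Q t * S.R t = Q t * (S.C t)ᵀ + S.B t * (S.D t)ᵀ := by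
  rw [forwardGain, Matrix.mul_assoc,
    Matrix.nonsing_inv_mul _ (isUnit_iff_ne_zero.2 (h.posR t).det_pos.ne'), Matrix.mul_one]

variable {K : ℝ → Matrix (Fin n) (Fin m) ℝ} {F X Y : ℝ → Matrix (Fin n) (Fin n) ℝ} {a c : ℝ}
  {Ka : ClosedSubmodule ℝ (RV ℙ)} {z₀ : Fin n → RV ℙ}

/-- Evolution of the covariance of the filter error with the stacked process. -/
theorem hasDerivWithinAt_inner_error (h : Core S T x y) (hK : Continuous K)
    (hF : F = fun t => S.A t - K t * S.C t)
    (hXY : IsFundamental F X Y) (ha : 0 ≤ a) (hac : a ≤ c) (hc : c ≤ T)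
    (hKa : Ka ≤ pastSpace S T x y a) (hz₀ : ∀ i, z₀ i ∈ Ka) (i : Fin n) (j : Fin n ⊕ Fin m)
    {t : ℝ} (ht : t ∈ Icc a c) :
    HasDerivWithinAt (fun t => inner ℝ (x t i - filt S x y K F X Y a c z₀ t i)
        (stackX x y j t - Sum.elim (fun _ => 0) (y a) j))
      ((∑ k, F t i k * inner ℝ (x t k - filt S x y K F X Y a c z₀ t k)
          (stackX x y j t - Sum.elim (fun _ => 0) (y a) j)) +
        (∑ k, stackA S t j k * inner ℝ (x t i - filt S x y K F X Y a c z₀ t i) (x t k)) +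
        (stackΓ S t (Sum.inl i) j - ∑ k, K t i k * stackΓ S t (Sum.inr k) j)) (Icc a c) t := by
  have hec := continuous_errCoef hK i
  have hΓ := h.cont_stackΓ
  have := (h.isDriven_error hK hF hXY ha hac hc hKa hz₀ i).hasDerivWithinAt
    ((h.isDriven ha j).mono hc)
    (γ := fun τ => ∑ ι, errCoef K i ι τ * stackΓ S τ ι j) (by fun_prop)
    (fun s t h1 h2 h3 => by
      rw [h.wiener_sub hec ha hc h1 h2 h3, h.noise_sub_eq (ha.trans h1) h2 (h3.trans hc),
        h.inner_wiener hec (fun _ => continuous_const) (ha.trans h1) h2 (h3.trans hc)]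
      simp) ht
  simpa only [sum_inner, inner_sum, real_inner_smul_left, real_inner_smul_right, sum_errCoef,
    stackDrift] using this

/-- The Kalman–Bucy filter: if `Q` is a symmetric solution of the Riccati equation starting from
the error covariance of the initial estimate, then `Q` is the error covariance of the estimate of
the state on the initial data and the output observed so far. -/
theorem kalman (h : Core S T x y) (ha : 0 ≤ a) (hac : a ≤ c) (hc : c ≤ T)
    (hKa : Ka ≤ pastSpace S T x y a) {Q : ℝ → Matrix (Fin n) (Fin n) ℝ} (hQc : Continuous Q)
    (hQs : ∀ t ∈ Icc a c, (Q t)ᵀ = Q t)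
    (hQ : ∀ t ∈ Icc a c, HasMatDeriv Q (S.A t * Q t + Q t * (S.A t)ᵀ -
      forwardGain S Q t * S.R t * (forwardGain S Q t)ᵀ + S.B t * (S.B t)ᵀ) (Icc a c) t)
    (hQa : covMat (x a - estimate Ka (x a)) (x a - estimate Ka (x a)) = Q a) :
    ∃ z : ℝ → Fin n → RV ℙ, (∀ i, Continuous fun t => z t i) ∧
      (∀ t ∈ Icc a c, estimate (Ka ⊔ incrSpace y a t) (x t) = z t ∧
        covMat (x t - z t) (x t - z t) = Q t ∧ ((Q a).PosDef → (Q t).PosDef)) ∧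
      ∀ s t, a ≤ s → s ≤ t → t ≤ c → ∀ i,
        Tendsto (fun P => ∑ k, rsum (fun τ => forwardGain S Q τ i k) (fun τ => y τ k) P)
          (meshFilter s t) (𝓝 (z t i - z s i - ∫ τ in s..t,
            ∑ j, (S.A τ - forwardGain S Q τ * S.C τ) i j • z τ j)) := by
  set K := forwardGain S Q
  have hK : Continuous K := h.continuous_forwardGain hQc
  obtain ⟨F, hF⟩ : ∃ F, F = fun t => S.A t - K t * S.C t := ⟨_, rfl⟩
  have hFc : Continuous F := by
    have h1 := h.contA
    have h2 := h.contC
    rw [hF]; fun_prop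
  obtain ⟨X, Y, hXY⟩ := exists_isFundamental hFc
  set z₀ := estimate Ka (x a)
  have hz₀ : ∀ i, z₀ i ∈ Ka := estimate_mem Ka (x a)
  set z := filt S x y K F X Y a c z₀
  have hza : z a = z₀ := h.filt_self hK hXY ha hac hc
  have hder := h.hasDerivWithinAt_inner_error hK hF hXY ha hac hc hKa hz₀
  have hdr := h.isDriven_error hK hF hXY ha hac hc hKa hz₀
  have hKR : ∀ t, K t * S.R t = Q t * (S.C t)ᵀ + S.B t * (S.D t)ᵀ := h.forwardGain_mul_R Q
  -- the covariance `E{e x'}` satisfies the linear equation `L' = F L + L A' + B B' - K D B'`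
  set L : ℝ → Matrix (Fin n) (Fin n) ℝ := fun t => covMat (x t - z t) (x t)
  have hL : ∀ t ∈ Icc a c, HasMatDeriv L (F t * L t + L t * (S.A t)ᵀ +
      (S.B t * (S.B t)ᵀ - K t * (S.D t * (S.B t)ᵀ))) (Icc a c) t := by
    intro t ht i j
    have := hder i (Sum.inl j) ht
    simp only [stackX, Sum.elim_inl, sub_zero] at this
    refine this.congr_deriv ?_
    simp [L, covMat, Matrix.mul_apply (M := F t), Matrix.mul_apply (M := K t),
      stackA, stackΓ, stackB, z, Matrix.mul_apply, mul_comm]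
  have hLa : L a = Q a := by
    change covMat (x a - z a) (x a) = _
    rw [hza, ← covMat_sub_estimate, hQa]
  have hLQ : ∀ t ∈ Icc a c, L t = Q t := by
    intro t ht
    have := eq_zero_of_hasMatDeriv (M := F) (N := S.A) (Z := fun t => L t - Q t) hFc h.contA
      (fun τ hτ => by
        have h1 := (hL τ hτ).sub (hQ τ hτ)
        have e : K τ * S.R τ * (K τ)ᵀ = K τ * (S.C τ * Q τ + S.D τ * (S.B τ)ᵀ) := by
          have hRs : (S.R τ)ᵀ = S.R τ := by simp [LinModel.R, Matrix.transpose_mul]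
          have := congrArg Matrix.transpose (hKR τ)
          simp only [Matrix.transpose_mul, hRs, Matrix.transpose_add, Matrix.transpose_transpose,
            hQs τ hτ] at this
          rw [Matrix.mul_assoc, this]
        have e2 : F τ * L τ + L τ * (S.A τ)ᵀ +
            (S.B τ * (S.B τ)ᵀ - K τ * (S.D τ * (S.B τ)ᵀ)) -
            (S.A τ * Q τ + Q τ * (S.A τ)ᵀ - K τ * S.R τ * (K τ)ᵀ + S.B τ * (S.B τ)ᵀ) =
            F τ * (L τ - Q τ) + (L τ - Q τ) * (S.A τ)ᵀ := by
          rw [e, hF]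
          simp only [Matrix.mul_sub, Matrix.sub_mul, Matrix.mul_add, Matrix.mul_assoc]
          abel
        rwa [e2] at h1) (by rw [hLa, sub_self]) ht
    exact sub_eq_zero.1 this
  -- the error is uncorrelated with the increment of the output since time `a`
  set G : ℝ → Matrix (Fin n) (Fin m) ℝ := fun t => covMat (x t - z t) (y t - y a)
  have hG : ∀ t ∈ Icc a c, G t = 0 := by
    intro t ht
    refine eq_zero_of_hasMatDeriv (M := F) (N := fun _ => 0) (Z := G) hFc continuous_const
      (fun τ hτ i j => ?_) ?_ ht
    · have := hder i (Sum.inr j) hτ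
      simp only [stackX, Sum.elim_inr] at this
      refine this.congr_deriv ?_
      have e := congrFun (congrFun (hKR τ) i) j
      rw [← hLQ τ hτ] at e
      simp only [Matrix.mul_apply (M := K τ), Matrix.mul_apply (M := L τ), Matrix.add_apply,
        LinModel.R] at e
      simp [G, L, covMat, Matrix.mul_apply, stackA, stackΓ, stackB, z] at e ⊢
      simp only [mul_comm] at e ⊢
      linarith
    · change covMat _ (y a - y a) = 0
      ext i j; simp [covMat]
  -- the error at time `t` depends linearly on that at time `s`, up to noise after `s`; so it is
  -- orthogonal to the initial data and to every increment of the output observed so far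
  have horth : ∀ t ∈ Icc a c, ∀ i, ∀ w ∈ Ka ⊔ incrSpace y a t, inner ℝ w (x t i - z t i) = 0 := by
    intro t ht i w hw
    have hprop := fun s (v : RV ℙ) (hv : v ∈ pastSpace S T x y s) has hst =>
      IsDriven.inner_eq_of_mem (u := fun i t => x t i - z t i) hdr hFc hXY (s := s) (t := t) hv has
        hst ht.2 i
    have hle : Ka ⊔ incrSpace y a t ≤ orthTo (x t i - z t i) := by
      refine sup_le (fun v hv => mem_orthTo.2 ?_) (incrSpace_le fun s hs s' hs' k => ?_)
      · rw [real_inner_comm, hprop a v (hKa hv) le_rfl ht.1]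
        refine Finset.sum_eq_zero fun j _ => ?_
        change _ * inner ℝ v (x a j - z a j) = 0
        rw [hza, inner_sub_estimate (x a) j hv, mul_zero]
      · have : ∀ s ∈ Icc a t, y s k - y a k ∈ orthTo (x t i - z t i) := by
          intro s hs
          rw [mem_orthTo, real_inner_comm,
            hprop s _ (h.output_mem ha hs.1 (ha.trans hs.1) le_rfl k) hs.1 hs.2]
          refine Finset.sum_eq_zero fun j _ => ?_
          have := congrFun (congrFun (hG s ⟨hs.1, hs.2.trans ht.2⟩) j) k
          simp only [G, covMat, Matrix.of_apply, Pi.sub_apply, Matrix.zero_apply] at this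
          rw [real_inner_comm, this, mul_zero]
        rw [← sub_sub_sub_cancel_right (y s' k) (y s k) (y a k)]
        exact (orthTo _).toSubmodule.sub_mem (this s' hs') (this s hs)
    rw [real_inner_comm]
    exact mem_orthTo.1 (hle hw)
  have hmem : ∀ t ∈ Icc a c, ∀ i, z t i ∈ Ka ⊔ incrSpace y a t := fun t ht i =>
    h.filt_mem hK hFc hXY ha hc hz₀ ht.1 ht.2 i
  have hcov : ∀ t ∈ Icc a c, covMat (x t - z t) (x t - z t) = Q t := by
    intro t ht
    rw [← hLQ t ht, ← estimate_eq_of_inner_eq_zero (hmem t ht) (horth t ht), covMat_sub_estimate,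
      estimate_eq_of_inner_eq_zero (hmem t ht) (horth t ht)]
  refine ⟨z, h.continuous_filt hK hFc hXY ha hac hc, fun t ht =>
    ⟨estimate_eq_of_inner_eq_zero (hmem t ht) (horth t ht), hcov t ht, fun hpos => ?_⟩,
    fun s t has hst htc i => ?_⟩
  · rw [← hQa] at hpos
    rw [← hcov t ht]
    refine posDef_covMat_iff.2 fun v hv => ?_
    -- if `v'e(t) = 0`, then `w'e(a)`, where `w' = v' X(t) Y(a)`, is orthogonal to `e(a)`
    set w : Fin n → ℝ := v ᵥ* (X t * Y a)
    have hw : w = 0 := by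
      refine posDef_covMat_iff.1 hpos w ?_
      have hk : ∀ k, inner ℝ (x a k - z a k) (∑ j, w j • (x a j - z a j)) = 0 := by
        intro k
        have h1 : x a k - z a k ∈ pastSpace S T x y a := by
          have := (hdr k).adapted a le_rfl hac
          exact this
        calc inner ℝ (x a k - z a k) (∑ j, w j • (x a j - z a j))
            = ∑ i, v i * inner ℝ (x a k - z a k) (x t i - z t i) := by
              have h2 := IsDriven.inner_eq_of_mem (u := fun i t => x t i - z t i) hdr hFc hXY h1
                le_rfl ht.1 ht.2
              simp only [h2]
              simp only [w, Matrix.vecMul, dotProduct, inner_sum, real_inner_smul_right,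
                Finset.mul_sum, Finset.sum_mul]
              rw [Finset.sum_comm]
              simp only [mul_assoc]
          _ = inner ℝ (x a k - z a k) (∑ i, v i • (x t - z t) i) := by
              simp [inner_sum, real_inner_smul_right]
          _ = 0 := by rw [hv, inner_zero_right]
      have e : ∀ j, (x a - z₀) j = x a j - z a j := fun j => by rw [← hza]; rfl
      simp only [e]
      rw [← inner_self_eq_zero (𝕜 := ℝ), sum_inner]
      exact Finset.sum_eq_zero fun k _ => by rw [real_inner_smul_left, hk, mul_zero]
    have : v = w ᵥ* (X a * Y t) := by
      rw [Matrix.vecMul_vecMul, Matrix.mul_assoc, ← Matrix.mul_assoc (Y a), hXY.inv_mul,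
        Matrix.one_mul, hXY.mul_inv, Matrix.vecMul_one]
    rw [this, hw, Matrix.zero_vecMul]
  · have h1 := h.tendsto_obsInt hK ha hc has hst htc i
    have h2 := h.filt_sub (z₀ := z₀) hK hFc hXY ha hac hc s t i
    rw [hF] at h2
    have e : z t i - z s i - ∫ τ in s..t, ∑ j, (S.A τ - K τ * S.C τ) i j • z τ j =
        obsInt S x y K a c i t - obsInt S x y K a c i s := by
      simp only [z, hF]
      rw [h2]; abel
    rwa [e]

end Core
end Kalman

/-! ### The Riccati equation -/

section Riccati

variable {n : ℕ}

/-- Solvability of a linear system of two matrix equations. -/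
theorem exists_hasMatDeriv_pair {M₁₁ M₁₂ M₂₁ M₂₂ : ℝ → Matrix (Fin n) (Fin n) ℝ}
    (h₁₁ : Continuous M₁₁) (h₁₂ : Continuous M₁₂) (h₂₁ : Continuous M₂₁) (h₂₂ : Continuous M₂₂)
    (a : ℝ) (U₀ V₀ : Matrix (Fin n) (Fin n) ℝ) :
    ∃ U V : ℝ → Matrix (Fin n) (Fin n) ℝ, U a = U₀ ∧ V a = V₀ ∧
      (∀ s t, HasMatDeriv U (M₁₁ t * U t + M₁₂ t * V t) s t) ∧
      ∀ s t, HasMatDeriv V (M₂₁ t * U t + M₂₂ t * V t) s t := by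
  set H : ℝ → Matrix (Fin (n + n)) (Fin (n + n)) ℝ := fun t =>
    (Matrix.fromBlocks (M₁₁ t) (M₁₂ t) (M₂₁ t) (M₂₂ t)).submatrix finSumFinEquiv.symm
      finSumFinEquiv.symm
  have hH : Continuous H := (h₁₁.matrix_fromBlocks h₁₂ h₂₁ h₂₂).matrix_submatrix _ _
  obtain ⟨X, Y, hXY⟩ := exists_isFundamental hH
  set Z₀ : Matrix (Fin (n + n)) (Fin n) ℝ := Matrix.of fun i j =>
    Sum.elim (fun i => U₀ i j) (fun i => V₀ i j) (finSumFinEquiv.symm i)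
  set Z : ℝ → Matrix (Fin (n + n)) (Fin n) ℝ := fun t => X t * (Y a * Z₀)
  have hZ : ∀ s t, HasMatDeriv Z (H t * Z t) s t := fun s t => by
    have := (hXY.deriv_left s t).mul (HasMatDeriv.const (Y a * Z₀))
    rwa [Matrix.mul_zero, add_zero, Matrix.mul_assoc] at this
  have hZa : Z a = Z₀ := by
    change X a * (Y a * Z₀) = Z₀
    rw [← Matrix.mul_assoc, hXY.mul_inv, Matrix.one_mul]
  refine ⟨fun t => Matrix.of fun i j => Z t (Fin.castAdd n i) j,
    fun t => Matrix.of fun i j => Z t (Fin.natAdd n i) j, ?_, ?_, fun s t i j => ?_,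
    fun s t i j => ?_⟩
  · ext i j; simp [hZa, Z₀]
  · ext i j; simp [hZa, Z₀, -Fin.natAdd_eq_addNat]
  · refine (hZ s t (Fin.castAdd n i) j).congr_deriv ?_
    rw [Matrix.mul_apply, Fin.sum_univ_add]
    simp [H, Matrix.mul_apply, -Fin.natAdd_eq_addNat]
  · refine (hZ s t (Fin.natAdd n i) j).congr_deriv ?_
    rw [Matrix.mul_apply, Fin.sum_univ_add]
    simp [H, Matrix.mul_apply, -Fin.natAdd_eq_addNat]

/-- Derivative of the inverse of a matrix function. -/
theorem HasMatDeriv.inv {V : ℝ → Matrix (Fin n) (Fin n) ℝ} {V' : Matrix (Fin n) (Fin n) ℝ}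
    {s : Set ℝ} {t : ℝ} (hV : HasMatDeriv V V' s t) (hdet : ∀ τ ∈ s, (V τ).det ≠ 0) (ht : t ∈ s) :
    HasMatDeriv (fun τ => (V τ)⁻¹) (-((V t)⁻¹ * V' * (V t)⁻¹)) s t := by
  have hVc : ContinuousWithinAt V s t :=
    continuousWithinAt_pi.2 fun i => continuousWithinAt_pi.2 fun j => (hV i j).continuousWithinAt
  have hinv : Tendsto (fun τ => (V τ)⁻¹) (𝓝[s] t) (𝓝 (V t)⁻¹) := by
    simp only [Matrix.inv_def, Ring.inverse_eq_inv']
    have h1 : Tendsto (fun τ => (V τ).det) (𝓝[s] t) (𝓝 (V t).det) :=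
      (continuous_id.matrix_det.tendsto (V t)).comp hVc
    have h2 : Tendsto (fun τ => (V τ).adjugate) (𝓝[s] t) (𝓝 (V t).adjugate) :=
      (continuous_id.matrix_adjugate.tendsto (V t)).comp hVc
    exact (h1.inv₀ (hdet t ht)).smul h2
  intro i j
  rw [hasDerivWithinAt_iff_tendsto_slope]
  have hinv' : Tendsto (fun τ => (V τ)⁻¹) (𝓝[s \ {t}] t) (𝓝 (V t)⁻¹) :=
    hinv.mono_left (nhdsWithin_mono _ sdiff_subset)
  have hslope : Tendsto (fun τ => Matrix.of fun i j => slope (fun τ => V τ i j) t τ)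
      (𝓝[s \ {t}] t) (𝓝 V') :=
    tendsto_pi_nhds.2 fun i => tendsto_pi_nhds.2 fun j =>
      hasDerivWithinAt_iff_tendsto_slope.1 (hV i j)
  have hmul := ((hinv'.mul hslope).mul_const (V t)⁻¹).neg
  refine ((tendsto_pi_nhds.1 (tendsto_pi_nhds.1 hmul i)) j).congr' ?_
  filter_upwards [self_mem_nhdsWithin] with τ hτ
  have h1 : (Matrix.of fun i j => slope (fun τ => V τ i j) t τ) = (τ - t)⁻¹ • (V τ - V t) := by
    ext i j; simp [slope_def_field, div_eq_inv_mul]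
  have h2 : -((V τ)⁻¹ * (V τ - V t) * (V t)⁻¹) = (V τ)⁻¹ - (V t)⁻¹ := by
    rw [Matrix.mul_sub, Matrix.sub_mul, Matrix.nonsing_inv_mul _ (isUnit_iff_ne_zero.2 (hdet τ hτ.1)),
      Matrix.mul_assoc, Matrix.mul_nonsing_inv _ (isUnit_iff_ne_zero.2 (hdet t ht))]
    simp
  rw [h1, Matrix.mul_smul, Matrix.smul_mul, ← smul_neg, h2]
  simp [slope_def_field, div_eq_inv_mul]

/-- Global solvability of the Riccati equation with nonnegative coefficients. The solution is
`U V⁻¹` for a solution `(U, V)` of the Hamiltonian system; `V` stays invertible because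
`v' U' V v` is nondecreasing. -/
theorem exists_riccati {A W N : ℝ → Matrix (Fin n) (Fin n) ℝ} (hA : Continuous A)
    (hW : Continuous W) (hN : Continuous N) (hWp : ∀ t, (W t).PosSemidef)
    (hNp : ∀ t, (N t).PosSemidef) {Q₀ : Matrix (Fin n) (Fin n) ℝ} (hQ₀ : Q₀.PosSemidef) {a b : ℝ}
    (hab : a ≤ b) :
    ∃ Q : ℝ → Matrix (Fin n) (Fin n) ℝ, Continuous Q ∧ Q a = Q₀ ∧ ∀ t ∈ Icc a b, (Q t)ᵀ = Q t ∧
      HasMatDeriv Q (A t * Q t + Q t * (A t)ᵀ - Q t * N t * Q t + W t) (Icc a b) t := by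
  obtain ⟨U, V, hUa, hVa, hU, hV⟩ := exists_hasMatDeriv_pair hA hW hN
    (M₂₂ := fun t => -(A t)ᵀ) (by fun_prop) a Q₀ 1
  have hWt : ∀ t, (W t)ᵀ = W t := fun t => (hWp t).isHermitian
  have hNt : ∀ t, (N t)ᵀ = N t := fun t => (hNp t).isHermitian
  -- derivative of the Hamiltonian pairing of two solutions
  have hpair : ∀ t, (A t * U t + W t * V t)ᵀ * V t + (U t)ᵀ * (N t * U t + -(A t)ᵀ * V t) =
      (V t)ᵀ * W t * V t + (U t)ᵀ * N t * U t := by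
    intro t
    simp only [Matrix.transpose_add, Matrix.transpose_mul, hWt, Matrix.add_mul, Matrix.mul_add,
      Matrix.neg_mul, Matrix.mul_neg, Matrix.mul_assoc]
    abel
  have hpairD : ∀ s t, HasMatDeriv (fun τ => (U τ)ᵀ * V τ)
      ((V t)ᵀ * W t * V t + (U t)ᵀ * N t * U t) s t := fun s t => by
    have := (hU s t).transpose.mul (hV s t)
    rwa [hpair] at this
  have hsymm : ∀ t ∈ Icc a b, (U t)ᵀ * V t = (V t)ᵀ * U t := by
    intro t ht
    have h1 : ∀ τ ∈ Icc a b, HasMatDeriv (fun τ => (V τ)ᵀ * U τ)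
        ((V τ)ᵀ * W τ * V τ + (U τ)ᵀ * N τ * U τ) (Icc a b) τ := fun τ _ => by
      have := (hpairD (Icc a b) τ).transpose
      simpa [Matrix.transpose_mul, hWt, hNt, Matrix.mul_assoc] using this
    have h2 := HasMatDeriv.sub_eq_sub (fun τ _ => hpairD (Icc a b) τ) h1 ht
    have h0 : Q₀ᵀ = Q₀ := hQ₀.isHermitian
    rwa [hUa, hVa, h0, Matrix.mul_one, Matrix.transpose_one, Matrix.one_mul, sub_left_inj] at h2
  -- if `V(t₁) v = 0`, then `φ = v' U' V v` vanishes on `[a, t₁]`, being nonnegative and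
  -- nondecreasing; hence `N U v = 0` there, `V v` solves a homogeneous equation and `v = V(a) v = 0`
  have hdet : ∀ t ∈ Icc a b, (V t).det ≠ 0 := by
    intro t₁ ht₁ hzero
    obtain ⟨v, hv0, hv⟩ := Matrix.exists_mulVec_eq_zero_iff.2 hzero
    refine hv0 ?_
    rcases ht₁.1.eq_or_lt with rfl | hlt
    · simpa [hVa] using hv
    set φ : ℝ → ℝ := fun t => v ⬝ᵥ (((U t)ᵀ * V t) *ᵥ v)
    set φ' : ℝ → ℝ := fun t => v ⬝ᵥ (((V t)ᵀ * W t * V t + (U t)ᵀ * N t * U t) *ᵥ v)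
    have hφ : ∀ s t, HasDerivWithinAt φ (φ' t) s t := by
      intro s t
      simp only [φ, φ', dotProduct, Matrix.mulVec]
      exact HasDerivWithinAt.fun_sum fun i _ => (HasDerivWithinAt.fun_sum fun j _ =>
        (hpairD s t i j).mul_const (v j)).const_mul (v i)
    have hsplit : ∀ (t : ℝ) (M Z : Matrix (Fin n) (Fin n) ℝ),
        v ⬝ᵥ ((Zᵀ * M * Z) *ᵥ v) = (Z *ᵥ v) ⬝ᵥ (M *ᵥ (Z *ᵥ v)) := fun t M Z => by
      rw [Matrix.mulVec_mulVec, Matrix.mul_assoc, ← Matrix.mulVec_mulVec, Matrix.dotProduct_mulVec,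
        Matrix.vecMul_transpose]
    have hW0 : ∀ t, 0 ≤ v ⬝ᵥ (((V t)ᵀ * W t * V t) *ᵥ v) := fun t => by
      rw [hsplit t]; simpa using (hWp t).dotProduct_mulVec_nonneg (V t *ᵥ v)
    have hN0 : ∀ t, 0 ≤ v ⬝ᵥ (((U t)ᵀ * N t * U t) *ᵥ v) := fun t => by
      rw [hsplit t]; simpa using (hNp t).dotProduct_mulVec_nonneg (U t *ᵥ v)
    have hφ'0 : ∀ t, 0 ≤ φ' t := fun t => by
      simp only [φ', Matrix.add_mulVec, dotProduct_add]
      exact add_nonneg (hW0 t) (hN0 t)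
    have hmono : MonotoneOn φ (Icc a t₁) := monotoneOn_of_hasDerivWithinAt_nonneg (convex_Icc _ _)
      (fun t _ => (hφ _ t).continuousWithinAt) (fun t _ => hφ _ t) fun t _ => hφ'0 t
    have hφa : 0 ≤ φ a := by
      have := hQ₀.dotProduct_mulVec_nonneg v
      have h0 : Q₀ᵀ = Q₀ := hQ₀.isHermitian
      simpa [φ, hUa, hVa, h0] using this
    have hφ1 : φ t₁ = 0 := by simp only [φ]; rw [← Matrix.mulVec_mulVec, hv]; simp
    have hφ0 : ∀ t ∈ Icc a t₁, φ t = 0 := fun t ht => le_antisymm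
      ((hmono ht (right_mem_Icc.2 hlt.le) ht.2).trans hφ1.le)
      (hφa.trans (hmono (left_mem_Icc.2 hlt.le) ht ht.1))
    have hNU : ∀ t ∈ Icc a t₁, N t *ᵥ (U t *ᵥ v) = 0 := by
      intro t ht
      have h1 : φ' t = 0 := (uniqueDiffOn_Icc hlt t ht).eq_deriv _ (hφ _ t)
        ((hasDerivWithinAt_const t (Icc a t₁) (0 : ℝ)).congr hφ0 (hφ0 t ht))
      simp only [φ', Matrix.add_mulVec, dotProduct_add] at h1
      have h2 : v ⬝ᵥ (((U t)ᵀ * N t * U t) *ᵥ v) = 0 := by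
        linarith [hW0 t, hN0 t]
      rw [hsplit t] at h2
      exact ((hNp t).dotProduct_mulVec_zero_iff (U t *ᵥ v)).1 (by simpa using h2)
    obtain ⟨X, Y, hXY⟩ := exists_isFundamental (A := fun t => -(A t)ᵀ) (by fun_prop)
    have h1 := eq_mul_of_hasMatDeriv (Z := fun t => V t * Matrix.replicateCol (Fin 1) v)
      (fun τ => hXY.deriv_right (Icc a t₁) τ) (fun τ hτ => by
        have := (hV (Icc a t₁) τ).mul (HasMatDeriv.const (Matrix.replicateCol (Fin 1) v))
        rw [Matrix.mul_zero, add_zero, Matrix.add_mul] at this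
        have e : N τ * U τ * Matrix.replicateCol (Fin 1) v = 0 := by
          rw [← Matrix.replicateCol_mulVec, ← Matrix.mulVec_mulVec, hNU τ hτ]; rfl
        rwa [e, zero_add, Matrix.mul_assoc] at this) (right_mem_Icc.2 hlt.le)
    simp only [hVa, Matrix.one_mul] at h1
    rw [← Matrix.replicateCol_mulVec, hv] at h1
    have h2 : Matrix.replicateCol (Fin 1) v = 0 := by
      rw [← Matrix.one_mul (Matrix.replicateCol (Fin 1) v), ← hXY.mul_inv a, Matrix.mul_assoc, ← h1]
      ext i j; simp
    exact funext fun i => congrFun (congrFun h2 i) 0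
  have hVinv : ∀ t ∈ Icc a b, V t * (V t)⁻¹ = 1 := fun t ht =>
    Matrix.mul_nonsing_inv _ (isUnit_iff_ne_zero.2 (hdet t ht))
  have hD : ∀ t ∈ Icc a b, HasMatDeriv (fun τ => U τ * (V τ)⁻¹)
      (A t * (U t * (V t)⁻¹) + (U t * (V t)⁻¹) * (A t)ᵀ -
        (U t * (V t)⁻¹) * N t * (U t * (V t)⁻¹) + W t) (Icc a b) t := by
    intro t ht
    have := (hU (Icc a b) t).mul ((hV (Icc a b) t).inv hdet ht)
    convert this using 1
    simp only [Matrix.add_mul, Matrix.mul_add, Matrix.mul_neg, Matrix.neg_mul, neg_add, neg_neg,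
      Matrix.mul_assoc, hVinv t ht, Matrix.mul_one]
    abel
  have hp : ∀ {t}, t ∈ Icc a b → (projIcc a b hab t : ℝ) = t := fun ht => by
    rw [projIcc_of_mem hab ht]
  -- extension by constants, for continuity on the whole line
  refine ⟨fun t => U (projIcc a b hab t) * (V (projIcc a b hab t))⁻¹, ?_, ?_, fun t ht => ⟨?_, ?_⟩⟩
  · have : ContinuousOn (fun τ => U τ * (V τ)⁻¹) (Icc a b) := fun t ht =>
      continuousWithinAt_pi.2 fun i => continuousWithinAt_pi.2 fun j =>
        (hD t ht i j).continuousWithinAt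
    exact this.comp_continuous (continuous_subtype_val.comp continuous_projIcc)
      fun t => (projIcc a b hab t).2
  · simp [hUa, hVa]
  · simp only [hp ht]
    rw [Matrix.transpose_mul, Matrix.transpose_nonsing_inv]
    have h1 : ((V t)ᵀ)⁻¹ * (V t)ᵀ = 1 :=
      Matrix.nonsing_inv_mul _
        (by rw [Matrix.det_transpose]; exact isUnit_iff_ne_zero.2 (hdet t ht))
    calc ((V t)ᵀ)⁻¹ * (U t)ᵀ = ((V t)ᵀ)⁻¹ * ((U t)ᵀ * V t) * (V t)⁻¹ := by
          rw [Matrix.mul_assoc, Matrix.mul_assoc, hVinv t ht, Matrix.mul_one]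
      _ = U t * (V t)⁻¹ := by rw [hsymm t ht, ← Matrix.mul_assoc, h1, Matrix.one_mul]
  · simp only [hp ht]
    intro i j
    exact (hD t ht i j).congr (fun τ hτ => by simp only [hp hτ]) (by simp only [hp ht])

end Riccati

section KalmanRiccati

variable {Ω : Type*} [MeasurableSpace Ω] {ℙ : Measure Ω} {n m p : ℕ}
  {S : LinModel n m p} {T : ℝ} {x : ℝ → Fin n → RV ℙ} {y : ℝ → Fin m → RV ℙ}

/-- The Riccati equation of the Kalman–Bucy filter has a symmetric solution for every nonnegative
initial value. -/
theorem Core.exists_riccati (h : Core S T x y) {Q₀ : Matrix (Fin n) (Fin n) ℝ}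
    (hQ₀ : Q₀.PosSemidef) {a b : ℝ} (hab : a ≤ b) :
    ∃ Q : ℝ → Matrix (Fin n) (Fin n) ℝ, Continuous Q ∧ Q a = Q₀ ∧ (∀ t ∈ Icc a b, (Q t)ᵀ = Q t) ∧
      ∀ t ∈ Icc a b, HasMatDeriv Q (S.A t * Q t + Q t * (S.A t)ᵀ -
        forwardGain S Q t * S.R t * (forwardGain S Q t)ᵀ + S.B t * (S.B t)ᵀ) (Icc a b) t := by
  have h1 := h.contA
  have h2 := h.contB
  have h3 := h.contC
  have h4 := h.contD
  have hRc : Continuous S.R := h4.matrix_mul h4.matrix_transpose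
  have hdet : ∀ t, IsUnit (S.R t).det := fun t => isUnit_iff_ne_zero.2 (h.posR t).det_pos.ne'
  have hRi := continuous_matrix_inv hRc fun t => (h.posR t).det_pos.ne'
  have hRs : ∀ t, (S.R t)ᵀ = S.R t := fun t => (h.posR t).isHermitian
  have hRis : ∀ t, ((S.R t)⁻¹)ᵀ = (S.R t)⁻¹ := fun t => by
    rw [Matrix.transpose_nonsing_inv, hRs]
  -- the part `B (I - D' R⁻¹ D)` of the state noise that is orthogonal to the output noise
  set J : ℝ → Matrix (Fin n) (Fin p) ℝ := fun t => S.B t - S.B t * (S.D t)ᵀ * (S.R t)⁻¹ * S.D t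
  have hJ : ∀ t, J t * (J t)ᵀ =
      S.B t * (S.B t)ᵀ - S.B t * (S.D t)ᵀ * (S.R t)⁻¹ * (S.D t * (S.B t)ᵀ) := by
    intro t
    have e : (S.R t)⁻¹ * (S.D t * ((S.D t)ᵀ * ((S.R t)⁻¹ * (S.D t * (S.B t)ᵀ)))) =
        (S.R t)⁻¹ * (S.D t * (S.B t)ᵀ) := by
      rw [← Matrix.mul_assoc (S.D t) (S.D t)ᵀ]
      change (S.R t)⁻¹ * (S.R t * ((S.R t)⁻¹ * (S.D t * (S.B t)ᵀ))) = _
      rw [← Matrix.mul_assoc (S.R t), Matrix.mul_nonsing_inv _ (hdet t), Matrix.one_mul]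
    simp only [J, Matrix.transpose_sub, Matrix.transpose_mul, Matrix.transpose_transpose, hRis,
      Matrix.sub_mul, Matrix.mul_sub, Matrix.mul_assoc, e]
    abel
  obtain ⟨Q, hQc, hQa, hQ⟩ := _root_.exists_riccati
    (A := fun t => S.A t - S.B t * (S.D t)ᵀ * (S.R t)⁻¹ * S.C t) (W := fun t => J t * (J t)ᵀ)
    (N := fun t => (S.C t)ᵀ * (S.R t)⁻¹ * S.C t) (by fun_prop) (by fun_prop) (by fun_prop)
    (fun t => by simpa using Matrix.posSemidef_self_mul_conjTranspose (J t))
    (fun t => by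
      simpa using (h.posR t).inv.posSemidef.conjTranspose_mul_mul_same (S.C t)) hQ₀ hab
  refine ⟨Q, hQc, hQa, fun t ht => (hQ t ht).1, fun t ht => ?_⟩
  convert (hQ t ht).2 using 1
  have e : (S.R t)⁻¹ * (S.R t * (((S.R t)⁻¹)ᵀ * (S.C t * Q t + S.D t * (S.B t)ᵀ))) =
      (S.R t)⁻¹ * (S.C t * Q t + S.D t * (S.B t)ᵀ) := by
    rw [hRis, ← Matrix.mul_assoc (S.R t), Matrix.mul_nonsing_inv _ (hdet t), Matrix.one_mul]
  rw [hJ]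
  simp only [forwardGain, Matrix.transpose_mul, Matrix.transpose_add, Matrix.transpose_transpose,
    (hQ t ht).1, Matrix.mul_assoc, e]
  simp only [Matrix.transpose_sub, Matrix.transpose_mul, Matrix.transpose_transpose, hRis,
    Matrix.sub_mul, Matrix.mul_sub, Matrix.mul_add, Matrix.add_mul, Matrix.mul_assoc]
  abel

end KalmanRiccati

/-! ### Covariance algebra and discrete-time updates -/

section CovAlgebra

variable {Ω : Type*} [MeasurableSpace Ω] {ℙ : Measure Ω} {q r k l : ℕ}

theorem covMat_matAct_left (M : Matrix (Fin k) (Fin q) ℝ) (u : Fin q → RV ℙ) (v : Fin r → RV ℙ) :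
    covMat (M ⊛ u) v = M * covMat u v := by
  ext i j
  simp [covMat, matAct, Matrix.mul_apply, sum_inner, real_inner_smul_left]

theorem covMat_matAct_right (M : Matrix (Fin k) (Fin r) ℝ) (u : Fin q → RV ℙ) (v : Fin r → RV ℙ) :
    covMat u (M ⊛ v) = covMat u v * Mᵀ := by
  ext i j
  simp [covMat, matAct, Matrix.mul_apply, inner_sum, real_inner_smul_right, mul_comm]

theorem covMat_add_left (u u' : Fin q → RV ℙ) (v : Fin r → RV ℙ) :
    covMat (u + u') v = covMat u v + covMat u' v := by
  ext i j; simp [covMat, inner_add_left]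

theorem covMat_add_right (u : Fin q → RV ℙ) (v v' : Fin r → RV ℙ) :
    covMat u (v + v') = covMat u v + covMat u v' := by
  ext i j; simp [covMat, inner_add_right]

theorem covMat_sub_left (u u' : Fin q → RV ℙ) (v : Fin r → RV ℙ) :
    covMat (u - u') v = covMat u v - covMat u' v := by
  ext i j; simp [covMat, inner_sub_left]

theorem covMat_sub_right (u : Fin q → RV ℙ) (v v' : Fin r → RV ℙ) :
    covMat u (v - v') = covMat u v - covMat u v' := by
  ext i j; simp [covMat, inner_sub_right]

theorem matAct_sub {E : Type*} [AddCommGroup E] [Module ℝ E] (M : Matrix (Fin k) (Fin q) ℝ)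
    (u v : Fin q → E) : M ⊛ (u - v) = M ⊛ u - M ⊛ v := by
  ext1 i; simp [matAct, smul_sub]

theorem matAct_add {E : Type*} [AddCommGroup E] [Module ℝ E] (M : Matrix (Fin k) (Fin q) ℝ)
    (u v : Fin q → E) : M ⊛ (u + v) = M ⊛ u + M ⊛ v := by
  ext1 i; simp [matAct, smul_add, Finset.sum_add_distrib]

theorem matAct_mul {E : Type*} [AddCommGroup E] [Module ℝ E] (M : Matrix (Fin k) (Fin q) ℝ)
    (N : Matrix (Fin q) (Fin l) ℝ) (u : Fin l → E) : (M * N) ⊛ u = M ⊛ N ⊛ u := by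
  ext1 i
  simp only [matAct, Matrix.mul_apply, Finset.sum_smul, Finset.smul_sum, smul_smul]
  exact Finset.sum_comm

theorem matAct_mem {K : ClosedSubmodule ℝ (RV ℙ)} (M : Matrix (Fin k) (Fin q) ℝ)
    {u : Fin q → RV ℙ} (hu : ∀ i, u i ∈ K) (i : Fin k) : (M ⊛ u) i ∈ K :=
  K.toSubmodule.sum_mem fun j _ => K.toSubmodule.smul_mem _ (hu j)

theorem inner_matAct_right (M : Matrix (Fin k) (Fin q) ℝ) (u : Fin q → RV ℙ) (i : Fin k)
    (w : RV ℙ) : inner ℝ w ((M ⊛ u) i) = ∑ j, M i j * inner ℝ w (u j) := by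
  simp [matAct, inner_sum, real_inner_smul_right]

theorem span_closure_le {d : Fin q → RV ℙ} {K : ClosedSubmodule ℝ (RV ℙ)} (h : ∀ j, d j ∈ K) :
    (Submodule.span ℝ (range d)).closure ≤ K := by
  rw [Submodule.closure_le, Submodule.span_le]
  rintro _ ⟨j, rfl⟩
  exact h j

theorem mem_span_closure (d : Fin q → RV ℙ) (j : Fin q) :
    d j ∈ (Submodule.span ℝ (range d)).closure :=
  Submodule.le_topologicalClosure _ (Submodule.subset_span ⟨j, rfl⟩)

/-- Update of a least-squares estimate by the additional data `d` with innovation `ν`. -/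
theorem estimate_sup_span {K : ClosedSubmodule ℝ (RV ℙ)} (v : Fin q → RV ℙ)
    {d ν : Fin r → RV ℙ} (hd : ∀ j, d j - ν j ∈ K) (hν : ∀ j, ∀ w ∈ K, inner ℝ w (ν j) = 0)
    (hV : IsUnit (covMat ν ν)) :
    estimate (K ⊔ (Submodule.span ℝ (range d)).closure) v =
        estimate K v + (covMat (v - estimate K v) ν * (covMat ν ν)⁻¹) ⊛ ν ∧
      covMat (v - estimate (K ⊔ (Submodule.span ℝ (range d)).closure) v)
          (v - estimate (K ⊔ (Submodule.span ℝ (range d)).closure) v) =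
        covMat (v - estimate K v) (v - estimate K v) -
          covMat (v - estimate K v) ν * (covMat ν ν)⁻¹ * covMat ν ν *
            (covMat (v - estimate K v) ν * (covMat ν ν)⁻¹)ᵀ := by
  set L := K ⊔ (Submodule.span ℝ (range d)).closure
  set e := v - estimate K v
  set V := covMat ν ν
  set G := covMat e ν * V⁻¹
  have hVs : Vᵀ = V := transpose_covMat _ _
  have hGV : G * V = covMat e ν := by
    simp only [G]
    rw [Matrix.mul_assoc, Matrix.nonsing_inv_mul _ ((Matrix.isUnit_iff_isUnit_det _).1 hV),
      Matrix.mul_one]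
  have hνL : ∀ j, ν j ∈ L := fun j => by
    have h1 : d j ∈ L := (le_sup_right : _ ≤ L) (mem_span_closure d j)
    have h2 : d j - ν j ∈ L := (le_sup_left : K ≤ L) (hd j)
    simpa using L.toSubmodule.sub_mem h1 h2
  have hνerr : ∀ i k, inner ℝ ((e - G ⊛ ν) i) (ν k) = 0 := by
    intro i k
    have h1 : covMat (e - G ⊛ ν) ν = 0 := by
      rw [covMat_sub_left, covMat_matAct_left, hGV, sub_self]
    exact congrFun (congrFun h1 i) k
  have hKerr : ∀ i, ∀ w ∈ K, inner ℝ ((e - G ⊛ ν) i) w = 0 := by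
    intro i w hw
    rw [real_inner_comm, Pi.sub_apply, inner_sub_right, inner_matAct_right]
    simp [e, inner_sub_estimate v i hw, hν _ w hw]
  have hest : estimate L v = estimate K v + G ⊛ ν := by
    refine estimate_eq_of_inner_eq_zero (fun i => L.toSubmodule.add_mem
      ((le_sup_left : K ≤ L) (estimate_mem K v i)) (matAct_mem G hνL i)) fun i w hw => ?_
    have e1 : v i - (estimate K v + G ⊛ ν) i = (e - G ⊛ ν) i := by
      simp only [e, Pi.sub_apply, Pi.add_apply]; abel
    rw [e1]
    have hle : L ≤ orthTo ((e - G ⊛ ν) i) := by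
      refine sup_le (fun w hw => mem_orthTo.2 (hKerr i w hw))
        (span_closure_le fun j => mem_orthTo.2 ?_)
      have : d j = (d j - ν j) + ν j := by abel
      rw [this, inner_add_right, hKerr i _ (hd j), hνerr, add_zero]
    rw [real_inner_comm]
    exact mem_orthTo.1 (hle hw)
  refine ⟨hest, ?_⟩
  have e1 : v - estimate L v = e - G ⊛ ν := by rw [hest]; simp only [e]; abel
  rw [e1, covMat_sub_right, covMat_matAct_right]
  have h1 : covMat (e - G ⊛ ν) ν = 0 := by ext i k; exact hνerr i k
  rw [h1, Matrix.zero_mul, sub_zero, covMat_sub_left, covMat_matAct_left,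
    ← transpose_covMat e ν, ← hGV, Matrix.transpose_mul, hVs, Matrix.mul_assoc G V]

end CovAlgebra

/-! ### Prediction without observations -/

section Gap

variable {Ω : Type*} [MeasurableSpace Ω] {ℙ : Measure Ω} {n m p : ℕ}
  {S : LinModel n m p} {T : ℝ} {x : ℝ → Fin n → RV ℙ} {y : ℝ → Fin m → RV ℙ}

/-- The transition matrix of the stacked process from time `s` to the fixed time `b`. -/
noncomputable def gapH (S : LinModel n m p) (b s : ℝ) : Matrix (Fin n ⊕ Fin m) (Fin n ⊕ Fin m) ℝ :=
  Matrix.fromBlocks (transition S.A b s) 0 (gapC S s b) 1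

namespace Core

variable {a b c t : ℝ} {Ka : ClosedSubmodule ℝ (RV ℙ)}

theorem covMat_state (h : Core S T x y) (ht : t ∈ Icc 0 T) : covMat (x t) (x t) = 1 := by
  ext i j; exact h.cov_state t ht i j

theorem estimate_state (h : Core S T x y) (hat : a ≤ t) (ht : t ≤ T)
    (hKa : Ka ≤ pastSpace S T x y a) :
    estimate Ka (x t) = transition S.A t a ⊛ estimate Ka (x a) := by
  obtain ⟨X, Y, hXY⟩ := exists_isFundamental h.contA
  refine estimate_eq_of_inner_eq_zero (matAct_mem _ (estimate_mem Ka _)) fun i w hw => ?_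
  rw [inner_sub_right, inner_matAct_right, h.inner_state_of_mem_past hXY (hKa hw) hat ht,
    ← Finset.sum_sub_distrib]
  refine Finset.sum_eq_zero fun j _ => ?_
  rw [hXY.transition_eq, ← mul_sub, ← inner_sub_right, inner_sub_estimate _ _ hw, mul_zero]

/-- Pythagoras for the estimate of a state with unit covariance. -/
theorem covMat_sub_estimate_eq (h : Core S T x y) (K : ClosedSubmodule ℝ (RV ℙ))
    (ht : t ∈ Icc 0 T) :
    covMat (x t - estimate K (x t)) (x t - estimate K (x t)) =
      1 - covMat (estimate K (x t)) (estimate K (x t)) := by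
  have h1 : covMat (x t - estimate K (x t)) (estimate K (x t)) = 0 := by
    ext i j
    have := inner_sub_estimate (x t) i (estimate_mem K (x t) j)
    rw [real_inner_comm] at this
    exact this
  rw [covMat_sub_estimate, covMat_sub_left, h.covMat_state ht]
  congr 1
  rw [covMat_sub_left, sub_eq_zero] at h1
  rw [← transpose_covMat (x t), h1, transpose_covMat]

/-- Without new observations the error covariance solves the Lyapunov equation. In
`1 - Φ P Φ'` the constant `1` is a solution because `A + A' + B B' = 0`. -/
theorem hasMatDeriv_errCov (h : Core S T x y) (hT : 0 < T) (ha : 0 ≤ a) (hc : c ≤ T)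
    (hKa : Ka ≤ pastSpace S T x y a) (ht : t ∈ Icc a c) :
    HasMatDeriv (fun t => covMat (x t - estimate Ka (x t)) (x t - estimate Ka (x t)))
      (S.A t * covMat (x t - estimate Ka (x t)) (x t - estimate Ka (x t)) +
        covMat (x t - estimate Ka (x t)) (x t - estimate Ka (x t)) * (S.A t)ᵀ +
        S.B t * (S.B t)ᵀ) (Icc a c) t := by
  have hmem : ∀ t ∈ Icc a c, t ∈ Icc 0 T := fun t ht => ⟨ha.trans ht.1, ht.2.trans hc⟩
  set P := covMat (estimate Ka (x a)) (estimate Ka (x a))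
  have hcov : ∀ t ∈ Icc a c, covMat (x t - estimate Ka (x t)) (x t - estimate Ka (x t)) =
      1 - transition S.A t a * P * (transition S.A t a)ᵀ := fun t ht => by
    rw [h.covMat_sub_estimate_eq Ka (hmem t ht), h.estimate_state ht.1 (ht.2.trans hc) hKa,
      covMat_matAct_left, covMat_matAct_right, Matrix.mul_assoc]
  have h1 := hasMatDeriv_transition h.contA a t (Icc a c)
  have h2 := (HasMatDeriv.const (1 : Matrix (Fin n) (Fin n) ℝ)).sub
    ((h1.mul (HasMatDeriv.const P)).mul h1.transpose)
  intro i j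
  refine ((h2 i j).congr (fun τ hτ => by simp only [hcov τ hτ])
    (by simp only [hcov t ht])).congr_deriv ?_
  rw [hcov t ht]
  refine congrFun (congrFun ?_ i) j
  have h3 : S.B t * (S.B t)ᵀ = -(S.A t + (S.A t)ᵀ) := by
    rw [eq_neg_iff_add_eq_zero, ← h.add_transpose_add hT (hmem t ht), add_comm]
  rw [h3]
  simp only [Matrix.mul_sub, Matrix.sub_mul, Matrix.mul_one, Matrix.one_mul, Matrix.mul_zero,
    add_zero, Matrix.transpose_mul, Matrix.mul_assoc]
  abel

/-- The estimate without observations solves `ż = A z`. -/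
theorem estimate_state_sub (h : Core S T x y) (hc : c ≤ T)
    (hKa : Ka ≤ pastSpace S T x y a) {s t : ℝ} (has : a ≤ s) (hst : s ≤ t) (htc : t ≤ c)
    (i : Fin n) :
    estimate Ka (x t) i - estimate Ka (x s) i =
      ∫ τ in s..t, ∑ j, S.A τ i j • estimate Ka (x τ) j := by
  obtain ⟨X, Y, hXY⟩ := exists_isFundamental h.contA
  have hX := hXY.cont_left
  have hA := h.contA
  have hd : ∀ τ, HasDerivAt (fun τ => (transition S.A τ a ⊛ estimate Ka (x a)) i)
      (((S.A τ * transition S.A τ a) ⊛ estimate Ka (x a)) i) τ := fun τ => by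
    simp only [matAct]
    exact HasDerivAt.fun_sum fun j _ =>
      ((hasMatDeriv_transition h.contA a τ univ i j).hasDerivAt univ_mem).smul_const _
  rw [h.estimate_state (has.trans hst) (htc.trans hc) hKa,
    h.estimate_state has (hst.trans (htc.trans hc)) hKa,
    ← intervalIntegral.integral_eq_sub_of_hasDerivAt (fun τ _ => hd τ)]
  · refine intervalIntegral.integral_congr fun τ hτ => ?_
    rw [uIcc_of_le hst] at hτ
    simp only [h.estimate_state (has.trans hτ.1) (hτ.2.trans (htc.trans hc)) hKa, matAct_mul]
    rfl
  · refine Continuous.intervalIntegrable ?_ _ _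
    simp only [matAct, hXY.transition_eq]
    fun_prop

/-- In its initial time the transition matrix of the stacked process solves the adjoint equation. -/
theorem hasMatDeriv_gapH (h : Core S T x y) (b : ℝ) (s : Set ℝ) (t : ℝ) :
    HasMatDeriv (gapH S b)
      (-(gapH S b t * Matrix.fromBlocks (S.A t) 0 (S.C t) (0 : Matrix (Fin m) (Fin m) ℝ))) s t := by
  obtain ⟨X, Y, hXY⟩ := exists_isFundamental h.contA
  have hX := hXY.cont_left
  have hC := h.contC
  have h1 : HasMatDeriv (transition S.A b) (-(transition S.A b t * S.A t)) s t := by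
    have := (HasMatDeriv.const (X b)).mul (hXY.deriv_right s t)
    simp only [Matrix.zero_mul, zero_add, Matrix.mul_neg, ← Matrix.mul_assoc] at this
    intro i j
    simpa only [hXY.transition_eq] using this i j
  have h2 : HasMatDeriv (fun τ => gapC S τ b) (-(gapC S t b * S.A t + S.C t)) s t := by
    have h3 : HasMatDeriv (fun τ => Matrix.of fun i j => ∫ σ in τ..b, (S.C σ * X σ) i j)
        (-(S.C t * X t)) s t := by
      have := hasMatDeriv_integral (M := fun τ => S.C τ * X τ) (by fun_prop) b s t
      intro i j
      refine ((this i j).neg).congr_of_eventuallyEq (Eventually.of_forall fun τ => ?_) ?_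
      · exact intervalIntegral.integral_symm b τ
      · exact intervalIntegral.integral_symm b t
    have h4 := h3.mul (hXY.deriv_right s t)
    have e : -(S.C t * X t) * Y t + (Matrix.of fun i j => ∫ σ in t..b, (S.C σ * X σ) i j) *
        (-(Y t * S.A t)) = -(gapC S t b * S.A t + S.C t) := by
      rw [gapC_eq h.contC hXY, Matrix.neg_mul, Matrix.mul_assoc, hXY.mul_inv, Matrix.mul_one,
        Matrix.mul_neg, ← Matrix.mul_assoc, neg_add, add_comm]
    rw [e] at h4
    intro i j
    simpa only [gapC_eq h.contC hXY] using h4 i j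
  rintro (i | i) (j | j)
  · simpa [gapH, Matrix.fromBlocks_multiply] using h1 i j
  · simpa [gapH, Matrix.fromBlocks_multiply] using hasDerivWithinAt_const t s (0 : ℝ)
  · simpa [gapH, Matrix.fromBlocks_multiply] using h2 i j
  · simpa [gapH, Matrix.fromBlocks_multiply] using
      hasDerivWithinAt_const t s ((1 : Matrix (Fin m) (Fin m) ℝ) i j)

/-- The effect of the noise between `a` and `b` on the state and the output at time `b`. -/
noncomputable def _root_.gapNoise (S : LinModel n m p) (x : ℝ → Fin n → RV ℙ) (y : ℝ → Fin m → RV ℙ)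
    (a b : ℝ) (i : Fin n ⊕ Fin m) : RV ℙ :=
  Sum.elim (x b - transition S.A b a ⊛ x a) (y b - y a - gapC S a b ⊛ x a) i

theorem inner_gapNoise_of_mem_past (h : Core S T x y) (hab : a ≤ b) (hb : b ≤ T) {v : RV ℙ}
    (hv : v ∈ pastSpace S T x y a) (i) : inner ℝ v (gapNoise S x y a b i) = 0 := by
  obtain ⟨X, Y, hXY⟩ := exists_isFundamental h.contA
  rcases i with i | i
  · simp only [gapNoise, Sum.elim_inl, Pi.sub_apply]
    rw [inner_sub_right, inner_matAct_right, h.inner_state_of_mem_past hXY hv hab hb, sub_eq_zero]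
    simp only [hXY.transition_eq]
  · simp only [gapNoise, Sum.elim_inr, Pi.sub_apply]
    rw [inner_sub_right, inner_matAct_right, h.inner_output_of_mem_past hv hab hb, sub_self]

/-- Covariance of the gap noise: the second moments of the stacked process solve a Lyapunov equation,
which is integrated by means of the transition matrix `gapH`. -/
theorem inner_gapNoise (h : Core S T x y) (ha : 0 ≤ a) (hab : a ≤ b) (hb : b ≤ T) (i j) :
    inner ℝ (gapNoise S x y a b i) (gapNoise S x y a b j) =
      ∫ s in a..b, (gapH S b s * stackB S s * (gapH S b s * stackB S s)ᵀ) i j := by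
  have hΓ := h.cont_stackΓ
  set u : Fin n ⊕ Fin m → ℝ → RV ℙ := fun i t => stackX x y i t - Sum.elim (fun _ => 0) (y a) i
  set P : ℝ → Matrix (Fin n ⊕ Fin m) (Fin n ⊕ Fin m) ℝ := fun t =>
    Matrix.of fun i j => inner ℝ (u i t) (u j t)
  set A' : ℝ → Matrix (Fin n ⊕ Fin m) (Fin n ⊕ Fin m) ℝ := fun t =>
    Matrix.fromBlocks (S.A t) 0 (S.C t) 0
  have hdrift : ∀ i t, stackDrift S x i t = ∑ k, A' t i k • u k t := by
    rintro (i | i) t <;> simp [stackDrift, A', u, stackA, stackX]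
  have hP : ∀ t ∈ Icc a b, HasMatDeriv P (A' t * P t + P t * (A' t)ᵀ + stackΓ S t) (Icc a b) t := by
    intro t ht i j
    have := ((h.isDriven ha i).mono hb).hasDerivWithinAt ((h.isDriven ha j).mono hb)
      (h.noise _ _).cont (fun s t h1 h2 h3 => (h.noise _ _).cov (ha.trans h1) h2 (h3.trans hb)) ht
    refine this.congr_deriv ?_
    rw [hdrift, hdrift]
    simp only [sum_inner, inner_sum, real_inner_smul_left, real_inner_smul_right, Matrix.mul_apply,
      Matrix.add_apply, Matrix.transpose_apply, Matrix.of_apply, P, stackΓ, u, mul_comm]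
  have hH : ∀ t, HasMatDeriv (gapH S b) (-(gapH S b t * A' t)) (Icc a b) t :=
    h.hasMatDeriv_gapH b (Icc a b)
  have hHc : Continuous (gapH S b) := continuous_matrix fun i j =>
    continuous_iff_continuousAt.2 fun t =>
      ((h.hasMatDeriv_gapH b univ t i j).hasDerivAt univ_mem).continuousAt
  have hB := h.cont_stackB
  have hHP : ∀ t ∈ Icc a b, HasMatDeriv (fun t => gapH S b t * P t * (gapH S b t)ᵀ)
      (gapH S b t * stackB S t * (gapH S b t * stackB S t)ᵀ) (Icc a b) t := by
    intro t ht
    have := ((hH t).mul (hP t ht)).mul (hH t).transpose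
    convert this using 1
    simp only [stackΓ, Matrix.transpose_mul, Matrix.transpose_neg, Matrix.mul_add, Matrix.add_mul,
      Matrix.neg_mul, Matrix.mul_neg, Matrix.mul_assoc]
    abel
  have hcont : Continuous fun s => gapH S b s * stackB S s * (gapH S b s * stackB S s)ᵀ := by
    fun_prop
  have hint := HasMatDeriv.sub_eq_sub hHP
    (fun t _ => hasMatDeriv_integral hcont a (Icc a b) t) (right_mem_Icc.2 hab)
  obtain ⟨X, Y, hXY⟩ := exists_isFundamental h.contA
  have hHb : gapH S b b = 1 := by
    have : gapC S b b = 0 := by ext i j; simp [gapC]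
    rw [gapH, hXY.transition_eq, hXY.mul_inv, this, Matrix.fromBlocks_one]
  have hu : ∀ i, u i b = gapNoise S x y a b i + ∑ k, gapH S b a i k • u k a := by
    rintro (i | i) <;> simp [u, gapNoise, gapH, stackX, matAct]
  have hpast : ∀ k, u k a ∈ pastSpace S T x y a := fun k => (h.isDriven ha k).adapted a le_rfl
    (hab.trans hb)
  have hleft := congrFun (congrFun hint i) j
  simp only [hHb, Matrix.one_mul, Matrix.transpose_one, Matrix.mul_one, Matrix.sub_apply,
    Matrix.of_apply, intervalIntegral.integral_same, sub_zero] at hleft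
  rw [← hleft]
  simp only [P, Matrix.of_apply, hu]
  have h0 : ∀ i j, inner ℝ (∑ k, gapH S b a i k • u k a) (gapNoise S x y a b j) = 0 := fun i j => by
    rw [sum_inner]
    exact Finset.sum_eq_zero fun k _ => by
      rw [real_inner_smul_left, h.inner_gapNoise_of_mem_past hab hb (hpast k), mul_zero]
  have h0' : ∀ i j, inner ℝ (gapNoise S x y a b j) (∑ k, gapH S b a i k • u k a) = 0 :=
      fun i j => by
    rw [real_inner_comm, h0]
  have hHPH : inner ℝ (∑ k, gapH S b a i k • u k a) (∑ k, gapH S b a j k • u k a) =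
      (gapH S b a * P a * (gapH S b a)ᵀ) i j := by
    rw [Matrix.mul_assoc]
    simp only [sum_inner, inner_sum, real_inner_smul_left, real_inner_smul_right, Matrix.mul_apply,
      Matrix.transpose_apply, Matrix.of_apply, P, Finset.mul_sum]
    rw [Finset.sum_comm]
    exact Finset.sum_congr rfl fun k _ => Finset.sum_congr rfl fun l _ => by ring
  rw [inner_add_left, inner_add_right, inner_add_right, h0, h0', hHPH]
  ring

theorem gapH_mul_stackB_inl (b s : ℝ) (i : Fin n) (k : Fin p) :
    (gapH S b s * stackB S s) (Sum.inl i) k = (transition S.A b s * S.B s) i k := by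
  simp [gapH, stackB, Matrix.mul_apply]

theorem gapH_mul_stackB_inr (b s : ℝ) (i : Fin m) (k : Fin p) :
    (gapH S b s * stackB S s) (Sum.inr i) k = gapM S b s i k := by
  simp [gapH, stackB, gapM, Matrix.mul_apply, Matrix.one_apply]

theorem covMat_gapNoise_state (h : Core S T x y) (ha : 0 ≤ a) (hab : a ≤ b) (hb : b ≤ T) :
    covMat (x b - transition S.A b a ⊛ x a) (x b - transition S.A b a ⊛ x a) = gapBB S a b := by
  ext i j
  have hi := h.inner_gapNoise ha hab hb (Sum.inl i) (Sum.inl j)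
  rw [intervalIntegral.integral_of_le hab] at hi
  simp only [covMat, gapBB, Matrix.of_apply, uIcc_of_le hab, integral_Icc_eq_integral_Ioc]
  refine hi.trans (integral_congr_ae (Eventually.of_forall fun s => ?_))
  simp only [Matrix.mul_apply', Matrix.transpose_apply, dotProduct]
  exact Finset.sum_congr rfl fun k _ =>
    congrArg₂ _ (gapH_mul_stackB_inl b s i k) (gapH_mul_stackB_inl b s j k)

theorem covMat_gapNoise_state_output (h : Core S T x y) (ha : 0 ≤ a) (hab : a ≤ b) (hb : b ≤ T) :
    covMat (x b - transition S.A b a ⊛ x a) (y b - y a - gapC S a b ⊛ x a) = gapBD S a b := by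
  ext i j
  have hi := h.inner_gapNoise ha hab hb (Sum.inl i) (Sum.inr j)
  rw [intervalIntegral.integral_of_le hab] at hi
  simp only [covMat, gapBD, Matrix.of_apply, uIcc_of_le hab, integral_Icc_eq_integral_Ioc]
  refine hi.trans (integral_congr_ae (Eventually.of_forall fun s => ?_))
  simp only [Matrix.mul_apply', Matrix.transpose_apply, dotProduct]
  exact Finset.sum_congr rfl fun k _ =>
    congrArg₂ _ (gapH_mul_stackB_inl b s i k) (gapH_mul_stackB_inr b s j k)

theorem covMat_gapNoise_output (h : Core S T x y) (ha : 0 ≤ a) (hab : a ≤ b) (hb : b ≤ T) :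
    covMat (y b - y a - gapC S a b ⊛ x a) (y b - y a - gapC S a b ⊛ x a) = gapDD S a b := by
  ext i j
  have hi := h.inner_gapNoise ha hab hb (Sum.inr i) (Sum.inr j)
  rw [intervalIntegral.integral_of_le hab] at hi
  simp only [covMat, gapDD, Matrix.of_apply, uIcc_of_le hab, integral_Icc_eq_integral_Ioc]
  refine hi.trans (integral_congr_ae (Eventually.of_forall fun s => ?_))
  simp only [Matrix.mul_apply', Matrix.transpose_apply, dotProduct]
  exact Finset.sum_congr rfl fun k _ =>
    congrArg₂ _ (gapH_mul_stackB_inr b s i k) (gapH_mul_stackB_inr b s j k)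

/-- The noise of the increment of the output over a gap is nondegenerate, because `M(b) = D(b)`. -/
theorem posDef_gapDD (h : Core S T x y) (ha : 0 ≤ a) (hab : a < b) (hb : b ≤ T) :
    (gapDD S a b).PosDef := by
  obtain ⟨X, Y, hXY⟩ := exists_isFundamental h.contA
  have hX := hXY.cont_left
  have hY := hXY.cont_right
  have hC := h.contC
  have hB := h.contB
  have hD := h.contD
  have hM : Continuous (gapM S b) := by
    have h1 : Continuous fun s => gapC S s b := continuous_matrix fun i j =>
      continuous_iff_continuousAt.2 fun t =>
        ((h.hasMatDeriv_gapH b univ t (Sum.inr i) (Sum.inl j)).hasDerivAt univ_mem).continuousAt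
    unfold gapM
    fun_prop
  refine Matrix.PosDef.of_dotProduct_mulVec_pos
    (by rw [← h.covMat_gapNoise_output ha hab.le hb]; exact transpose_covMat _ _) fun v hv => ?_
  have hq : ∀ s, v ⬝ᵥ ((gapM S b s * (gapM S b s)ᵀ) *ᵥ v) =
      ((gapM S b s)ᵀ *ᵥ v) ⬝ᵥ ((gapM S b s)ᵀ *ᵥ v) := fun s => by
    rw [← Matrix.mulVec_mulVec, Matrix.dotProduct_mulVec, ← Matrix.mulVec_transpose]
  have hint : v ⬝ᵥ (gapDD S a b *ᵥ v) =
      ∫ s in a..b, v ⬝ᵥ ((gapM S b s * (gapM S b s)ᵀ) *ᵥ v) := by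
    simp only [dotProduct, Matrix.mulVec, gapDD, Matrix.of_apply, uIcc_of_le hab.le,
      integral_Icc_eq_integral_Ioc, ← intervalIntegral.integral_of_le hab.le]
    rw [intervalIntegral.integral_finsetSum fun i _ =>
      Continuous.intervalIntegrable (by fun_prop) _ _]
    refine Finset.sum_congr rfl fun i _ => ?_
    rw [intervalIntegral.integral_const_mul, intervalIntegral.integral_finsetSum fun i _ =>
      Continuous.intervalIntegrable (by fun_prop) _ _]
    simp only [intervalIntegral.integral_mul_const]
  rw [star_trivial, hint]
  have hgapb : gapM S b b = S.D b := by
    have : gapC S b b = 0 := by ext i j; simp [gapC]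
    rw [gapM, this, Matrix.zero_mul, zero_add]
  refine intervalIntegral.integral_pos hab ?_ (fun s _ => ?_) ⟨b, right_mem_Icc.2 hab.le, ?_⟩
  · refine Continuous.continuousOn ?_
    simp only [dotProduct, Matrix.mulVec]
    fun_prop
  · rw [hq]; exact Finset.sum_nonneg fun i _ => mul_self_nonneg _
  · rw [hgapb]
    simpa [LinModel.R] using (h.posR b).dotProduct_mulVec_pos hv

/-- The discrete-time Kalman step across a gap of which only the increment of the output is
known. -/
theorem gapStep (h : Core S T x y) (ha : 0 ≤ a) (hab : a < b) (hb : b ≤ T)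
    (hKa : Ka ≤ pastSpace S T x y a) {z : ℝ → Fin n → RV ℙ} {Q : ℝ → Matrix (Fin n) (Fin n) ℝ}
    (hza : z a = estimate Ka (x a))
    (hQa : Q a = covMat (x a - z a) (x a - z a))
    (hzb : z b = estimate
      (Ka ⊔ (Submodule.span ℝ (range fun k => y b k - y a k)).closure) (x b))
    (hQb : Q b = covMat (x b - z b) (x b - z b)) :
    IsUnit (gapInnov S Q a b) ∧ GapStep S y z Q a b := by
  set Φ := transition S.A b a
  set Cd := gapC S a b
  set ξ := x b - Φ ⊛ x a
  set η := y b - y a - Cd ⊛ x a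
  set e := x a - z a
  set ν := y b - y a - Cd ⊛ z a
  have hν : ν = Cd ⊛ e + η := by simp only [ν, e, η, matAct_sub]; abel
  have hest : estimate Ka (x b) = Φ ⊛ z a := by rw [h.estimate_state hab.le hb hKa, hza]
  have herr : x b - estimate Ka (x b) = Φ ⊛ e + ξ := by
    rw [hest]; simp only [e, ξ, matAct_sub]; abel
  have hemem : ∀ i, e i ∈ pastSpace S T x y a := fun i =>
    (pastSpace S T x y a).toSubmodule.sub_mem (h.state_mem ha le_rfl i)
      (by rw [hza]; exact hKa (estimate_mem Ka _ i))
  have heξ : covMat e ξ = 0 := by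
    ext i j; exact h.inner_gapNoise_of_mem_past hab.le hb (hemem i) (Sum.inl j)
  have heη : covMat e η = 0 := by
    ext i j; exact h.inner_gapNoise_of_mem_past hab.le hb (hemem i) (Sum.inr j)
  have hξe : covMat ξ e = 0 := by rw [← transpose_covMat, heξ, Matrix.transpose_zero]
  have hηe : covMat η e = 0 := by rw [← transpose_covMat, heη, Matrix.transpose_zero]
  have hξξ : covMat ξ ξ = gapBB S a b := h.covMat_gapNoise_state ha hab.le hb
  have hξη : covMat ξ η = gapBD S a b := h.covMat_gapNoise_state_output ha hab.le hb
  have hηη : covMat η η = gapDD S a b := h.covMat_gapNoise_output ha hab.le hb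
  have hee : covMat e e = Q a := hQa.symm
  have hV : covMat ν ν = gapInnov S Q a b := by
    rw [hν, gapInnov, covMat_add_left, covMat_add_right, covMat_add_right, covMat_matAct_left,
      covMat_matAct_left, covMat_matAct_right, covMat_matAct_right, hee, heη, hηe, hηη]
    simp [Matrix.mul_assoc, Cd]
  have hcross : covMat (x b - estimate Ka (x b)) ν =
      Φ * Q a * Cdᵀ + gapBD S a b := by
    rw [herr, hν, covMat_add_left, covMat_add_right, covMat_add_right, covMat_matAct_left,
      covMat_matAct_left, covMat_matAct_right, covMat_matAct_right, hee, heη, hξe, hξη]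
    simp [Matrix.mul_assoc]
  have herrcov : covMat (x b - estimate Ka (x b)) (x b - estimate Ka (x b)) =
      Φ * Q a * Φᵀ + gapBB S a b := by
    rw [herr, covMat_add_left, covMat_add_right, covMat_add_right, covMat_matAct_left,
      covMat_matAct_left, covMat_matAct_right, covMat_matAct_right, hee, heξ, hξe, hξξ]
    simp [Matrix.mul_assoc]
  have hunit : IsUnit (gapInnov S Q a b) := by
    have h1 : (gapInnov S Q a b).PosDef := by
      rw [gapInnov, add_comm]
      refine (h.posDef_gapDD ha hab hb).add_posSemidef ?_
      have : (Q a).PosSemidef := by rw [hQa]; exact posSemidef_covMat _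
      simpa using this.mul_mul_conjTranspose_same (gapC S a b)
    exact (Matrix.isUnit_iff_isUnit_det _).2 (isUnit_iff_ne_zero.2 h1.det_pos.ne')
  have hup := estimate_sup_span (K := Ka) (x b) (d := fun k => y b k - y a k) (ν := ν)
    (fun j => by
      have : y b j - y a j - ν j = (Cd ⊛ z a) j := by
        simp only [ν, Pi.sub_apply]; abel
      rw [this, hza]
      exact matAct_mem Cd (estimate_mem Ka (x a)) j)
    (fun j w hw => by
      rw [hν, Pi.add_apply, inner_add_right, inner_matAct_right]
      have h1 : inner ℝ w (η j) = 0 :=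
        h.inner_gapNoise_of_mem_past hab.le hb (hKa hw) (Sum.inr j)
      rw [h1, add_zero]
      exact Finset.sum_eq_zero fun k _ => by
        simp only [e, Pi.sub_apply, hza]
        rw [inner_sub_estimate _ _ hw, mul_zero])
    (by rw [hV]; exact hunit)
  rw [hcross, hV, herrcov, ← hzb, ← hQb, hest] at hup
  refine ⟨hunit, hup.1, hup.2.trans ?_⟩
  simp only [gapGain, Φ, Cd]
  abel

end Core
end Gap

/-! ### Splitting of past and future -/

section Splitting

variable {Ω : Type*} [MeasurableSpace Ω] {ℙ : Measure Ω} {n : ℕ}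

/-- The subspaces `L` and `U` are conditionally orthogonal given the orthonormal vector `x`. -/
def IsSplitting (x : Fin n → RV ℙ) (L U : ClosedSubmodule ℝ (RV ℙ)) : Prop :=
  ∀ h ∈ L, ∀ k ∈ U, inner ℝ h k = ∑ i, inner ℝ h (x i) * inner ℝ k (x i)

theorem IsSplitting.mono {x : Fin n → RV ℙ} {L L' U U' : ClosedSubmodule ℝ (RV ℙ)}
    (h : IsSplitting x L U) (hL : L' ≤ L) (hU : U' ≤ U) : IsSplitting x L' U' :=
  fun v hv w hw => h v (hL hv) w (hU hw)

theorem IsSplitting.symm {x : Fin n → RV ℙ} {L U : ClosedSubmodule ℝ (RV ℙ)}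
    (h : IsSplitting x L U) : IsSplitting x U L := fun v hv w hw => by
  rw [real_inner_comm, h w hw v hv]
  exact Finset.sum_congr rfl fun i _ => mul_comm _ _

variable {x : Fin n → RV ℙ} {L U : ClosedSubmodule ℝ (RV ℙ)}

/-- Splitting extends to estimation errors, `x` being orthonormal. -/
theorem IsSplitting.inner_error (h : IsSplitting x L U) (hx : covMat x x = 1) (j : Fin n)
    {k : RV ℙ} (hk : k ∈ U) :
    inner ℝ k (x j - estimate L x j) =
      ∑ i, covMat (x - estimate L x) (x - estimate L x) j i * inner ℝ k (x i) := by
  have h1 : ∀ i, inner ℝ (x j) (x i) = (1 : Matrix (Fin n) (Fin n) ℝ) j i := fun i =>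
    congrFun (congrFun hx j) i
  rw [covMat_sub_estimate, inner_sub_right, real_inner_comm (estimate L x j),
    h _ (estimate_mem L x j) k hk]
  simp only [covMat, Matrix.of_apply, Pi.sub_apply, inner_sub_left, h1, sub_mul,
    Finset.sum_sub_distrib]
  simp [Matrix.one_apply]

/-- If no combination of the components of `x` lies in `L`, then `L` and `U` are in direct sum, with
a continuous oblique projection onto `L` along `U`. Hence nothing of `L` is gained by adjoining `U`
to a subspace of `L`. -/
theorem IsSplitting.sup_inf_le (h : IsSplitting x L U) (hx : covMat x x = 1)
    (hQ : (covMat (x - estimate L x) (x - estimate L x)).PosDef) {V : ClosedSubmodule ℝ (RV ℙ)}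
    (hV : V ≤ L) : (V ⊔ U) ⊓ L ≤ V := by
  set Q := covMat (x - estimate L x) (x - estimate L x)
  have hQu : Q⁻¹ * Q = 1 := Matrix.nonsing_inv_mul _ (isUnit_iff_ne_zero.2 hQ.det_pos.ne')
  -- `π` is the identity on `L` and kills `U`: for `v ∈ U` the projection of `v` on `L` is
  -- `∑ ⟪v, xᵢ⟫ x̂ᵢ`, and `⟪v, x - x̂⟫ = Q ⟪v, x⟫`
  set π : RV ℙ →L[ℝ] RV ℙ := L.toSubmodule.starProjection -
    ∑ i, ∑ j, Q⁻¹ i j • (innerSL ℝ (x j - estimate L x j)).smulRight (estimate L x i)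
  have hπ : ∀ v, π v = L.toSubmodule.starProjection v -
      ∑ i, (∑ j, Q⁻¹ i j * inner ℝ v (x j - estimate L x j)) • estimate L x i := fun v => by
    simp only [π, _root_.sub_apply, _root_.sum_apply,
      _root_.smul_apply, ContinuousLinearMap.smulRight_apply, innerSL_apply_apply, Finset.sum_smul,
      smul_smul, real_inner_comm v]
  have hπL : ∀ v ∈ L, π v = v := fun v hv => by
    rw [hπ, Submodule.starProjection_eq_self_iff.2 hv]
    simp [inner_sub_estimate x _ hv]
  have hπU : ∀ v ∈ U, π v = 0 := fun v hv => by
    have h1 : L.toSubmodule.starProjection v = ∑ i, inner ℝ v (x i) • estimate L x i := by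
      refine Submodule.eq_starProjection_of_mem_of_inner_eq_zero
        (L.toSubmodule.sum_mem fun i _ => L.toSubmodule.smul_mem _ (estimate_mem L x i))
        fun w hw => ?_
      rw [inner_sub_left, real_inner_comm, h w hw v hv, sum_inner, sub_eq_zero]
      refine Finset.sum_congr rfl fun i _ => ?_
      have := inner_sub_estimate x i hw
      rw [inner_sub_right, sub_eq_zero] at this
      rw [real_inner_smul_left, real_inner_comm w, this, mul_comm]
    have h2 : ∀ i, ∑ j, Q⁻¹ i j * inner ℝ v (x j - estimate L x j) = inner ℝ v (x i) := fun i => by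
      simp only [h.inner_error hx _ hv, Finset.mul_sum, ← mul_assoc]
      rw [Finset.sum_comm]
      simp only [← Finset.sum_mul]
      change ∑ k, (∑ j, Q⁻¹ i j * Q j k) * inner ℝ v (x k) = _
      simp only [← Matrix.mul_apply, hQu]
      simp [Matrix.one_apply]
    rw [hπ, h1]
    simp [h2]
  have hle : V ⊔ U ≤ ClosedSubmodule.comap π V := by
    refine sup_le (fun v hv => ?_) fun v hv => ?_
    · rw [ClosedSubmodule.mem_comap, hπL v (hV hv)]; exact hv
    · rw [ClosedSubmodule.mem_comap, hπU v hv]; exact zero_mem V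
  intro w hw
  have := hle hw.1
  rwa [ClosedSubmodule.mem_comap, hπL w hw.2] at this

/-- The two-filter formula: combination of the estimates on two conditionally orthogonal families of
data. -/
theorem IsSplitting.estimate_sup (h : IsSplitting x L U) (hx : covMat x x = 1)
    {Q₁ Q₂ Q : Matrix (Fin n) (Fin n) ℝ}
    (h₁ : covMat (x - estimate L x) (x - estimate L x) = Q₁)
    (h₂ : covMat (x - estimate U x) (x - estimate U x) = Q₂)
    (hQ : covMat (x - estimate (L ⊔ U) x) (x - estimate (L ⊔ U) x) = Q)
    (hp₁ : Q₁.PosDef) (hp₂ : Q₂.PosDef) :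
    Q.PosDef ∧ estimate (L ⊔ U) x = Q ⊛ (Q₁⁻¹ ⊛ estimate L x + Q₂⁻¹ ⊛ estimate U x) ∧
      Q⁻¹ = Q₁⁻¹ + Q₂⁻¹ - 1 := by
  have hinv₁ : Q₁⁻¹ * Q₁ = 1 := Matrix.nonsing_inv_mul _ (isUnit_iff_ne_zero.2 hp₁.det_pos.ne')
  have hinv₂ : Q₂⁻¹ * Q₂ = 1 := Matrix.nonsing_inv_mul _ (isUnit_iff_ne_zero.2 hp₂.det_pos.ne')
  have hcov : ∀ K : ClosedSubmodule ℝ (RV ℙ), covMat (estimate K x) x =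
      1 - covMat (x - estimate K x) (x - estimate K x) := fun K => by
    rw [covMat_sub_estimate, covMat_sub_left, hx, sub_sub_cancel]
  have hcov₁ := hcov L
  have hcov₂ := hcov U
  rw [h₁] at hcov₁
  rw [h₂] at hcov₂
  have hcovs : ∀ K : ClosedSubmodule ℝ (RV ℙ),
      covMat (estimate K x) (estimate K x) = covMat (estimate K x) x := fun K => by
    ext i j
    have := inner_sub_estimate x j (estimate_mem K x i)
    rw [inner_sub_right, sub_eq_zero] at this
    exact this.symm
  -- `Q₁ = 1 - P` with `P ≥ 0`, and `(1 - P)⁻¹ = 1 + P + P (1 - P)⁻¹ P ≥ 1`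
  have hone : ((Q₁)⁻¹ - 1).PosSemidef := by
    set P := covMat (estimate L x) (estimate L x)
    have hP : P = 1 - Q₁ := by rw [← hcov₁, ← hcovs]
    have hPs : P.PosSemidef := posSemidef_covMat _
    have hPt : Pᴴ = P := hPs.isHermitian
    have e : Q₁⁻¹ - 1 = P + P * Q₁⁻¹ * Pᴴ := by
      have hr : Q₁ * Q₁⁻¹ = 1 := Matrix.mul_nonsing_inv _ (isUnit_iff_ne_zero.2 hp₁.det_pos.ne')
      rw [hPt, hP]
      simp only [Matrix.sub_mul, Matrix.mul_sub, Matrix.one_mul, Matrix.mul_one, hr, hinv₁]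
      abel
    rw [e]
    exact hPs.add (hp₁.inv.posSemidef.mul_mul_conjTranspose_same P)
  have hG : (Q₁⁻¹ + Q₂⁻¹ - 1).PosDef := by
    have : Q₁⁻¹ + Q₂⁻¹ - 1 = Q₂⁻¹ + (Q₁⁻¹ - 1) := by abel
    rw [this]
    exact hp₂.inv.add_posSemidef hone
  set G := Q₁⁻¹ + Q₂⁻¹ - 1
  have hGi : G⁻¹ * G = 1 := Matrix.nonsing_inv_mul _ (isUnit_iff_ne_zero.2 hG.det_pos.ne')
  set z := G⁻¹ ⊛ (Q₁⁻¹ ⊛ estimate L x + Q₂⁻¹ ⊛ estimate U x)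
  have hz : z = (G⁻¹ * Q₁⁻¹) ⊛ estimate L x + (G⁻¹ * Q₂⁻¹) ⊛ estimate U x := by
    simp only [z, matAct_add, matAct_mul]
  -- covariances of the combined estimate with a vector of one of the two families
  have key : ∀ (L U : ClosedSubmodule ℝ (RV ℙ)) (Q₁ Q₂ : Matrix (Fin n) (Fin n) ℝ),
      IsSplitting x L U → Q₂⁻¹ * Q₂ = 1 → covMat (estimate U x) x = 1 - Q₂ →
      G = Q₁⁻¹ + Q₂⁻¹ - 1 → ∀ w ∈ L, ∀ i,
        inner ℝ w (((G⁻¹ * Q₁⁻¹) ⊛ estimate L x + (G⁻¹ * Q₂⁻¹) ⊛ estimate U x) i) =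
          inner ℝ w (x i) := by
    intro L U Q₁ Q₂ h hinv₂ hcov₂ hGe w hw i
    have e1 : covMat (estimate L x) (fun _ : Fin 1 => w) = covMat x (fun _ : Fin 1 => w) := by
      ext i j
      have := inner_sub_estimate x i hw
      rw [inner_sub_right, sub_eq_zero] at this
      change inner ℝ (estimate L x i) w = inner ℝ (x i) w
      rw [real_inner_comm w, real_inner_comm w, this]
    have e2 : covMat (estimate U x) (fun _ : Fin 1 => w) =
        (1 - Q₂) * covMat x (fun _ : Fin 1 => w) := by
      ext i j
      rw [← hcov₂, Matrix.mul_apply]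
      change inner ℝ (estimate U x i) w = ∑ k, inner ℝ (estimate U x i) (x k) * inner ℝ (x k) w
      rw [real_inner_comm, h w hw _ (estimate_mem U x i)]
      exact Finset.sum_congr rfl fun k _ => by rw [mul_comm, real_inner_comm w]
    have e3 : G⁻¹ * Q₁⁻¹ + G⁻¹ * Q₂⁻¹ * (1 - Q₂) = 1 := by
      rw [Matrix.mul_assoc, ← Matrix.mul_add, Matrix.mul_sub, Matrix.mul_one, hinv₂,
        ← add_sub_assoc, ← hGe, hGi]
    have e4 : covMat ((G⁻¹ * Q₁⁻¹) ⊛ estimate L x + (G⁻¹ * Q₂⁻¹) ⊛ estimate U x)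
        (fun _ : Fin 1 => w) = covMat x (fun _ : Fin 1 => w) := by
      rw [covMat_add_left, covMat_matAct_left, covMat_matAct_left, e1, e2, ← Matrix.mul_assoc,
        ← Matrix.add_mul, e3, Matrix.one_mul]
    have := congrFun (congrFun e4 i) 0
    rw [real_inner_comm, real_inner_comm (x i)]
    exact this
  have hLz := key L U Q₁ Q₂ h hinv₂ hcov₂ rfl
  have hUz := key U L Q₂ Q₁ h.symm hinv₁ hcov₁ (by simp only [G]; abel)
  have hzmem : ∀ i, z i ∈ L ⊔ U := fun i => by
    rw [hz]
    exact (L ⊔ U).toSubmodule.add_mem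
      ((le_sup_left : L ≤ L ⊔ U) (matAct_mem _ (estimate_mem L x) i))
      ((le_sup_right : U ≤ L ⊔ U) (matAct_mem _ (estimate_mem U x) i))
  have hest : estimate (L ⊔ U) x = z := by
    refine estimate_eq_of_inner_eq_zero hzmem fun i w hw => ?_
    have hle : L ⊔ U ≤ orthTo (x i - z i) := by
      refine sup_le (fun w hw => mem_orthTo.2 ?_) fun w hw => mem_orthTo.2 ?_
      · rw [real_inner_comm, inner_sub_right, hz, hLz w hw, sub_self]
      · rw [real_inner_comm, inner_sub_right, hz, add_comm, hUz w hw, sub_self]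
    rw [real_inner_comm]
    exact mem_orthTo.1 (hle hw)
  have hQG : Q = G⁻¹ := by
    rw [← hQ, covMat_sub_estimate, hest, hz, covMat_sub_left, covMat_add_left, covMat_matAct_left,
      covMat_matAct_left, hcov₁, hcov₂, hx, Matrix.mul_sub, Matrix.mul_sub, Matrix.mul_assoc _ _ Q₁,
      Matrix.mul_assoc _ _ Q₂, hinv₁, hinv₂]
    have : Q₁⁻¹ + Q₂⁻¹ = G + 1 := by simp only [G]; abel
    simp only [Matrix.mul_one]
    calc 1 - (G⁻¹ * Q₁⁻¹ - G⁻¹ + (G⁻¹ * Q₂⁻¹ - G⁻¹))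
        = 1 - (G⁻¹ * (Q₁⁻¹ + Q₂⁻¹) - G⁻¹ - G⁻¹) := by rw [Matrix.mul_add]; abel
      _ = G⁻¹ := by rw [this, Matrix.mul_add, hGi, Matrix.mul_one]; abel
  refine ⟨hQG ▸ hG.inv, by rw [hest, hQG], ?_⟩
  rw [hQG, Matrix.nonsing_inv_nonsing_inv _ (isUnit_iff_ne_zero.2 hG.det_pos.ne')]

/-- Less data give larger errors. -/
theorem posDef_errCov_mono {K : ClosedSubmodule ℝ (RV ℙ)} (hK : K ≤ L)
    (h : (covMat (x - estimate L x) (x - estimate L x)).PosDef) :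
    (covMat (x - estimate K x) (x - estimate K x)).PosDef := by
  refine posDef_covMat_iff.2 fun v hv => posDef_covMat_iff.1 h v ?_
  -- a combination of the components of `x` that lies in `K` lies in `L`
  have h1 : ∑ i, v i • x i ∈ L := hK (by
    have : ∑ i, v i • x i = ∑ i, v i • estimate K x i := by
      rw [← sub_eq_zero, ← Finset.sum_sub_distrib, ← hv]
      exact Finset.sum_congr rfl fun i _ => by rw [Pi.sub_apply, smul_sub]
    rw [this]
    exact K.toSubmodule.sum_mem fun i _ => K.toSubmodule.smul_mem _ (estimate_mem K x i))
  have h2 := Submodule.starProjection_eq_self_iff.2 h1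
  rw [map_sum] at h2
  simp only [map_smul] at h2
  simp only [Pi.sub_apply, smul_sub, Finset.sum_sub_distrib]
  rw [sub_eq_zero, ← h2]
  rfl

end Splitting

section CoreSplitting

variable {Ω : Type*} [MeasurableSpace Ω] {ℙ : Measure Ω} {n m p : ℕ}
  {S : LinModel n m p} {T : ℝ} {x : ℝ → Fin n → RV ℙ} {y : ℝ → Fin m → RV ℙ} {t : ℝ}

namespace Core

/-- Given the present state, the past and the future increments of the output are conditionally
orthogonal. -/
theorem isSplitting (h : Core S T x y) (ht : 0 ≤ t) :
    IsSplitting (x t) (pastSpace S T x y t) (incrSpace y t T) := by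
  intro v hv k hk
  have hle : incrSpace y t T ≤ orthTo (v - ∑ i, inner ℝ v (x t i) • x t i) := by
    refine incrSpace_le fun s hs s' hs' k => mem_orthTo.2 ?_
    have hcov : ∀ j i, inner ℝ (x t j) (x t i) = (1 : Matrix (Fin n) (Fin n) ℝ) j i :=
      fun j i => h.cov_state t ⟨ht, hs.1.trans hs.2⟩ j i
    -- covariances of the future increments with the past only depend on the present state
    have h1 : ∀ w ∈ pastSpace S T x y t, inner ℝ w (y s' k - y s k) =
        ∑ i, (gapC S t s' k i - gapC S t s k i) * inner ℝ w (x t i) := fun w hw => by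
      rw [← sub_sub_sub_cancel_right (y s' k) (y s k) (y t k), inner_sub_right,
        h.inner_output_of_mem_past hw hs'.1 hs'.2, h.inner_output_of_mem_past hw hs.1 hs.2,
        ← Finset.sum_sub_distrib]
      exact Finset.sum_congr rfl fun i _ => (sub_mul _ _ _).symm
    rw [inner_sub_left, h1 v hv, sum_inner, sub_eq_zero]
    refine Finset.sum_congr rfl fun i _ => ?_
    rw [real_inner_smul_left, h1 _ (h.state_mem ht le_rfl i)]
    simp only [real_inner_comm (x t i), hcov]
    simp [Matrix.one_apply, mul_comm]
  have h2 := mem_orthTo.1 (hle hk)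
  rw [inner_sub_left, sum_inner, sub_eq_zero] at h2
  rw [h2]
  exact Finset.sum_congr rfl fun i _ => by rw [real_inner_smul_left, real_inner_comm k]

theorem isSplitting_incrSpace (h : Core S T x y) (ht : 0 ≤ t) :
    IsSplitting (x t) (incrSpace y 0 t) (incrSpace y t T) :=
  (h.isSplitting ht).mono (h.incrSpace_le_past le_rfl) le_rfl

/-- Even the whole past of the output does not determine any component of the state. -/
theorem posDef_errCov_past (h : Core S T x y) (hT : 0 ≤ T) (ht : t ∈ Icc 0 T) :
    (covMat (x t - estimate (incrSpace y 0 t) (x t))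
      (x t - estimate (incrSpace y 0 t) (x t))).PosDef := by
  obtain ⟨Q, hQc, hQ0, hQs, hQ⟩ := h.exists_riccati (Q₀ := 1) Matrix.PosSemidef.one (a := 0) hT
  have hbot : estimate (⊥ : ClosedSubmodule ℝ (RV ℙ)) (x 0) = 0 :=
    estimate_eq_of_inner_eq_zero (fun i => zero_mem _) fun i w hw => by
      rw [ClosedSubmodule.mem_bot.1 hw, inner_zero_left]
  obtain ⟨z, -, hz, -⟩ := h.kalman le_rfl hT le_rfl bot_le hQc hQs hQ
    (by rw [hbot, sub_zero, h.covMat_state ⟨le_rfl, hT⟩, hQ0])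
  obtain ⟨h1, h2, h3⟩ := hz t ht
  rw [bot_sup_eq] at h1
  rw [h1, h2]
  exact h3 (hQ0 ▸ Matrix.PosDef.one)

/-- Output increments after `t` add nothing to what a family of past data says about the past. -/
theorem sup_inf_le (h : Core S T x y) (hT : 0 ≤ T) (ht : t ∈ Icc 0 T)
    {V : ClosedSubmodule ℝ (RV ℙ)} (hV : V ≤ incrSpace y 0 t) :
    (V ⊔ incrSpace y t T) ⊓ incrSpace y 0 t ≤ V :=
  (h.isSplitting_incrSpace ht.1).sup_inf_le (h.covMat_state ht) (h.posDef_errCov_past hT ht) hV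

end Core
end CoreSplitting

/-! ### Spaces of observed data -/

section Patterns

variable {T : ℝ} (O : ObsPattern T)

namespace ObsPattern

theorem left_lt_right (i : Fin O.N) : O.left i < O.right i := O.strictMono Fin.castSucc_lt_succ

theorem left_nonneg (i : Fin O.N) : 0 ≤ O.left i := by
  rw [← O.first]; exact O.strictMono.monotone (Fin.zero_le _)

theorem right_le (i : Fin O.N) : O.right i ≤ T := by
  exact (O.strictMono.monotone (Fin.le_last _)).trans O.last.le

theorem right_le_left {i j : Fin O.N} (h : i < j) : O.right i ≤ O.left j :=
  O.strictMono.monotone (Fin.succ_le_castSucc_iff.2 h)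

theorem exists_mem_Icc (hT : 0 < T) {t : ℝ} (ht : t ∈ Icc 0 T) :
    ∃ i, t ∈ Icc (O.left i) (O.right i) := by
  have hN : 0 < O.N := by
    rcases Nat.eq_zero_or_pos O.N with h | h
    · have h0 := O.first
      have h1 := O.last
      have : (Fin.last O.N) = 0 := by ext; simp [h]
      rw [this, h0] at h1
      exact absurd h1 hT.ne
    · exact h
  have key : ∀ k, t ≤ O.τ k → ∃ i, t ∈ Icc (O.left i) (O.right i) := by
    intro k
    induction k using Fin.induction with
    | zero =>
      intro h
      exact ⟨⟨0, hN⟩, O.first.le.trans ht.1, h.trans (O.strictMono.monotone (Fin.zero_le _))⟩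
    | succ i ih =>
      intro h
      rcases le_total t (O.τ i.castSucc) with h1 | h1
      · exact ih h1
      · exact ⟨i, h1, h⟩
  exact key (Fin.last _) (ht.2.trans O.last.ge)

end ObsPattern

variable {Ω : Type*} [MeasurableSpace Ω] {ℙ : Measure Ω} {m : ℕ} {y : ℝ → Fin m → RV ℙ}

theorem modeSpace_le_incrSpace {a b : ℝ} (hab : a ≤ b) (o : ObsMode) :
    modeSpace y a b o ≤ incrSpace y a b := by
  cases o with
  | full => exact le_rfl
  | increment =>
    exact span_closure_le fun k => mem_incrSpace (left_mem_Icc.2 hab) (right_mem_Icc.2 hab) k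
  | lost => exact bot_le

theorem incrSpace_le_sup {a t b : ℝ} (hat : a ≤ t) (htb : t ≤ b) :
    incrSpace y a b ≤ incrSpace y a t ⊔ incrSpace y t b := by
  set V := incrSpace y a t ⊔ incrSpace y t b
  have h1 : ∀ s ∈ Icc a b, ∀ k, y s k - y t k ∈ V := fun s hs k => by
    rcases le_total s t with h | h
    · exact (le_sup_left : incrSpace y a t ≤ V) (mem_incrSpace ⟨hat, le_rfl⟩ ⟨hs.1, h⟩ k)
    · exact (le_sup_right : incrSpace y t b ≤ V) (mem_incrSpace ⟨le_rfl, htb⟩ ⟨h, hs.2⟩ k)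
  refine incrSpace_le fun s hs s' hs' k => ?_
  rw [← sub_sub_sub_cancel_right _ _ (y t k)]
  exact V.toSubmodule.sub_mem (h1 s' hs' k) (h1 s hs k)

theorem modeSpace_le_obsSpace (i : Fin O.N) :
    modeSpace y (O.left i) (O.right i) (O.mode i) ≤ obsSpace O y :=
  le_iSup (fun i => modeSpace y (O.left i) (O.right i) (O.mode i)) i

theorem modeSpace_le_obsPast {i : Fin O.N} {t : ℝ} (h : O.right i ≤ t) :
    modeSpace y (O.left i) (O.right i) (O.mode i) ≤ obsPast O y t :=
  le_inf (modeSpace_le_obsSpace O i) ((modeSpace_le_incrSpace (O.left_lt_right i).le _).trans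
    (incrSpace_mono (Icc_subset_Icc (O.left_nonneg i) h)))

theorem modeSpace_le_obsFuture {i : Fin O.N} {t : ℝ} (h : t ≤ O.left i) :
    modeSpace y (O.left i) (O.right i) (O.mode i) ≤ obsFuture O y t :=
  le_inf (modeSpace_le_obsSpace O i) ((modeSpace_le_incrSpace (O.left_lt_right i).le _).trans
    (incrSpace_mono (Icc_subset_Icc h (O.right_le i))))

theorem obsPast_mono {s t : ℝ} (h : s ≤ t) : obsPast O y s ≤ obsPast O y t :=
  inf_le_inf_left _ (incrSpace_mono (Icc_subset_Icc_right h))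

theorem obsFuture_anti {s t : ℝ} (h : s ≤ t) : obsFuture O y t ≤ obsFuture O y s :=
  inf_le_inf_left _ (incrSpace_mono (Icc_subset_Icc_left h))

/-- The data are those before, in and after the `i`-th interval. -/
theorem obsSpace_le_sup (i : Fin O.N) :
    obsSpace O y ≤ obsPast O y (O.left i) ⊔ modeSpace y (O.left i) (O.right i) (O.mode i) ⊔
      obsFuture O y (O.right i) := by
  refine iSup_le fun j => ?_
  rcases lt_trichotomy j i with h | rfl | h
  · exact (modeSpace_le_obsPast O (O.right_le_left h)).trans (le_sup_left.trans le_sup_left)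
  · exact le_sup_right.trans le_sup_left
  · exact (modeSpace_le_obsFuture O (O.right_le_left h)).trans le_sup_right

/-- Observed past and observed future exhaust the data at every time that does not cut a gap over
which the increment of the output is known. -/
theorem obsPast_sup_obsFuture (hT : 0 < T) {t : ℝ} (ht : t ∈ Icc 0 T)
    (h : ∀ i, O.mode i = .increment → t ∉ Ioo (O.left i) (O.right i)) :
    obsPast O y t ⊔ obsFuture O y t = obsSpace O y := by
  refine le_antisymm (sup_le inf_le_left inf_le_left) ?_
  obtain ⟨i, hi⟩ := O.exists_mem_Icc hT ht
  refine (obsSpace_le_sup O i).trans (sup_le (sup_le ((obsPast_mono O hi.1).trans le_sup_left) ?_)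
    ((obsFuture_anti O hi.2).trans le_sup_right))
  have hm := modeSpace_le_obsSpace (y := y) O i
  by_cases h1 : t = O.left i
  · exact (modeSpace_le_obsFuture O h1.le).trans le_sup_right
  by_cases h2 : t = O.right i
  · exact (modeSpace_le_obsPast O h2.ge).trans le_sup_left
  cases hmode : O.mode i with
  | full =>
    rw [hmode] at hm
    refine (incrSpace_le_sup hi.1 hi.2).trans (sup_le_sup (le_inf ?_ ?_) (le_inf ?_ ?_))
    · exact (incrSpace_mono (Icc_subset_Icc_right hi.2)).trans hm
    · exact incrSpace_mono (Icc_subset_Icc_left (O.left_nonneg i))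
    · exact (incrSpace_mono (Icc_subset_Icc_left hi.1)).trans hm
    · exact incrSpace_mono (Icc_subset_Icc_right (O.right_le i))
  | increment => exact absurd ⟨lt_of_le_of_ne hi.1 (Ne.symm h1), lt_of_le_of_ne hi.2 h2⟩ (h i hmode)
  | lost => exact bot_le

theorem obsPast_zero : obsPast O y 0 = ⊥ := by
  refine le_bot_iff.1 (inf_le_right.trans (incrSpace_le fun s hs t ht k => ?_))
  rw [Icc_self, mem_singleton_iff] at hs ht
  rw [hs, ht, sub_self]
  exact zero_mem _

end Patterns

section Recursion

variable {Ω : Type*} [MeasurableSpace Ω] {ℙ : Measure Ω} {n m p : ℕ}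
  {S : LinModel n m p} {T : ℝ} {x : ℝ → Fin n → RV ℙ} {y : ℝ → Fin m → RV ℙ} {t : ℝ}

namespace Core

variable (O : ObsPattern T) {i : Fin O.N}

theorem obsPast_le_past (h : Core S T x y) : obsPast O y t ≤ pastSpace S T x y t :=
  inf_le_right.trans (h.incrSpace_le_past le_rfl)

/-- Data whose past part is `V` and whose remaining part lies in the future. -/
theorem obsPast_eq_of_le_sup (h : Core S T x y) (hT : 0 ≤ T) (ht : t ∈ Icc 0 T)
    {V : ClosedSubmodule ℝ (RV ℙ)} (hV : V ≤ obsPast O y t)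
    (hle : obsSpace O y ≤ V ⊔ incrSpace y t T) : obsPast O y t = V :=
  le_antisymm ((inf_le_inf_right _ hle).trans (h.sup_inf_le hT ht (hV.trans inf_le_right))) hV

theorem obsFuture_le {s : ℝ} (hts : t ≤ s) : obsFuture O y s ≤ incrSpace y t T :=
  inf_le_right.trans (incrSpace_mono (Icc_subset_Icc_left hts))

theorem mem_Icc_of_mem (ht : t ∈ Icc (O.left i) (O.right i)) : t ∈ Icc 0 T :=
  ⟨(O.left_nonneg i).trans ht.1, ht.2.trans (O.right_le i)⟩

theorem obsPast_full (h : Core S T x y) (hT : 0 ≤ T) (hi : O.mode i = .full)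
    (ht : t ∈ Icc (O.left i) (O.right i)) :
    obsPast O y t = obsPast O y (O.left i) ⊔ incrSpace y (O.left i) t := by
  have hm := modeSpace_le_obsSpace (y := y) O i
  have hle := obsSpace_le_sup (y := y) O i
  rw [hi] at hm hle
  refine h.obsPast_eq_of_le_sup O hT (mem_Icc_of_mem O ht) (sup_le (obsPast_mono O ht.1)
    (le_inf ((incrSpace_mono (Icc_subset_Icc_right ht.2)).trans hm)
      (incrSpace_mono (Icc_subset_Icc_left (O.left_nonneg i))))) (hle.trans ?_)
  refine sup_le (sup_le (le_sup_left.trans le_sup_left) ((incrSpace_le_sup ht.1 ht.2).trans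
    (sup_le_sup le_sup_right (incrSpace_mono (Icc_subset_Icc_right (O.right_le i))))))
    ((obsFuture_le O ht.2).trans le_sup_right)

theorem obsPast_lost (h : Core S T x y) (hT : 0 ≤ T) (hi : O.mode i = .lost)
    (ht : t ∈ Icc (O.left i) (O.right i)) : obsPast O y t = obsPast O y (O.left i) := by
  have hle := obsSpace_le_sup (y := y) O i
  rw [hi] at hle
  refine h.obsPast_eq_of_le_sup O hT (mem_Icc_of_mem O ht) (obsPast_mono O ht.1) (hle.trans ?_)
  exact sup_le (sup_le le_sup_left bot_le) ((obsFuture_le O ht.2).trans le_sup_right)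

theorem obsPast_increment_right (h : Core S T x y) (hT : 0 ≤ T) (hi : O.mode i = .increment) :
    obsPast O y (O.right i) = obsPast O y (O.left i) ⊔
      (Submodule.span ℝ (range fun k => y (O.right i) k - y (O.left i) k)).closure := by
  have hle := obsSpace_le_sup (y := y) O i
  have hm := modeSpace_le_obsPast (y := y) O (le_refl (O.right i))
  rw [hi] at hle hm
  refine h.obsPast_eq_of_le_sup O hT ⟨(O.left_nonneg i).trans (O.left_lt_right i).le, O.right_le i⟩
    (sup_le (obsPast_mono O (O.left_lt_right i).le) hm) (hle.trans ?_)
  exact sup_le_sup le_rfl (obsFuture_le O le_rfl)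

theorem posDef_increment (h : Core S T x y) {s t : ℝ} (hs : 0 ≤ s) (hst : s < t) (ht : t ≤ T) :
    (covMat (y t - y s) (y t - y s)).PosDef := by
  set Cd := gapC S s t
  set η := y t - y s - Cd ⊛ x s
  have hη : covMat (x s) η = 0 := by
    ext i j
    exact h.inner_gapNoise_of_mem_past hst.le ht (h.state_mem hs le_rfl i) (Sum.inr j)
  have hη' : covMat η (x s) = 0 := by rw [← transpose_covMat, hη, Matrix.transpose_zero]
  have hy : y t - y s = η + Cd ⊛ x s := by simp only [η]; abel
  have hηη : covMat η η = gapDD S s t := h.covMat_gapNoise_output hs hst.le ht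
  have hcov : covMat (y t - y s) (y t - y s) = gapDD S s t + Cd * Cdᵀ := by
    rw [hy, covMat_add_left, covMat_add_right, covMat_add_right, covMat_matAct_left,
      covMat_matAct_left, covMat_matAct_right, covMat_matAct_right,
      h.covMat_state ⟨hs, hst.le.trans ht⟩, hη, hη', hηη]
    simp
  rw [hcov]
  exact (h.posDef_gapDD hs hst ht).add_posSemidef
    (by simpa using Matrix.posSemidef_self_mul_conjTranspose Cd)

/-- The increment of the output over a gap contributes to the observed past only at the end of the
gap: a combination of its components that is already known before has no noise after `t`, hence
vanishes. -/
theorem obsPast_increment (h : Core S T x y) (hT : 0 ≤ T) (hi : O.mode i = .increment)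
    (ht : t ∈ Ico (O.left i) (O.right i)) : obsPast O y t = obsPast O y (O.left i) := by
  have htI : t ∈ Icc 0 T := mem_Icc_of_mem O ⟨ht.1, ht.2.le⟩
  refine le_antisymm (fun w hw => ?_) (obsPast_mono O ht.1)
  set b := O.right i
  set a := O.left i
  set V := obsPast O y a
  have hwb : w ∈ obsPast O y b := obsPast_mono O ht.2.le hw
  rw [h.obsPast_increment_right O hT hi] at hwb
  have hclosed : IsClosed ((V.toSubmodule ⊔ Submodule.span ℝ (range fun k => y b k - y a k) :
      Submodule ℝ (RV ℙ)) : Set (RV ℙ)) :=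
    have : FiniteDimensional ℝ (Submodule.span ℝ (range fun k => y b k - y a k)) :=
      FiniteDimensional.span_of_finite ℝ (finite_range _)
    Submodule.isClosed_sup_finiteDimensional _ _ V.isClosed
  have hwb' : w ∈ V.toSubmodule ⊔ Submodule.span ℝ (range fun k => y b k - y a k) := by
    have : V ⊔ (Submodule.span ℝ (range fun k => y b k - y a k)).closure ≤
        ⟨V.toSubmodule ⊔ Submodule.span ℝ (range fun k => y b k - y a k), hclosed⟩ :=
      sup_le (fun v hv => Submodule.mem_sup_left hv)
        (Submodule.closure_le.2 fun v hv => Submodule.mem_sup_right hv)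
    exact this hwb
  obtain ⟨v, hv, d, hd, rfl⟩ := Submodule.mem_sup.1 hwb'
  obtain ⟨c, rfl⟩ := (Submodule.mem_span_range_iff_exists_fun ℝ).1 hd
  have hVt : V ≤ incrSpace y 0 t := (obsPast_mono O ht.1).trans inf_le_right
  have hsplit : ∑ k, c k • (y b k - y a k) =
      ∑ k, c k • (y b k - y t k) + ∑ k, c k • (y t k - y a k) := by
    rw [← Finset.sum_add_distrib]
    exact Finset.sum_congr rfl fun k _ => by rw [← smul_add, sub_add_sub_cancel]
  have hpast : ∑ k, c k • (y b k - y t k) ∈ incrSpace y 0 t := by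
    have h1 : ∑ k, c k • (y t k - y a k) ∈ incrSpace y 0 t :=
      (incrSpace y 0 t).toSubmodule.sum_mem fun k _ => (incrSpace y 0 t).toSubmodule.smul_mem _
        (mem_incrSpace ⟨O.left_nonneg i, ht.1⟩ ⟨htI.1, le_rfl⟩ k)
    have h2 : ∑ k, c k • (y b k - y t k) =
        v + ∑ k, c k • (y b k - y a k) - v - ∑ k, c k • (y t k - y a k) := by
      rw [hsplit]; abel
    rw [h2]
    exact (incrSpace y 0 t).toSubmodule.sub_mem
      ((incrSpace y 0 t).toSubmodule.sub_mem hw.2 (hVt hv)) h1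
  have hfut : ∑ k, c k • (y b k - y t k) ∈ incrSpace y t T :=
    (incrSpace y t T).toSubmodule.sum_mem fun k _ => (incrSpace y t T).toSubmodule.smul_mem _
      (mem_incrSpace ⟨le_rfl, htI.2⟩ ⟨ht.2.le, O.right_le i⟩ k)
  have hzero : ∑ k, c k • (y b k - y t k) = 0 :=
    ClosedSubmodule.mem_bot.1 (h.sup_inf_le hT htI bot_le
      ⟨(le_sup_right : incrSpace y t T ≤ ⊥ ⊔ incrSpace y t T) hfut, hpast⟩)
  have hc : c = 0 := by
    have hpos := h.posDef_increment htI.1 ht.2 (O.right_le i)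
    exact posDef_covMat_iff.1 hpos c hzero
  simpa [hc] using hv

end Core
end Recursion

/-! ### The cascade of filters -/

section Cascade

variable {Ω : Type*} [MeasurableSpace Ω] {ℙ : Measure Ω} {n m p : ℕ}

/-- The forward filter on `J`, with the stochastic integral of the gain taken in the sense of
arbitrarily tagged Riemann–Stieltjes sums. The freedom in the choice of the tags makes the notion
compatible with time reversal. -/
structure TaggedFilterOn (S : LinModel n m p) (J : Set ℝ) (y : ℝ → Fin m → RV ℙ)
    (K : ℝ → Matrix (Fin n) (Fin m) ℝ) (z : ℝ → Fin n → RV ℙ) (Q : ℝ → Matrix (Fin n) (Fin n) ℝ) :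
    Prop where
  cont_drift : ∀ i, ContinuousOn (fun τ => ∑ j, (S.A τ - K τ * S.C τ) i j • z τ j) J
  tendsto : ∀ s ∈ J, ∀ t ∈ J, s ≤ t → ∀ i,
    Tendsto (fun P => ∑ k, rsum (fun τ => K τ i k) (fun τ => y τ k) P) (meshFilter s t)
      (𝓝 (z t i - z s i - ∫ τ in s..t, ∑ j, (S.A τ - K τ * S.C τ) i j • z τ j))
  deriv : ∀ t ∈ J, HasMatDeriv Q (S.A t * Q t + Q t * (S.A t)ᵀ - K t * S.R t * (K t)ᵀ +
    S.B t * (S.B t)ᵀ) J t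

/-- The forward cascade with stochastic integrals in the tagged sense. -/
structure TaggedCascade (S : LinModel n m p) {T : ℝ} (O : ObsPattern T)
    (y : ℝ → Fin m → RV ℙ) (z : ℝ → Fin n → RV ℙ) (Q : ℝ → Matrix (Fin n) (Fin n) ℝ) : Prop where
  init_est : z 0 = 0
  init_cov : Q 0 = 1
  full : ∀ i, O.mode i = .full →
    TaggedFilterOn S (Icc (O.left i) (O.right i)) y (forwardGain S Q) z Q
  lost : ∀ i, O.mode i = .lost → TaggedFilterOn S (Icc (O.left i) (O.right i)) y 0 z Q
  increment : ∀ i, O.mode i = .increment →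
    TaggedFilterOn S (Ico (O.left i) (O.right i)) y 0 z Q ∧
    IsUnit (gapInnov S Q (O.left i) (O.right i)) ∧
    GapStep S y z Q (O.left i) (O.right i)

theorem TaggedFilterOn.congr {S : LinModel n m p} {J : Set ℝ} [J.OrdConnected]
    {y : ℝ → Fin m → RV ℙ} {K K' : ℝ → Matrix (Fin n) (Fin m) ℝ} {z z' : ℝ → Fin n → RV ℙ}
    {Q Q' : ℝ → Matrix (Fin n) (Fin n) ℝ} (h : TaggedFilterOn S J y K z Q)
    (hK : ∀ t ∈ J, K' t = K t) (hz : ∀ t ∈ J, z' t = z t) (hQ : ∀ t ∈ J, Q' t = Q t) :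
    TaggedFilterOn S J y K' z' Q' where
  cont_drift i := (h.cont_drift i).congr fun t ht => by simp only [hK t ht, hz t ht]
  tendsto s hs t ht hst i := by
    have hsub : Icc s t ⊆ J := Set.Icc_subset J hs ht
    have e : ∫ τ in s..t, ∑ j, (S.A τ - K' τ * S.C τ) i j • z' τ j =
        ∫ τ in s..t, ∑ j, (S.A τ - K τ * S.C τ) i j • z τ j :=
      intervalIntegral.integral_congr fun τ hτ => by
        rw [uIcc_of_le hst] at hτ
        simp only [hK τ (hsub hτ), hz τ (hsub hτ)]
    rw [e, hz t ht, hz s hs]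
    refine (h.tendsto s hs t ht hst i).congr' ?_
    filter_upwards [eventually_isOn s t one_pos] with P hP
    refine Finset.sum_congr rfl fun k _ => Finset.sum_congr rfl fun l hl => ?_
    simp only [hK _ (hsub (hP.tag_mem (Finset.mem_range.1 hl)))]
  deriv t ht i j := by
    have := (h.deriv t ht i j).congr (fun τ hτ => by rw [hQ τ hτ]) (by rw [hQ t ht])
      (f₁ := fun τ => Q' τ i j)
    rw [hK t ht, hQ t ht]
    exact this

variable {S : LinModel n m p} {T : ℝ} {x : ℝ → Fin n → RV ℙ} {y : ℝ → Fin m → RV ℙ}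

namespace Core

/-- The filter with zero gain on a set of times at which the observed data stay the same. -/
theorem taggedFilterOn_zero (h : Core S T x y) (hT : 0 < T) {a c : ℝ} (ha : 0 ≤ a) (hc : c ≤ T)
    {J : Set ℝ} [J.OrdConnected] (hJ : J ⊆ Icc a c) {Ka : ClosedSubmodule ℝ (RV ℙ)}
    (hKa : Ka ≤ pastSpace S T x y a) :
    TaggedFilterOn S J y 0 (fun t => estimate Ka (x t))
      (fun t => covMat (x t - estimate Ka (x t)) (x t - estimate Ka (x t))) where
  cont_drift i := by
    have h1 := h.contA
    have h2 : ∀ j, Continuous fun t => estimate Ka (x t) j := fun j =>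
      Ka.toSubmodule.starProjection.continuous.comp (h.cont_state j)
    simp only [Pi.zero_apply, Matrix.zero_mul, sub_zero]
    exact (continuous_finsetSum _ fun j _ => (h1.matrix_elem i j).smul (h2 j)).continuousOn
  tendsto s hs t ht hst i := by
    have h1 := h.estimate_state_sub hc hKa (hJ hs).1 hst (hJ ht).2 i
    simp only [Pi.zero_apply, Matrix.zero_mul, sub_zero]
    rw [h1, sub_self]
    refine tendsto_const_nhds.congr fun P => ?_
    simp [rsum]
  deriv t ht := by
    have := (h.hasMatDeriv_errCov hT ha hc hKa (hJ ht)).mono hJ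
    simpa using this

/-- On an interval of full observation the estimates are generated by the Kalman–Bucy filter. -/
theorem taggedFilterOn_full (h : Core S T x y) {a c : ℝ} (ha : 0 ≤ a) (hac : a ≤ c) (hc : c ≤ T)
    {Ka : ClosedSubmodule ℝ (RV ℙ)} (hKa : Ka ≤ pastSpace S T x y a)
    {z : ℝ → Fin n → RV ℙ} {Q : ℝ → Matrix (Fin n) (Fin n) ℝ}
    (hz : ∀ t ∈ Icc a c, z t = estimate (Ka ⊔ incrSpace y a t) (x t))
    (hQ : ∀ t ∈ Icc a c, Q t = covMat (x t - z t) (x t - z t)) :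
    TaggedFilterOn S (Icc a c) y (forwardGain S Q) z Q := by
  obtain ⟨Q', hQc, hQ0, hQs, hQ'⟩ := h.exists_riccati
    (posSemidef_covMat (x a - estimate Ka (x a))) hac
  obtain ⟨z', hz'c, hz', hlim⟩ := h.kalman ha hac hc hKa hQc hQs hQ' hQ0.symm
  have hzz : ∀ t ∈ Icc a c, z t = z' t := fun t ht => (hz t ht).trans (hz' t ht).1
  have hQQ : ∀ t ∈ Icc a c, Q t = Q' t := fun t ht => by
    rw [hQ t ht, hzz t ht, (hz' t ht).2.1]
  have hfil : TaggedFilterOn S (Icc a c) y (forwardGain S Q') z' Q' :=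
    { cont_drift := fun i => by
        have h1 := h.contA
        have h2 := h.contC
        have h3 := h.continuous_forwardGain hQc
        exact (continuous_finsetSum _ fun j _ =>
          ((h1.sub (h3.matrix_mul h2)).matrix_elem i j).smul (hz'c j)).continuousOn
      tendsto := fun s hs t ht hst i => hlim s t hs.1 hst ht.2 i
      deriv := hQ' }
  exact hfil.congr (fun t ht => by simp only [forwardGain, hQQ t ht]) hzz hQQ

/-- The estimates of the state on the observed past are generated by the cascade of filters. -/
theorem taggedCascade (h : Core S T x y) (hT : 0 < T) (O : ObsPattern T) :
    TaggedCascade S O y (forwardEst O x y) (forwardErrCov O x y) := by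
  have hle : ∀ i, obsPast O y (O.left i) ≤ pastSpace S T x y (O.left i) :=
    fun i => h.obsPast_le_past O
  have h0 : forwardEst O x y 0 = 0 := by
    rw [forwardEst, obsPast_zero]
    exact estimate_eq_of_inner_eq_zero (fun i => zero_mem _) fun i w hw => by
      rw [ClosedSubmodule.mem_bot.1 hw, inner_zero_left]
  refine ⟨h0, ?_, fun i hi => ?_, fun i hi => ?_, fun i hi => ⟨?_, ?_⟩⟩
  · rw [forwardErrCov, h0, sub_zero, h.covMat_state ⟨le_rfl, hT.le⟩]
  · exact h.taggedFilterOn_full (O.left_nonneg i) (O.left_lt_right i).le (O.right_le i) (hle i)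
      (fun t ht => by rw [forwardEst, h.obsPast_full O hT.le hi ht]) fun t _ => rfl
  · refine (h.taggedFilterOn_zero hT (O.left_nonneg i) (O.right_le i) subset_rfl (hle i)).congr
      (fun t _ => rfl) (fun t ht => ?_) fun t ht => ?_
    · simp only [forwardEst, h.obsPast_lost O hT.le hi ht]
    · simp only [forwardErrCov, forwardEst, h.obsPast_lost O hT.le hi ht]
  · refine (h.taggedFilterOn_zero hT (O.left_nonneg i) (O.right_le i) Ico_subset_Icc_self
      (hle i)).congr (fun t _ => rfl) (fun t ht => ?_) fun t ht => ?_
    · simp only [forwardEst, h.obsPast_increment O hT.le hi ht]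
    · simp only [forwardErrCov, forwardEst, h.obsPast_increment O hT.le hi ht]
  · exact h.gapStep (O.left_nonneg i) (O.left_lt_right i) (O.right_le i) (hle i) rfl rfl
      (by rw [forwardEst, h.obsPast_increment_right O hT.le hi]) rfl

end Core
end Cascade

/-! ### Time reversal -/

section ReversePartition

/-- The image of a tagged partition under `t ↦ T - t`. -/
def TagPart.rev (T : ℝ) (P : TagPart) : TagPart where
  N := P.N
  u k := T - P.u (P.N - k)
  τ k := T - P.τ (P.N - 1 - k)

theorem TagPart.IsOn.rev {P : TagPart} {a b δ : ℝ} (h : P.IsOn a b δ) (T : ℝ) :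
    (P.rev T).IsOn (T - b) (T - a) δ := by
  have hk : ∀ k < P.N, P.N - k = P.N - 1 - k + 1 ∧ P.N - (k + 1) = P.N - 1 - k ∧
      P.N - 1 - k < P.N := fun k hk => by omega
  refine ⟨fun k l hkl => sub_le_sub_left (h.mono (by omega)) T, ?_, ?_, fun k hkN => ?_,
    fun k hkN => ?_⟩
  · simp [TagPart.rev, h.last]
  · simp [TagPart.rev, h.first]
  · obtain ⟨h1, h2, h3⟩ := hk k hkN
    have := h.mesh _ h3
    simp only [TagPart.rev, h1, h2]
    linarith
  · obtain ⟨h1, h2, h3⟩ := hk k hkN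
    have := h.tag _ h3
    simp only [TagPart.rev, h1, h2]
    exact ⟨by linarith [this.2], by linarith [this.1]⟩

theorem tendsto_rev (T a b : ℝ) :
    Tendsto (TagPart.rev T) (meshFilter a b) (meshFilter (T - b) (T - a)) :=
  ((meshFilter_hasBasis a b).tendsto_iff (meshFilter_hasBasis _ _)).2
    fun δ hδ => ⟨δ, hδ, fun _ hP => TagPart.IsOn.rev hP T⟩

theorem rsum_rev {E : Type*} [NormedAddCommGroup E] [NormedSpace ℝ E] (f : ℝ → ℝ) (z : ℝ → E)
    (T : ℝ) (P : TagPart) :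
    rsum (fun t => f (T - t)) (fun t => z (T - t)) (P.rev T) = -rsum f z P := by
  simp only [rsum, TagPart.rev, sub_sub_cancel]
  rw [← Finset.sum_range_reflect, ← Finset.sum_neg_distrib]
  refine Finset.sum_congr rfl fun k hk => ?_
  rw [Finset.mem_range] at hk
  have h1 : P.N - 1 - (P.N - 1 - k) = k := by omega
  have h2 : P.N - (P.N - 1 - k + 1) = k := by omega
  have h3 : P.N - (P.N - 1 - k) = k + 1 := by omega
  rw [h1, h2, h3, ← smul_neg, neg_sub]

end ReversePartition

section ReflectModel

variable {n m p : ℕ}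

/-- The coefficients, in forward time, of a model that is run backward from time `T`. -/
def LinModel.reflect (S : LinModel n m p) (T : ℝ) : LinModel n m p where
  A t := -S.A (T - t)
  B t := S.B (T - t)
  C t := -S.C (T - t)
  D t := S.D (T - t)

theorem revModel_eq_reflect (S : LinModel n m p) (T : ℝ) :
    revModel S T = (S.backward fun _ => 1).reflect T := by
  simp [revModel, LinModel.reflect, LinModel.backward]

theorem transition_reflect {A : ℝ → Matrix (Fin n) (Fin n) ℝ} (hA : Continuous A) (T t s : ℝ) :
    transition (fun t => -A (T - t)) (T - t) (T - s) = transition A t s := by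
  obtain ⟨X, Y, hXY⟩ := exists_isFundamental hA
  obtain ⟨X', Y', hXY'⟩ := exists_isFundamental (A := fun t => -A (T - t)) (by fun_prop)
  have hZ : ∀ u τ, HasMatDeriv (fun τ => X' (T - τ) * Y' (T - s)) (A τ * (X' (T - τ) * Y' (T - s)))
      u τ := by
    intro u τ i j
    have h1 : HasMatDeriv (fun τ => X' (T - τ)) (A τ * X' (T - τ)) u τ := fun i j => by
      have h2 := ((hXY'.deriv_left univ (T - τ) i j).hasDerivAt univ_mem)
      have h3 := h2.scomp τ ((hasDerivAt_id τ).const_sub T)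
      refine h3.hasDerivWithinAt.congr_deriv ?_
      simp
    have h4 := h1.mul (HasMatDeriv.const (Y' (T - s)))
    rw [Matrix.mul_zero, add_zero, Matrix.mul_assoc] at h4
    exact h4 i j
  have key : Y t * (X' (T - t) * Y' (T - s)) = Y s * (X' (T - s) * Y' (T - s)) := by
    rcases le_total s t with h | h
    · exact eq_mul_of_hasMatDeriv (a := s) (b := t) (fun τ => hXY.deriv_right _ τ)
        (fun τ _ => hZ _ τ) (right_mem_Icc.2 h)
    · exact (eq_mul_of_hasMatDeriv (a := t) (b := s) (fun τ => hXY.deriv_right _ τ)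
        (fun τ _ => hZ _ τ) (right_mem_Icc.2 h)).symm
  rw [hXY'.mul_inv, Matrix.mul_one] at key
  rw [hXY'.transition_eq, hXY.transition_eq, ← key, ← Matrix.mul_assoc, hXY.mul_inv, Matrix.one_mul]

theorem setIntegral_uIcc_comp_sub_left (f : ℝ → ℝ) (T a b : ℝ) :
    ∫ s in uIcc (T - a) (T - b), f s = ∫ s in uIcc a b, f (T - s) := by
  wlog h : a ≤ b generalizing a b
  · rw [uIcc_comm, this b a (le_of_not_ge h), uIcc_comm]
  rw [uIcc_of_ge (by linarith), uIcc_of_le h, integral_Icc_eq_integral_Ioc,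
    integral_Icc_eq_integral_Ioc, ← intervalIntegral.integral_of_le h,
    ← intervalIntegral.integral_of_le (by linarith), intervalIntegral.integral_comp_sub_left]

variable {S : LinModel n m p} {T : ℝ}

theorem gapC_reflect (hA : Continuous S.A) (a b : ℝ) :
    gapC (S.reflect T) (T - a) (T - b) = gapC S a b := by
  ext i j
  simp only [gapC, Matrix.of_apply]
  rw [← neg_inj, ← intervalIntegral.integral_symm,
    ← intervalIntegral.integral_comp_sub_left
      (fun t => ((S.reflect T).C t * transition (S.reflect T).A t (T - a)) i j) T,
    ← intervalIntegral.integral_neg]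
  refine intervalIntegral.integral_congr fun t _ => ?_
  have h1 : transition (S.reflect T).A (T - t) (T - a) = transition S.A t a :=
    transition_reflect hA T t a
  simp only [h1]
  simp [LinModel.reflect]

theorem gapM_reflect (hA : Continuous S.A) (b s : ℝ) :
    gapM (S.reflect T) (T - b) (T - s) = gapM S b s := by
  rw [gapM, gapM, gapC_reflect hA]
  simp [LinModel.reflect]

theorem gapBB_reflect (hA : Continuous S.A) (a b : ℝ) :
    gapBB (S.reflect T) (T - a) (T - b) = gapBB S a b := by
  have h1 : ∀ s, transition (S.reflect T).A (T - b) (T - s) = transition S.A b s :=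
    transition_reflect hA T b
  ext i j
  simp only [gapBB, Matrix.of_apply, setIntegral_uIcc_comp_sub_left, h1]
  simp [LinModel.reflect]

theorem gapBD_reflect (hA : Continuous S.A) (a b : ℝ) :
    gapBD (S.reflect T) (T - a) (T - b) = gapBD S a b := by
  have h1 : ∀ s, transition (S.reflect T).A (T - b) (T - s) = transition S.A b s :=
    transition_reflect hA T b
  ext i j
  simp only [gapBD, Matrix.of_apply, setIntegral_uIcc_comp_sub_left, h1, gapM_reflect hA]
  simp [LinModel.reflect]

theorem gapDD_reflect (hA : Continuous S.A) (a b : ℝ) :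
    gapDD (S.reflect T) (T - a) (T - b) = gapDD S a b := by
  ext i j
  simp only [gapDD, Matrix.of_apply, setIntegral_uIcc_comp_sub_left, gapM_reflect hA]

variable {Q : ℝ → Matrix (Fin n) (Fin n) ℝ}

theorem gapInnov_reflect (hA : Continuous S.A) (a b : ℝ) :
    gapInnov (S.reflect T) (fun t => Q (T - t)) (T - a) (T - b) = gapInnov S Q a b := by
  simp only [gapInnov, gapC_reflect hA, gapDD_reflect hA, sub_sub_cancel]

theorem gapGain_reflect (hA : Continuous S.A) (a b : ℝ) :
    gapGain (S.reflect T) (fun t => Q (T - t)) (T - a) (T - b) = gapGain S Q a b := by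
  have h1 : transition (S.reflect T).A (T - b) (T - a) = transition S.A b a :=
    transition_reflect hA T b a
  simp only [gapGain, gapInnov_reflect hA, gapC_reflect hA, gapBD_reflect hA, h1, sub_sub_cancel]

variable {Ω : Type*} [MeasurableSpace Ω] {ℙ : Measure Ω} {y : ℝ → Fin m → RV ℙ}
  {z : ℝ → Fin n → RV ℙ}

theorem GapStep.of_reflect (hA : Continuous S.A) {a b : ℝ}
    (h : GapStep (S.reflect T) (fun t => y (T - t)) (fun t => z (T - t)) (fun t => Q (T - t))
      (T - a) (T - b)) : GapStep S y z Q a b := by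
  have h1 : transition (S.reflect T).A (T - b) (T - a) = transition S.A b a :=
    transition_reflect hA T b a
  simpa only [GapStep, gapGain_reflect hA, gapInnov_reflect hA, gapC_reflect hA, gapBB_reflect hA,
    h1, sub_sub_cancel] using h

/-- The backward filter on `J`, with stochastic integrals in the tagged sense. -/
structure TaggedBackFilterOn (S : LinModel n m p) (J : Set ℝ) (y : ℝ → Fin m → RV ℙ)
    (K : ℝ → Matrix (Fin n) (Fin m) ℝ) (z : ℝ → Fin n → RV ℙ) (Q : ℝ → Matrix (Fin n) (Fin n) ℝ) :
    Prop where
  cont_drift : ∀ i, ContinuousOn (fun τ => ∑ j, (S.A τ - K τ * S.C τ) i j • z τ j) J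
  tendsto : ∀ s ∈ J, ∀ t ∈ J, s ≤ t → ∀ i,
    Tendsto (fun P => ∑ k, rsum (fun τ => K τ i k) (fun τ => y τ k) P) (meshFilter s t)
      (𝓝 (z t i - z s i - ∫ τ in s..t, ∑ j, (S.A τ - K τ * S.C τ) i j • z τ j))
  deriv : ∀ t ∈ J, HasMatDeriv Q (S.A t * Q t + Q t * (S.A t)ᵀ + K t * S.R t * (K t)ᵀ -
    S.B t * (S.B t)ᵀ) J t

theorem TaggedFilterOn.of_reflect {J J' : Set ℝ} {K : ℝ → Matrix (Fin n) (Fin m) ℝ}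
    (h : TaggedFilterOn (S.reflect T) J' (fun t => y (T - t)) (fun t => K (T - t))
      (fun t => z (T - t)) (fun t => Q (T - t))) (hJ : MapsTo (fun t => T - t) J J') :
    TaggedBackFilterOn S J y K z Q where
  cont_drift i := by
    have h1 : ContinuousOn (fun t => -∑ j, ((S.reflect T).A (T - t) -
        K (T - (T - t)) * (S.reflect T).C (T - t)) i j • z (T - (T - t)) j) J :=
      ((h.cont_drift i).comp (continuous_const.sub continuous_id).continuousOn hJ).neg
    refine h1.congr fun t _ => ?_
    simp only [LinModel.reflect, sub_sub_cancel]
    rw [← Finset.sum_neg_distrib]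
    refine Finset.sum_congr rfl fun j _ => ?_
    rw [← neg_smul]
    congr 1
    simp only [Matrix.sub_apply, Matrix.mul_neg, Matrix.neg_apply]
    ring
  tendsto s hs t ht hst i := by
    have h1 := ((h.tendsto (T - t) (hJ ht) (T - s) (hJ hs) (by linarith) i).comp
      (tendsto_rev T s t)).neg
    have e : ∀ P, -∑ k, rsum (fun τ => K (T - τ) i k) (fun τ => y (T - τ) k) (P.rev T) =
        ∑ k, rsum (fun τ => K τ i k) (fun τ => y τ k) P := fun P => by
      rw [← Finset.sum_neg_distrib]
      refine Finset.sum_congr rfl fun k _ => ?_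
      rw [rsum_rev (fun τ => K τ i k) (fun τ => y τ k), neg_neg]
    have e2 : ∫ τ in (T - t)..(T - s), ∑ j, ((S.reflect T).A τ -
        K (T - τ) * (S.reflect T).C τ) i j • z (T - τ) j =
        -∫ τ in s..t, ∑ j, (S.A τ - K τ * S.C τ) i j • z τ j := by
      rw [← intervalIntegral.integral_comp_sub_left (fun τ => ∑ j, ((S.reflect T).A τ -
        K (T - τ) * (S.reflect T).C τ) i j • z (T - τ) j) T, ← intervalIntegral.integral_neg]
      refine intervalIntegral.integral_congr fun τ _ => ?_
      simp only [LinModel.reflect, sub_sub_cancel]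
      rw [← Finset.sum_neg_distrib]
      refine Finset.sum_congr rfl fun j _ => ?_
      rw [← neg_smul]
      congr 1
      simp only [Matrix.sub_apply, Matrix.mul_neg, Matrix.neg_apply]
      ring
    rw [e2] at h1
    simp only [sub_sub_cancel] at h1
    have e3 : -(z s i - z t i - -∫ τ in s..t, ∑ j, (S.A τ - K τ * S.C τ) i j • z τ j) =
        z t i - z s i - ∫ τ in s..t, ∑ j, (S.A τ - K τ * S.C τ) i j • z τ j := by abel
    rw [e3] at h1
    exact h1.congr e
  deriv t ht i j := by
    have h1 := h.deriv (T - t) (hJ ht) i j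
    have h2 : HasDerivWithinAt (fun t => T - t) (-1) J t :=
      ((hasDerivAt_id t).const_sub T).hasDerivWithinAt
    have h3 := h1.scomp t h2 hJ
    simp only [Function.comp_def, sub_sub_cancel] at h3
    refine h3.congr_deriv ?_
    simp only [LinModel.reflect, LinModel.R, sub_sub_cancel, Matrix.add_apply, Matrix.sub_apply,
      Matrix.neg_mul, Matrix.mul_neg, Matrix.transpose_neg, Matrix.neg_apply, smul_eq_mul]
    ring

theorem forwardGain_reflect (t : ℝ) :
    forwardGain (S.reflect T) (fun t => Q (T - t)) t = backwardGain S Q (T - t) := by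
  simp only [forwardGain, backwardGain, LinModel.reflect, LinModel.R, Matrix.transpose_neg,
    Matrix.mul_neg, ← Matrix.neg_mul, neg_sub]
  rw [Matrix.neg_mul, neg_add_eq_sub]

end ReflectModel

section ReversePattern

variable {T : ℝ} (O : ObsPattern T)

/-- The observation pattern in reversed time. -/
def ObsPattern.rev : ObsPattern T where
  N := O.N
  τ i := T - O.τ i.rev
  strictMono i j h := sub_lt_sub_left (O.strictMono (Fin.rev_lt_rev.2 h)) T
  first := by rw [Fin.rev_zero, O.last, sub_self]
  last := by rw [Fin.rev_last, O.first, sub_zero]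
  mode i := O.mode i.rev

theorem ObsPattern.rev_left (i : Fin O.N) : O.rev.left i.rev = T - O.right i := by
  simp only [ObsPattern.left, ObsPattern.right, ObsPattern.rev, Fin.rev_castSucc]
  rw [Fin.rev_rev]

theorem ObsPattern.rev_right (i : Fin O.N) : O.rev.right i.rev = T - O.left i := by
  simp only [ObsPattern.left, ObsPattern.right, ObsPattern.rev, Fin.rev_succ]
  rw [Fin.rev_rev]

theorem ObsPattern.rev_mode (i : Fin O.N) : O.rev.mode i.rev = O.mode i :=
  congrArg O.mode (Fin.rev_rev i)

variable {Ω : Type*} [MeasurableSpace Ω] {ℙ : Measure Ω} {n m p : ℕ} {y : ℝ → Fin m → RV ℙ}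

theorem incrSpace_rev (T a b : ℝ) :
    incrSpace (fun t => y (T - t)) (T - b) (T - a) = incrSpace y a b := by
  refine le_antisymm (incrSpace_le fun s hs t ht k => mem_incrSpace
    ⟨by linarith [hs.2], by linarith [hs.1]⟩ ⟨by linarith [ht.2], by linarith [ht.1]⟩ k)
    (incrSpace_le fun s hs t ht k => ?_)
  have := mem_incrSpace (y := fun t => y (T - t)) (a := T - b) (b := T - a) (s := T - s)
    (t := T - t) ⟨by linarith [hs.2], by linarith [hs.1]⟩ ⟨by linarith [ht.2], by linarith [ht.1]⟩ k
  simpa only [sub_sub_cancel] using this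

theorem modeSpace_rev (T a b : ℝ) (o : ObsMode) :
    modeSpace (fun t => y (T - t)) (T - b) (T - a) o = modeSpace y a b o := by
  cases o with
  | full => exact incrSpace_rev T a b
  | increment =>
    simp only [modeSpace, sub_sub_cancel]
    refine le_antisymm (span_closure_le fun k => ?_) (span_closure_le fun k => ?_)
    · rw [← neg_sub]
      exact Submodule.neg_mem _ (mem_span_closure (fun k => y b k - y a k) k)
    · rw [← neg_sub]
      exact Submodule.neg_mem _ (mem_span_closure (fun k => y a k - y b k) k)
  | lost => rfl

theorem obsSpace_rev : obsSpace O.rev (fun t => y (T - t)) = obsSpace O y := by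
  have h1 : obsSpace O.rev (fun t => y (T - t)) = ⨆ i : Fin O.N, modeSpace (fun t => y (T - t))
      (O.rev.left i) (O.rev.right i) (O.rev.mode i) := rfl
  rw [h1, obsSpace, ← (Fin.revPerm : Equiv.Perm (Fin O.N)).iSup_comp]
  refine iSup_congr fun i => ?_
  rw [← modeSpace_rev T (O.left i)]
  exact congr (congrArg₂ _ (O.rev_left i) (O.rev_right i)) (O.rev_mode i)

theorem obsPast_rev (t : ℝ) :
    obsPast O.rev (fun t => y (T - t)) t = obsFuture O y (T - t) := by
  rw [obsPast, obsFuture, obsSpace_rev, ← incrSpace_rev T (T - t) T, sub_self, sub_sub_cancel]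

/-- The backward cascade with stochastic integrals in the tagged sense. -/
structure TaggedBackCascade (S : LinModel n m p)
    (y : ℝ → Fin m → RV ℙ) (z : ℝ → Fin n → RV ℙ) (Q : ℝ → Matrix (Fin n) (Fin n) ℝ) : Prop where
  final_est : z T = 0
  final_cov : Q T = 1
  full : ∀ i, O.mode i = .full →
    TaggedBackFilterOn S (Icc (O.left i) (O.right i)) y (backwardGain S Q) z Q
  lost : ∀ i, O.mode i = .lost → TaggedBackFilterOn S (Icc (O.left i) (O.right i)) y 0 z Q
  increment : ∀ i, O.mode i = .increment →
    TaggedBackFilterOn S (Ioc (O.left i) (O.right i)) y 0 z Q ∧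
    IsUnit (gapInnov S Q (O.right i) (O.left i)) ∧
    GapStep S y z Q (O.right i) (O.left i)

/-- A forward cascade in reversed time is a backward cascade. -/
theorem TaggedCascade.of_reflect {S : LinModel n m p} (hA : Continuous S.A)
    {z : ℝ → Fin n → RV ℙ} {Q : ℝ → Matrix (Fin n) (Fin n) ℝ}
    (h : TaggedCascade (S.reflect T) O.rev (fun t => y (T - t)) (fun t => z (T - t))
      fun t => Q (T - t)) : TaggedBackCascade O S y z Q where
  final_est := by simpa using h.init_est
  final_cov := by simpa using h.init_cov
  full i hi := by
    have h1 := h.full i.rev (by rw [O.rev_mode, hi])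
    rw [funext forwardGain_reflect, O.rev_left, O.rev_right] at h1
    exact h1.of_reflect fun t ht => ⟨by linarith [ht.2], by linarith [ht.1]⟩
  lost i hi := by
    have h1 := h.lost i.rev (by rw [O.rev_mode, hi])
    rw [O.rev_left, O.rev_right] at h1
    exact TaggedFilterOn.of_reflect (K := 0) h1 fun t ht => ⟨by linarith [ht.2], by linarith [ht.1]⟩
  increment i hi := by
    have h1 := h.increment i.rev (by rw [O.rev_mode, hi])
    rw [O.rev_left, O.rev_right, gapInnov_reflect hA] at h1
    exact ⟨TaggedFilterOn.of_reflect (K := 0) h1.1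
      fun t ht => ⟨by linarith [ht.2], by linarith [ht.1]⟩, h1.2.1, h1.2.2.of_reflect hA⟩

end ReversePattern

section CoreReverse

variable {Ω : Type*} [MeasurableSpace Ω] {ℙ : Measure Ω} {n m p : ℕ}
  {S : LinModel n m p} {T : ℝ} {x : ℝ → Fin n → RV ℙ} {y : ℝ → Fin m → RV ℙ}

namespace Core

theorem posDef_forwardErrCov (h : Core S T x y) (hT : 0 ≤ T) (O : ObsPattern T) {t : ℝ}
    (ht : t ∈ Icc 0 T) : (forwardErrCov O x y t).PosDef :=
  posDef_errCov_mono inf_le_right (h.posDef_errCov_past hT ht)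

theorem forwardEst_rev (O : ObsPattern T) :
    forwardEst O.rev (fun t => x (T - t)) (fun t => y (T - t)) =
      fun t => estimate (obsFuture O y (T - t)) (x (T - t)) :=
  funext fun t => by rw [forwardEst, obsPast_rev]

theorem forwardErrCov_rev (O : ObsPattern T) :
    forwardErrCov O.rev (fun t => x (T - t)) (fun t => y (T - t)) =
      fun t => covMat (x (T - t) - estimate (obsFuture O y (T - t)) (x (T - t)))
        (x (T - t) - estimate (obsFuture O y (T - t)) (x (T - t))) :=
  funext fun t => by rw [forwardErrCov, forwardEst_rev]

/-- The backward cascade is the forward cascade of the time-reversed system. -/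
theorem taggedBackCascade (h : Core S T x y) (hT : 0 < T) (O : ObsPattern T) :
    TaggedBackCascade O (S.backward fun _ => 1) y (fun t => estimate (obsFuture O y t) (x t))
      (fun t => covMat (x t - estimate (obsFuture O y t) (x t))
        (x t - estimate (obsFuture O y t) (x t))) := by
  have h1 := (h.rev hT).taggedCascade hT O.rev
  rw [revModel_eq_reflect, forwardEst_rev, forwardErrCov_rev] at h1
  refine TaggedCascade.of_reflect O ?_ h1
  have h2 := h.contA
  dsimp only [LinModel.backward]
  fun_prop

theorem posDef_errCov_future (h : Core S T x y) (hT : 0 < T) (O : ObsPattern T) {t : ℝ}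
    (ht : t ∈ Icc 0 T) :
    (covMat (x t - estimate (obsFuture O y t) (x t))
      (x t - estimate (obsFuture O y t) (x t))).PosDef := by
  have := (h.rev hT).posDef_forwardErrCov hT.le O.rev (t := T - t)
    ⟨by linarith [ht.2], by linarith [ht.1]⟩
  rw [forwardErrCov_rev] at this
  simpa only [sub_sub_cancel] using this

end Core
end CoreReverse

/-! ### The second-order description of a linear system driven by noise -/

section LeftTags

variable {E : Type*} [NormedAddCommGroup E] [NormedSpace ℝ E] {r q : ℕ}
  {M : ℝ → Matrix (Fin r) (Fin q) ℝ} {z : ℝ → Fin q → E} {a b : ℝ} {I : Fin r → E}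

/-- The same partition, with the left end points as tags. -/
def TagPart.leftTag (P : TagPart) : TagPart := ⟨P.N, P.u, P.u⟩

theorem TagPart.IsOn.leftTag {P : TagPart} {δ : ℝ} (h : P.IsOn a b δ) : P.leftTag.IsOn a b δ :=
  ⟨h.mono, h.first, h.last, h.mesh, fun k _ => ⟨le_rfl, h.mono k.le_succ⟩⟩

theorem tendsto_leftTag (a b : ℝ) :
    Tendsto TagPart.leftTag (meshFilter a b) (meshFilter a b) :=
  ((meshFilter_hasBasis a b).tendsto_iff (meshFilter_hasBasis a b)).2
    fun δ hδ => ⟨δ, hδ, fun _ hP => TagPart.IsOn.leftTag hP⟩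

theorem leftSum_apply (N : ℕ) (u τ : ℕ → ℝ) (i : Fin r) :
    (∑ l ∈ Finset.range N, M (u l) ⊛ (z (u (l + 1)) - z (u l))) i =
      ∑ k, rsum (fun t => M t i k) (fun t => z t k) (TagPart.leftTag ⟨N, u, τ⟩) := by
  simp only [Finset.sum_apply, matAct, rsum, TagPart.leftTag, Pi.sub_apply]
  exact Finset.sum_comm

theorem HasStochIntegral.tendsto (h : HasStochIntegral M z a b I) (i : Fin r) :
    Tendsto (fun P : TagPart => ∑ k, rsum (fun t => M t i k) (fun t => z t k) P.leftTag)
      (meshFilter a b) (𝓝 (I i)) := by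
  refine Metric.tendsto_nhds.2 fun ε hε => ?_
  obtain ⟨δ, hδ, hI⟩ := h ε hε
  filter_upwards [eventually_isOn a b hδ] with P hP
  have h1 := (norm_le_pi_norm _ i).trans_lt (hI P.N P.u hP.mono hP.first hP.last hP.mesh)
  rw [Pi.sub_apply, leftSum_apply P.N P.u P.τ] at h1
  rwa [dist_eq_norm]

theorem HasStochIntegral.of_tendsto
    (h : ∀ i, Tendsto (fun P : TagPart => ∑ k, rsum (fun t => M t i k) (fun t => z t k) P)
      (meshFilter a b) (𝓝 (I i))) : HasStochIntegral M z a b I := by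
  intro ε hε
  have h1 : ∀ᶠ P in meshFilter a b,
      ∀ i, dist (∑ k, rsum (fun t => M t i k) (fun t => z t k) P) (I i) < ε :=
    eventually_all.2 fun i => Metric.tendsto_nhds.1 (h i) ε hε
  obtain ⟨δ, hδ, hP⟩ := (meshFilter_hasBasis a b).eventually_iff.1 h1
  refine ⟨δ, hδ, fun N u h2 h3 h4 h5 => (pi_norm_lt_iff hε).2 fun i => ?_⟩
  rw [Pi.sub_apply, leftSum_apply N u u, ← dist_eq_norm]
  exact hP (x := TagPart.leftTag ⟨N, u, u⟩) ⟨h2, h3, h4, h5, fun k _ => ⟨le_rfl, h2 k.le_succ⟩⟩ i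

end LeftTags

section Clamp

variable {n m p : ℕ} {T : ℝ}

/-- The point of `[0, T]` nearest to `t`. -/
def clamp (T t : ℝ) : ℝ := max 0 (min t T)

theorem continuous_clamp (T : ℝ) : Continuous (clamp T) := by
  unfold clamp
  fun_prop

theorem clamp_mem (hT : 0 ≤ T) (t : ℝ) : clamp T t ∈ Icc 0 T :=
  ⟨le_max_left _ _, max_le hT (min_le_right _ _)⟩

theorem clamp_of_mem {t : ℝ} (ht : t ∈ Icc 0 T) : clamp T t = t := by
  rw [clamp, min_eq_left ht.2, max_eq_right ht.1]

/-- The coefficients, extended by constants outside `[0, T]`. -/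
def LinModel.clamp (S : LinModel n m p) (T : ℝ) : LinModel n m p where
  A t := S.A (_root_.clamp T t)
  B t := S.B (_root_.clamp T t)
  C t := S.C (_root_.clamp T t)
  D t := S.D (_root_.clamp T t)

theorem ContinuousOn.comp_clamp {F : Type*} [TopologicalSpace F] {f : ℝ → F}
    (hf : ContinuousOn f (Icc 0 T)) (hT : 0 ≤ T) : Continuous fun t => f (clamp T t) :=
  hf.comp_continuous (continuous_clamp T) (clamp_mem hT)

end Clamp

section LinearSystem

variable {Ω : Type*} [MeasurableSpace Ω] {ℙ : Measure Ω} {n m p r : ℕ} {T : ℝ}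
  {w : ℝ → Fin p → RV ℙ}

theorem IsNormalizedNoise.noisePair (h : IsNormalizedNoise T w) (k l : Fin p) :
    NoisePair (fun t => w (clamp T t) k) (fun t => w (clamp T t) l)
      (fun _ => (1 : Matrix (Fin p) (Fin p) ℝ) k l) 0 T where
  cont := continuous_const
  cov s t hs hst ht := by
    have h1 : s ∈ Icc 0 T := ⟨hs, hst.trans ht⟩
    have h2 : t ∈ Icc 0 T := ⟨hs.trans hst, ht⟩
    have := congrFun (congrFun (h.normalized s h1 t h2 hst) k) l
    simp only [clamp_of_mem h1, clamp_of_mem h2, intervalIntegral.integral_const]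
    exact this
  orth₁ s t s' t' hs hst hts hst' ht' := by
    have h1 : s ∈ Icc 0 T := ⟨hs, by linarith⟩
    have h2 : t ∈ Icc 0 T := ⟨by linarith, by linarith⟩
    have h3 : s' ∈ Icc 0 T := ⟨by linarith, by linarith⟩
    have h4 : t' ∈ Icc 0 T := ⟨by linarith, ht'⟩
    have := congrFun (congrFun (h.orthogonal s h1 t h2 s' h3 t' h4 hst hts hst') k) l
    simp only [clamp_of_mem h1, clamp_of_mem h2, clamp_of_mem h3, clamp_of_mem h4]
    exact this
  orth₂ s t s' t' hs hst hts hst' ht' := by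
    have h1 : s ∈ Icc 0 T := ⟨hs, by linarith⟩
    have h2 : t ∈ Icc 0 T := ⟨by linarith, by linarith⟩
    have h3 : s' ∈ Icc 0 T := ⟨by linarith, by linarith⟩
    have h4 : t' ∈ Icc 0 T := ⟨by linarith, ht'⟩
    have := congrFun (congrFun (h.orthogonal s h1 t h2 s' h3 t' h4 hst hts hst') l) k
    rw [real_inner_comm]
    simp only [clamp_of_mem h1, clamp_of_mem h2, clamp_of_mem h3, clamp_of_mem h4]
    exact this

theorem IsNormalizedNoise.continuous (h : IsNormalizedNoise T w) (hT : 0 ≤ T) (k : Fin p) :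
    Continuous fun t => w (clamp T t) k := by
  have h1 := continuous_of_norm_sq_le (z := fun t => w (clamp T t) k) (κ := 1) hT
    fun s t hs hst ht => by
      rw [← real_inner_self_eq_norm_sq, (h.noisePair k k).cov hs hst ht]
      simp
  refine h1.congr fun t => ?_
  change w (clamp T (clamp T t)) k = _
  rw [clamp_of_mem (clamp_mem hT t)]

/-- The components of a Wiener integral `∫_s^t M dw`. -/
theorem IsNormalizedNoise.eq_sum_stochInt (h : IsNormalizedNoise T w) (hT : 0 ≤ T)
    {M : ℝ → Matrix (Fin r) (Fin p) ℝ} (hM : ContinuousOn M (Icc 0 T)) {I : Fin r → RV ℙ}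
    {s t : ℝ} (hs : 0 ≤ s) (hst : s ≤ t) (ht : t ≤ T) (hI : HasStochIntegral M w s t I)
    (i : Fin r) :
    I i = ∑ k, stochInt (fun τ => M (clamp T τ) i k) (fun τ => w (clamp T τ) k) s t := by
  have := meshFilter_neBot hst
  have hMc := hM.comp_clamp hT
  refine tendsto_nhds_unique (hI.tendsto i) ?_
  refine (tendsto_finsetSum _ fun k _ =>
    (((h.noisePair k k).mono hs ht).tendsto_stochInt (h.continuous hT k)
      (hMc.matrix_elem i k) hst).comp (tendsto_leftTag s t)).congr' ?_
  filter_upwards [eventually_isOn s t one_pos] with P hP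
  have hmem : ∀ k ≤ P.N, clamp T (P.u k) = P.u k := fun k hk =>
    clamp_of_mem ⟨hs.trans (hP.u_mem hk).1, (hP.u_mem hk).2.trans ht⟩
  refine Finset.sum_congr rfl fun k _ => ?_
  change rsum _ _ P.leftTag = _
  refine Finset.sum_congr rfl fun l hl => ?_
  have hl' := Finset.mem_range.1 hl
  simp only [TagPart.leftTag, hmem _ hl'.le, hmem _ (Nat.succ_le_of_lt hl')]

theorem intervalIntegral_apply {f : ℝ → Fin r → RV ℙ} {s t : ℝ}
    (hf : IntervalIntegrable f volume s t) (i : Fin r) :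
    (∫ τ in s..t, f τ) i = ∫ τ in s..t, f τ i :=
  ((ContinuousLinearMap.proj (R := ℝ) (φ := fun _ : Fin r => RV ℙ) i).intervalIntegral_comp_comm
    hf).symm

theorem IntervalIntegrable.apply {f : ℝ → Fin r → RV ℙ} {s t : ℝ}
    (hf : IntervalIntegrable f volume s t) (i : Fin r) :
    IntervalIntegrable (fun τ => f τ i) volume s t :=
  ⟨(ContinuousLinearMap.proj (R := ℝ) (φ := fun _ : Fin r => RV ℙ) i).integrable_comp hf.1,
    (ContinuousLinearMap.proj (R := ℝ) (φ := fun _ : Fin r => RV ℙ) i).integrable_comp hf.2⟩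

variable {S : LinModel n m p} {x : ℝ → Fin n → RV ℙ} {y : ℝ → Fin m → RV ℙ}

namespace IsLinearSystem

theorem intervalIntegrable_drift (h : IsLinearSystem S T w x y) {s t : ℝ} (hs : 0 ≤ s)
    (hst : s ≤ t) (ht : t ≤ T) (i : Fin n ⊕ Fin m) :
    IntervalIntegrable (stackDrift S x i) volume s t := by
  rcases i with i | i
  · exact (h.state s ⟨hs, hst.trans ht⟩ t ⟨hs.trans hst, ht⟩ hst).1.apply i
  · exact (h.output s ⟨hs, hst.trans ht⟩ t ⟨hs.trans hst, ht⟩ hst).1.apply i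

/-- The integrated equations of the system, with the noise and its coefficient extended by constants
beyond `[0, T]`. -/
theorem stackX_sub (h : IsLinearSystem S T w x y) (hT : 0 ≤ T) (hS : S.IsContinuousOn T) {s t : ℝ}
    (hs : 0 ≤ s) (hst : s ≤ t) (ht : t ≤ T) (i : Fin n ⊕ Fin m) :
    stackX x y i t - stackX x y i s = (∫ τ in s..t, stackDrift S x i τ) +
      ∑ k, stochInt (fun τ => stackB (S.clamp T) τ i k) (fun τ => w (clamp T τ) k) s t := by
  rw [← sub_eq_iff_eq_add']
  rcases i with i | i
  · obtain ⟨h1, h2⟩ := h.state s ⟨hs, hst.trans ht⟩ t ⟨hs.trans hst, ht⟩ hst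
    have := h.noise.eq_sum_stochInt hT hS.B hs hst ht h2 i
    rwa [Pi.sub_apply, intervalIntegral_apply h1] at this
  · obtain ⟨h1, h2⟩ := h.output s ⟨hs, hst.trans ht⟩ t ⟨hs.trans hst, ht⟩ hst
    have := h.noise.eq_sum_stochInt hT hS.D hs hst ht h2 i
    rwa [Pi.sub_apply, intervalIntegral_apply h1] at this

theorem continuous_stackB_clamp (hT : 0 ≤ T) (hS : S.IsContinuousOn T) :
    Continuous (stackB (S.clamp T)) :=
  continuous_matrix fun i j => by
    rcases i with i | i
    · exact (hS.B.comp_clamp hT).matrix_elem i j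
    · exact (hS.D.comp_clamp hT).matrix_elem i j

theorem continuous_stackX (h : IsLinearSystem S T w x y) (hT : 0 ≤ T) (hS : S.IsContinuousOn T)
    (i : Fin n ⊕ Fin m) :
    Continuous (stackX (fun t => x (clamp T t)) (fun t => y (clamp T t)) i) := by
  have hB := continuous_stackB_clamp hT hS
  have h1 : ContinuousOn (fun t => ∫ τ in (0 : ℝ)..t, stackDrift S x i τ) (Icc 0 T) := by
    rw [← uIcc_of_le hT]
    exact intervalIntegral.continuousOn_primitive_interval'
      (h.intervalIntegrable_drift le_rfl hT le_rfl i) left_mem_uIcc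
  have h2 := continuous_finsetSum Finset.univ fun k _ =>
    (h.noise.noisePair k k).continuous_stochPrim (h.noise.continuous hT k) (hB.matrix_elem i k) hT
  refine (((h1.comp_clamp hT).add h2).const_add (stackX x y i 0)).congr fun t => ?_
  have := h.stackX_sub hT hS le_rfl (clamp_mem hT t).1 (clamp_mem hT t).2 i
  rw [sub_eq_iff_eq_add'] at this
  have e : stackX (fun t => x (clamp T t)) (fun t => y (clamp T t)) i t =
    stackX x y i (clamp T t) := rfl
  rw [e, this]
  rfl

theorem continuous_stackDrift (h : IsLinearSystem S T w x y) (hT : 0 ≤ T)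
    (hS : S.IsContinuousOn T) (i : Fin n ⊕ Fin m) :
    Continuous (stackDrift (S.clamp T) (fun t => x (clamp T t)) i) := by
  have hx : ∀ j, Continuous fun t => x (clamp T t) j :=
    fun j => h.continuous_stackX hT hS (Sum.inl j)
  have hA : ∀ j, Continuous fun t => stackA (S.clamp T) t i j := fun j => by
    rcases i with i | i
    · exact (hS.A.comp_clamp hT).matrix_elem i j
    · exact (hS.C.comp_clamp hT).matrix_elem i j
  exact continuous_finsetSum _ fun j _ => (hA j).smul (hx j)

/-- The noise of the stacked process is `∫ (B; D) dw`. -/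
theorem sysNoise_sub (h : IsLinearSystem S T w x y) (hT : 0 ≤ T) (hS : S.IsContinuousOn T)
    {s t : ℝ} (hs : 0 ≤ s) (hst : s ≤ t) (ht : t ≤ T) (i : Fin n ⊕ Fin m) :
    sysNoise (S.clamp T) (fun t => x (clamp T t)) (fun t => y (clamp T t)) i t -
      sysNoise (S.clamp T) (fun t => x (clamp T t)) (fun t => y (clamp T t)) i s =
      ∑ k, stochInt (fun τ => stackB (S.clamp T) τ i k) (fun τ => w (clamp T τ) k) s t := by
  have hi := fun a b => (h.continuous_stackDrift hT hS i).intervalIntegrable (μ := volume) a b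
  have h1 := h.stackX_sub hT hS hs hst ht i
  have hs' : s ∈ Icc 0 T := ⟨hs, hst.trans ht⟩
  have ht' : t ∈ Icc 0 T := ⟨hs.trans hst, ht⟩
  have e1 : ∫ τ in s..t, stackDrift S x i τ =
      ∫ τ in s..t, stackDrift (S.clamp T) (fun t => x (clamp T t)) i τ :=
    intervalIntegral.integral_congr fun τ hτ => by
      rw [uIcc_of_le hst] at hτ
      simp only [stackDrift, stackA, LinModel.clamp,
        clamp_of_mem (T := T) ⟨hs.trans hτ.1, hτ.2.trans ht⟩]
  have e2 : ∀ r ∈ Icc 0 T, stackX (fun t => x (clamp T t)) (fun t => y (clamp T t)) i r =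
      stackX x y i r := fun r hr => by simp only [stackX, clamp_of_mem hr]
  rw [sysNoise, sysNoise, sub_sub_sub_comm, intervalIntegral.integral_interval_sub_left (hi _ _)
    (hi _ _), e2 s hs', e2 t ht', h1, e1, add_sub_cancel_left]

/-- Increments of the noise are orthogonal to whatever is orthogonal to the increments of `w` over
the same interval. -/
theorem inner_sysNoise_eq_zero (h : IsLinearSystem S T w x y) (hT : 0 ≤ T)
    (hS : S.IsContinuousOn T) {s t : ℝ} (hs : 0 ≤ s) (hst : s ≤ t) (ht : t ≤ T)
    (i : Fin n ⊕ Fin m) {v : RV ℙ}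
    (hv : ∀ k a b, s ≤ a → a ≤ b → b ≤ t →
      inner ℝ v (w (clamp T b) k - w (clamp T a) k) = 0) :
    inner ℝ v (sysNoise (S.clamp T) (fun t => x (clamp T t)) (fun t => y (clamp T t)) i t -
      sysNoise (S.clamp T) (fun t => x (clamp T t)) (fun t => y (clamp T t)) i s) = 0 := by
  rw [h.sysNoise_sub hT hS hs hst ht, inner_sum]
  exact Finset.sum_eq_zero fun k _ => inner_limit_eq_zero hst
    (((h.noise.noisePair k k).mono hs ht).tendsto_stochInt (h.noise.continuous hT k)
      ((continuous_stackB_clamp hT hS).matrix_elem i k) hst) (hv k)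

theorem inner_sysNoise_noise (h : IsLinearSystem S T w x y) (hT : 0 ≤ T)
    (hS : S.IsContinuousOn T) {s t s' t' : ℝ} (hs : 0 ≤ s) (hst : s ≤ t) (hts : t ≤ s')
    (hst' : s' ≤ t') (ht : t' ≤ T) (i j : Fin n ⊕ Fin m) :
    inner ℝ (sysNoise (S.clamp T) (fun t => x (clamp T t)) (fun t => y (clamp T t)) i t -
        sysNoise (S.clamp T) (fun t => x (clamp T t)) (fun t => y (clamp T t)) i s)
      (sysNoise (S.clamp T) (fun t => x (clamp T t)) (fun t => y (clamp T t)) j t' -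
        sysNoise (S.clamp T) (fun t => x (clamp T t)) (fun t => y (clamp T t)) j s') = 0 := by
  refine h.inner_sysNoise_eq_zero hT hS (hs.trans (hst.trans hts)) hst' ht j
    fun k a b ha hab hb => ?_
  rw [real_inner_comm]
  refine h.inner_sysNoise_eq_zero hT hS hs hst (hts.trans (hst'.trans ht)) i
    fun l a' b' ha' hab' hb' => ?_
  rw [real_inner_comm]
  exact (h.noise.noisePair l k).orth₁ (hs.trans ha') hab' (hb'.trans (hts.trans ha)) hab
    (hb.trans ht)

theorem noisePair (h : IsLinearSystem S T w x y) (hT : 0 ≤ T) (hS : S.IsContinuousOn T)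
    (i j : Fin n ⊕ Fin m) :
    NoisePair (sysNoise (S.clamp T) (fun t => x (clamp T t)) (fun t => y (clamp T t)) i)
      (sysNoise (S.clamp T) (fun t => x (clamp T t)) (fun t => y (clamp T t)) j)
      (fun t => (stackB (S.clamp T) t * (stackB (S.clamp T) t)ᵀ) i j) 0 T where
  cont := by
    have hB := continuous_stackB_clamp hT hS
    fun_prop
  cov s t hs hst ht := by
    have hB := continuous_stackB_clamp hT hS
    have hlim := fun i k => ((h.noise.noisePair k k).mono hs ht).tendsto_stochInt
      (h.noise.continuous hT k) (hB.matrix_elem i k) hst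
    rw [h.sysNoise_sub hT hS hs hst ht, h.sysNoise_sub hT hS hs hst ht]
    simp only [sum_inner, inner_sum, Matrix.mul_apply, Matrix.transpose_apply]
    rw [intervalIntegral.integral_finsetSum]
    · refine Finset.sum_congr rfl fun k _ => ?_
      have h1 : ∀ l, inner ℝ
          (stochInt (fun τ => stackB (S.clamp T) τ i l) (fun τ => w (clamp T τ) l) s t)
          (stochInt (fun τ => stackB (S.clamp T) τ j k) (fun τ => w (clamp T τ) k) s t) =
          ∫ τ in s..t, stackB (S.clamp T) τ i l * stackB (S.clamp T) τ j k *
            (1 : Matrix (Fin p) (Fin p) ℝ) l k := fun l =>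
        ((h.noise.noisePair l k).mono hs ht).inner_limit (hB.matrix_elem i l)
          (hB.matrix_elem j k) hst (hlim i l) (hlim j k)
      simp only [h1]
      rw [Finset.sum_eq_single_of_mem k (Finset.mem_univ k)]
      · simp
      · intro l _ hl
        simp [Matrix.one_apply_ne hl]
    · intro k _
      exact Continuous.intervalIntegrable (by fun_prop) _ _
  orth₁ s t s' t' hs hst hts hst' ht' := h.inner_sysNoise_noise hT hS hs hst hts hst' ht' i j
  orth₂ s t s' t' hs hst hts hst' ht' := by
    rw [real_inner_comm]
    exact h.inner_sysNoise_noise hT hS hs hst hts hst' ht' j i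

/-- The covariances of the state with a later increment of the noise satisfy a homogeneous
linear equation and vanish initially. -/
theorem inner_state_sysNoise (h : IsLinearSystem S T w x y) (hT : 0 ≤ T) (hS : S.IsContinuousOn T)
    (i : Fin n ⊕ Fin m) (k : Fin n) {r s t : ℝ} (hr : 0 ≤ r) (hrs : r ≤ s) (hst : s ≤ t)
    (ht : t ≤ T) :
    inner ℝ (x (clamp T r) k)
      (sysNoise (S.clamp T) (fun t => x (clamp T t)) (fun t => y (clamp T t)) i t -
        sysNoise (S.clamp T) (fun t => x (clamp T t)) (fun t => y (clamp T t)) i s) = 0 := by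
  set N := sysNoise (S.clamp T) (fun t => x (clamp T t)) (fun t => y (clamp T t))
  set v := N i t - N i s with hv
  have hA : Continuous (S.clamp T).A := hS.A.comp_clamp hT
  have hx : ∀ j, Continuous fun t => x (clamp T t) j :=
    fun j => h.continuous_stackX hT hS (Sum.inl j)
  obtain ⟨X, Y, hXY⟩ := exists_isFundamental hA
  set Z : ℝ → Matrix (Fin n) (Fin 1) ℝ := fun τ => Matrix.of fun j _ => inner ℝ v (x (clamp T τ) j)
  have hZ : ∀ τ ∈ Icc 0 s, HasMatDeriv Z ((S.clamp T).A τ * Z τ) (Icc 0 s) τ := by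
    intro τ hτ j _
    have := hasDerivWithinAt_of_integral (φ := fun τ => inner ℝ v (x (clamp T τ) j)) (a := 0)
      (b := s) (h := fun τ => ∑ l, (S.clamp T).A τ j l * inner ℝ v (x (clamp T τ) l))
      (continuous_finsetSum _ fun l _ => (hA.matrix_elem j l).mul
        (continuous_const.inner (hx l))) (fun τ hτ => ?_) hτ
    · simpa [Z, Matrix.mul_apply] using this
    · have hi := fun a b =>
        (h.continuous_stackDrift hT hS (Sum.inl j)).intervalIntegrable (μ := volume) a b
      have e : x (clamp T τ) j - x (clamp T 0) j = (∫ σ in (0 : ℝ)..τ, stackDrift (S.clamp T)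
          (fun t => x (clamp T t)) (Sum.inl j) σ) + (N (Sum.inl j) τ - N (Sum.inl j) 0) := by
        simp only [N, sysNoise, stackX, Sum.elim_inl, intervalIntegral.integral_same]
        abel
      have h0 : inner ℝ v (N (Sum.inl j) τ - N (Sum.inl j) 0) = 0 := by
        rw [real_inner_comm]
        exact h.inner_sysNoise_noise hT hS le_rfl hτ.1 hτ.2 hst ht _ _
      rw [← inner_sub_right, e, inner_add_right, h0, add_zero,
        inner_intervalIntegral _ (h.continuous_stackDrift hT hS (Sum.inl j))]
      simp only [stackDrift, inner_sum, real_inner_smul_right]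
      rfl
  have hZ0 : Z 0 = 0 := by
    ext j l
    change inner ℝ v (x (clamp T 0) j) = 0
    rw [clamp_of_mem ⟨le_rfl, hT⟩, real_inner_comm]
    refine h.inner_sysNoise_eq_zero hT hS (hr.trans hrs) hst ht i fun k a b ha hab hb => ?_
    exact congrFun (congrFun (h.uncorrelated _ (clamp_mem hT a) _ (clamp_mem hT b)) j) k
  have h1 := eq_mul_of_hasMatDeriv (fun τ => hXY.deriv_right (Icc 0 s) τ) hZ (t := r) ⟨hr, hrs⟩
  rw [hZ0, Matrix.mul_zero] at h1
  have h2 : Z r = 0 := by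
    rw [← Matrix.one_mul (Z r), ← hXY.mul_inv r, Matrix.mul_assoc, h1, Matrix.mul_zero]
  rw [real_inner_comm]
  exact congrFun (congrFun h2 k) 0

/-- Extended by constants, a normalized linear system satisfies the second-order description. -/
theorem core (h : IsLinearSystem S T w x y) (hT : 0 ≤ T) (hS : S.IsContinuousOn T)
    (hR : ∀ t ∈ Icc 0 T, (S.R t).PosDef) (hnorm : ∀ t ∈ Icc 0 T, stateCov x t = 1) :
    Core (S.clamp T) T (fun t => x (clamp T t)) (fun t => y (clamp T t)) where
  contA := hS.A.comp_clamp hT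
  contB := hS.B.comp_clamp hT
  contC := hS.C.comp_clamp hT
  contD := hS.D.comp_clamp hT
  posR t := hR _ (clamp_mem hT t)
  contX := h.continuous_stackX hT hS
  noise := h.noisePair hT hS
  past_state i k r s t := h.inner_state_sysNoise hT hS i k
  past_output i k r s t hr hrs hst ht := by
    have hd := h.continuous_stackDrift hT hS (Sum.inr k)
    have e : y (clamp T r) k - y (clamp T 0) k = (∫ σ in (0 : ℝ)..r, stackDrift (S.clamp T)
        (fun t => x (clamp T t)) (Sum.inr k) σ) +
        (sysNoise (S.clamp T) (fun t => x (clamp T t)) (fun t => y (clamp T t)) (Sum.inr k) r -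
        sysNoise (S.clamp T) (fun t => x (clamp T t)) (fun t => y (clamp T t)) (Sum.inr k) 0) := by
      simp only [sysNoise, stackX, Sum.elim_inr, intervalIntegral.integral_same]
      abel
    rw [e, inner_add_left, h.inner_sysNoise_noise hT hS le_rfl hr hrs hst ht, add_zero,
      intervalIntegral_inner _ hd]
    refine (intervalIntegral.integral_congr fun τ hτ => ?_).trans intervalIntegral.integral_zero
    rw [uIcc_of_le hr] at hτ
    simp only [stackDrift, sum_inner, real_inner_smul_left]
    exact Finset.sum_eq_zero fun j _ => by
      rw [h.inner_state_sysNoise hT hS i j hτ.1 (hτ.2.trans hrs) hst ht, mul_zero]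
  cov_state t ht i j := by
    have := congrFun (congrFun (hnorm t ht) i) j
    simp only [clamp_of_mem ht]
    exact this

end IsLinearSystem
end LinearSystem

/-! ### Restriction to the time interval -/

section GapCongr

variable {n m p : ℕ}

/-- Two models have the same coefficients on `J`. -/
structure LinModel.AgreeOn (S S' : LinModel n m p) (J : Set ℝ) : Prop where
  A : EqOn S.A S'.A J
  B : EqOn S.B S'.B J
  C : EqOn S.C S'.C J
  D : EqOn S.D S'.D J

variable {S S' : LinModel n m p} {J : Set ℝ}

theorem LinModel.AgreeOn.mono {J' : Set ℝ} (h : S.AgreeOn S' J) (hJ : J' ⊆ J) : S.AgreeOn S' J' :=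
  ⟨h.A.mono hJ, h.B.mono hJ, h.C.mono hJ, h.D.mono hJ⟩

theorem LinModel.AgreeOn.R (h : S.AgreeOn S' J) : EqOn S.R S'.R J := fun t ht => by
  simp only [LinModel.R, h.D ht]

theorem peanoBaker_congr [J.OrdConnected] {A A' : ℝ → Matrix (Fin n) (Fin n) ℝ} (h : EqOn A A' J)
    {s : ℝ} (hs : s ∈ J) (k : ℕ) : EqOn (peanoBaker A s k) (peanoBaker A' s k) J := by
  induction k with
  | zero => exact fun _ _ => rfl
  | succ k ih =>
    intro t ht
    ext i j
    refine intervalIntegral.integral_congr fun τ hτ => ?_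
    have hτJ := OrdConnected.uIcc_subset ‹_› hs ht hτ
    simp only [h hτJ, ih hτJ]

theorem transition_congr [J.OrdConnected] {A A' : ℝ → Matrix (Fin n) (Fin n) ℝ} (h : EqOn A A' J)
    {s t : ℝ} (hs : s ∈ J) (ht : t ∈ J) : transition A t s = transition A' t s :=
  tsum_congr fun k => peanoBaker_congr h hs k ht

variable [J.OrdConnected] (h : S.AgreeOn S' J) {a b : ℝ} (ha : a ∈ J) (hb : b ∈ J)

include h ha hb

theorem gapC_congr : gapC S a b = gapC S' a b := by
  ext i j
  refine intervalIntegral.integral_congr fun τ hτ => ?_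
  have hτJ := OrdConnected.uIcc_subset ‹_› ha hb hτ
  simp only [h.C hτJ, transition_congr h.A ha hτJ]

theorem gapM_congr : gapM S b a = gapM S' b a := by
  rw [gapM, gapM, gapC_congr h ha hb, h.B ha, h.D ha]

theorem gapBB_congr : gapBB S a b = gapBB S' a b := by
  ext i j
  refine setIntegral_congr_fun measurableSet_uIcc fun τ hτ => ?_
  have hτJ := OrdConnected.uIcc_subset ‹_› ha hb hτ
  simp only [h.B hτJ, transition_congr h.A hτJ hb]

theorem gapBD_congr : gapBD S a b = gapBD S' a b := by
  ext i j
  refine setIntegral_congr_fun measurableSet_uIcc fun τ hτ => ?_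
  have hτJ := OrdConnected.uIcc_subset ‹_› ha hb hτ
  simp only [h.B hτJ, transition_congr h.A hτJ hb, gapM_congr h hτJ hb]

theorem gapDD_congr : gapDD S a b = gapDD S' a b := by
  ext i j
  refine setIntegral_congr_fun measurableSet_uIcc fun τ hτ => ?_
  have hτJ := OrdConnected.uIcc_subset ‹_› ha hb hτ
  simp only [gapM_congr h hτJ hb]

theorem gapInnov_congr {Q Q' : ℝ → Matrix (Fin n) (Fin n) ℝ} (hQ : EqOn Q Q' J) :
    gapInnov S Q a b = gapInnov S' Q' a b := by
  rw [gapInnov, gapInnov, gapC_congr h ha hb, gapDD_congr h ha hb, hQ ha]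

theorem GapStep.congr {Ω : Type*} [MeasurableSpace Ω] {ℙ : Measure Ω} {y y' : ℝ → Fin m → RV ℙ}
    {z z' : ℝ → Fin n → RV ℙ} {Q Q' : ℝ → Matrix (Fin n) (Fin n) ℝ} (hg : GapStep S y z Q a b)
    (hy : EqOn y y' J) (hz : EqOn z z' J) (hQ : EqOn Q Q' J) : GapStep S' y' z' Q' a b := by
  simpa only [GapStep, gapGain, gapInnov_congr h ha hb hQ, gapC_congr h ha hb,
    gapBB_congr h ha hb, gapBD_congr h ha hb, transition_congr h.A ha hb, hQ ha, hQ hb, hz ha,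
    hz hb, hy ha, hy hb] using hg

end GapCongr

section ObsCongr

variable {Ω : Type*} [MeasurableSpace Ω] {ℙ : Measure Ω} {n m p : ℕ} {T : ℝ}
  {y y' : ℝ → Fin m → RV ℙ}

theorem incrSpace_congr {a b : ℝ} (h : EqOn y y' (Icc a b)) :
    incrSpace y a b = incrSpace y' a b := by
  have key : ∀ {y y' : ℝ → Fin m → RV ℙ}, EqOn y y' (Icc a b) →
      incrSpace y a b ≤ incrSpace y' a b := fun h => incrSpace_le fun s hs t ht k => by
    rw [h hs, h ht]
    exact mem_incrSpace hs ht k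
  exact le_antisymm (key h) (key h.symm)

theorem obsSpace_congr (O : ObsPattern T) (h : EqOn y y' (Icc 0 T)) :
    obsSpace O y = obsSpace O y' := by
  refine iSup_congr fun i => ?_
  have hsub := Icc_subset_Icc (O.left_nonneg i) (O.right_le i)
  have hle := (O.left_lt_right i).le
  cases O.mode i with
  | full => exact incrSpace_congr (h.mono hsub)
  | increment =>
    simp only [modeSpace, h (hsub (left_mem_Icc.2 hle)), h (hsub (right_mem_Icc.2 hle))]
  | lost => rfl

theorem obsPast_congr (O : ObsPattern T) (h : EqOn y y' (Icc 0 T)) {t : ℝ} (ht : t ≤ T) :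
    obsPast O y t = obsPast O y' t := by
  rw [obsPast, obsPast, obsSpace_congr O h, incrSpace_congr (h.mono (Icc_subset_Icc le_rfl ht))]

theorem obsFuture_congr (O : ObsPattern T) (h : EqOn y y' (Icc 0 T)) {t : ℝ} (ht : 0 ≤ t) :
    obsFuture O y t = obsFuture O y' t := by
  rw [obsFuture, obsFuture, obsSpace_congr O h,
    incrSpace_congr (h.mono (Icc_subset_Icc ht le_rfl))]

end ObsCongr

section CascadeCongr

variable {Ω : Type*} [MeasurableSpace Ω] {ℙ : Measure Ω} {n m p : ℕ} {T : ℝ}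
  {S S' : LinModel n m p} {J : Set ℝ} {y y' : ℝ → Fin m → RV ℙ}
  {K K' : ℝ → Matrix (Fin n) (Fin m) ℝ} {z z' : ℝ → Fin n → RV ℙ}
  {Q Q' : ℝ → Matrix (Fin n) (Fin n) ℝ}

theorem filterDrift_apply (S : LinModel n m p) (K : ℝ → Matrix (Fin n) (Fin m) ℝ)
    (z : ℝ → Fin n → RV ℙ) (t : ℝ) (i : Fin n) :
    (S.A t ⊛ z t - K t ⊛ S.C t ⊛ z t) i = ∑ j, (S.A t - K t * S.C t) i j • z t j := by
  rw [← matAct_mul]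
  simp only [Pi.sub_apply, matAct, Matrix.sub_apply, sub_smul, Finset.sum_sub_distrib]

/-- Convergence of arbitrarily tagged sums contains that of the sums with left end points as tags,
by which stochastic differentials are defined. -/
theorem hasStochDifferential_of_tendsto [J.OrdConnected]
    (hc : ∀ i, ContinuousOn (fun τ => ∑ j, (S.A τ - K τ * S.C τ) i j • z τ j) J)
    (hlim : ∀ s ∈ J, ∀ t ∈ J, s ≤ t → ∀ i,
      Tendsto (fun P => ∑ k, rsum (fun τ => K τ i k) (fun τ => y τ k) P) (meshFilter s t)
        (𝓝 (z t i - z s i - ∫ τ in s..t, ∑ j, (S.A τ - K τ * S.C τ) i j • z τ j)))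
    (hS : S.AgreeOn S' J) (hy : EqOn y y' J) (hK : EqOn K K' J) (hz : EqOn z z' J) :
    HasStochDifferential J z' (fun t => S'.A t ⊛ z' t - K' t ⊛ S'.C t ⊛ z' t) K' y' := by
  intro s hs t ht hst
  have hsub : uIcc s t ⊆ J := OrdConnected.uIcc_subset ‹_› hs ht
  have e : ∀ i, EqOn (fun τ => (S'.A τ ⊛ z' τ - K' τ ⊛ S'.C τ ⊛ z' τ) i)
      (fun τ => ∑ j, (S.A τ - K τ * S.C τ) i j • z τ j) J := fun i τ hτ => by
    dsimp only
    rw [filterDrift_apply, hS.A hτ, hS.C hτ, hK hτ, hz hτ]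
  have hint : IntervalIntegrable (fun t => S'.A t ⊛ z' t - K' t ⊛ S'.C t ⊛ z' t) volume s t :=
    (continuousOn_pi.2 fun i => (((hc i).congr (e i)).mono hsub)).intervalIntegrable
  refine ⟨hint, HasStochIntegral.of_tendsto fun i => ?_⟩
  have h1 := hlim s hs t ht hst i
  rw [← intervalIntegral.integral_congr ((e i).mono hsub), ← intervalIntegral_apply hint,
    hz hs, hz ht] at h1
  refine h1.congr' ?_
  filter_upwards [eventually_isOn s t one_pos] with P hP
  have hmem : ∀ {τ}, τ ∈ Icc s t → τ ∈ J := fun hτ => hsub (by rwa [uIcc_of_le hst])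
  refine Finset.sum_congr rfl fun k _ => Finset.sum_congr rfl fun l hl => ?_
  have hl' := Finset.mem_range.1 hl
  simp only [hK (hmem (hP.tag_mem hl')), hy (hmem (hP.u_mem hl'.le)), hy (hmem (hP.u_mem hl'))]

theorem TaggedFilterOn.forwardFilterOn [J.OrdConnected] (h : TaggedFilterOn S J y K z Q)
    (hS : S.AgreeOn S' J) (hy : EqOn y y' J) (hK : EqOn K K' J) (hz : EqOn z z' J)
    (hQ : EqOn Q Q' J) : ForwardFilterOn S' J y' K' z' Q' := by
  refine ⟨hasStochDifferential_of_tendsto h.cont_drift h.tendsto hS hy hK hz, fun t ht i j => ?_⟩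
  rw [← hS.A ht, ← hS.B ht, ← hS.R ht, ← hK ht, ← hQ ht]
  exact (h.deriv t ht i j).congr (fun τ hτ => by rw [hQ hτ]) (by rw [hQ ht])

theorem TaggedBackFilterOn.backwardFilterOn [J.OrdConnected] (h : TaggedBackFilterOn S J y K z Q)
    (hS : S.AgreeOn S' J) (hy : EqOn y y' J) (hK : EqOn K K' J) (hz : EqOn z z' J)
    (hQ : EqOn Q Q' J) : BackwardFilterOn S' J y' K' z' Q' := by
  refine ⟨hasStochDifferential_of_tendsto h.cont_drift h.tendsto hS hy hK hz, fun t ht i j => ?_⟩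
  rw [← hS.A ht, ← hS.B ht, ← hS.R ht, ← hK ht, ← hQ ht]
  exact (h.deriv t ht i j).congr (fun τ hτ => by rw [hQ hτ]) (by rw [hQ ht])

variable {O : ObsPattern T}

theorem TaggedCascade.forwardCascade (hT : 0 ≤ T) (h : TaggedCascade S O y z Q)
    (hS : S.AgreeOn S' (Icc 0 T)) (hy : EqOn y y' (Icc 0 T)) (hz : EqOn z z' (Icc 0 T))
    (hQ : EqOn Q Q' (Icc 0 T)) : ForwardCascade S' O y' 1 z' Q' := by
  have hsub := fun i => Icc_subset_Icc (O.left_nonneg i) (O.right_le i)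
  have hl := fun i => hsub i (left_mem_Icc.2 (O.left_lt_right i).le)
  have hr := fun i => hsub i (right_mem_Icc.2 (O.left_lt_right i).le)
  have hgain : EqOn (forwardGain S Q) (forwardGain S' Q') (Icc 0 T) := fun t ht => by
    simp only [forwardGain, hS.B ht, hS.C ht, hS.D ht, hS.R ht, hQ ht]
  refine ⟨(hz ⟨le_rfl, hT⟩).symm.trans h.init_est, (hQ ⟨le_rfl, hT⟩).symm.trans h.init_cov,
    fun i hi => ?_, fun i hi => ?_, fun i hi => ⟨?_, ?_, ?_⟩⟩
  · exact (h.full i hi).forwardFilterOn (hS.mono (hsub i)) (hy.mono (hsub i))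
      (hgain.mono (hsub i)) (hz.mono (hsub i)) (hQ.mono (hsub i))
  · exact (h.lost i hi).forwardFilterOn (hS.mono (hsub i)) (hy.mono (hsub i))
      (fun _ _ => rfl) (hz.mono (hsub i)) (hQ.mono (hsub i))
  · have hsub' := Ico_subset_Icc_self.trans (hsub i)
    exact (h.increment i hi).1.forwardFilterOn (hS.mono hsub') (hy.mono hsub')
      (fun _ _ => rfl) (hz.mono hsub') (hQ.mono hsub')
  · rw [← gapInnov_congr hS (hl i) (hr i) hQ]
    exact (h.increment i hi).2.1
  · exact GapStep.congr hS (hl i) (hr i) (h.increment i hi).2.2 hy hz hQ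

theorem TaggedBackCascade.backwardCascade (hT : 0 ≤ T) (h : TaggedBackCascade O S y z Q)
    (hS : S.AgreeOn S' (Icc 0 T)) (hy : EqOn y y' (Icc 0 T)) (hz : EqOn z z' (Icc 0 T))
    (hQ : EqOn Q Q' (Icc 0 T)) : BackwardCascade S' O y' 1 z' Q' := by
  have hsub := fun i => Icc_subset_Icc (O.left_nonneg i) (O.right_le i)
  have hl := fun i => hsub i (left_mem_Icc.2 (O.left_lt_right i).le)
  have hr := fun i => hsub i (right_mem_Icc.2 (O.left_lt_right i).le)
  have hgain : EqOn (backwardGain S Q) (backwardGain S' Q') (Icc 0 T) := fun t ht => by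
    simp only [backwardGain, hS.B ht, hS.C ht, hS.D ht, hS.R ht, hQ ht]
  refine ⟨(hz ⟨hT, le_rfl⟩).symm.trans h.final_est, (hQ ⟨hT, le_rfl⟩).symm.trans h.final_cov,
    fun i hi => ?_, fun i hi => ?_, fun i hi => ⟨?_, ?_, ?_⟩⟩
  · exact (h.full i hi).backwardFilterOn (hS.mono (hsub i)) (hy.mono (hsub i))
      (hgain.mono (hsub i)) (hz.mono (hsub i)) (hQ.mono (hsub i))
  · exact (h.lost i hi).backwardFilterOn (hS.mono (hsub i)) (hy.mono (hsub i))
      (fun _ _ => rfl) (hz.mono (hsub i)) (hQ.mono (hsub i))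
  · have hsub' := Ioc_subset_Icc_self.trans (hsub i)
    exact (h.increment i hi).1.backwardFilterOn (hS.mono hsub') (hy.mono hsub')
      (fun _ _ => rfl) (hz.mono hsub') (hQ.mono hsub')
  · rw [← gapInnov_congr hS (hr i) (hl i) hQ]
    exact (h.increment i hi).2.1
  · exact GapStep.congr hS (hr i) (hl i) (h.increment i hi).2.2 hy hz hQ

end CascadeCongr

theorem LinModel.clamp_agreeOn {n m p : ℕ} (S : LinModel n m p) (T : ℝ) :
    (S.clamp T).AgreeOn S (Icc 0 T) := by
  constructor <;> intro t ht <;> simp only [LinModel.clamp, clamp_of_mem ht]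

/-- For unit state covariance, the time-reversed model does not depend on the covariance function
outside the interval. -/
theorem LinModel.backward_agreeOn {n m p : ℕ} {S S' : LinModel n m p} {J : Set ℝ}
    {P : ℝ → Matrix (Fin n) (Fin n) ℝ} (h : S.AgreeOn S' J) (hP : ∀ t ∈ J, P t = 1) :
    (S.backward fun _ => 1).AgreeOn (S'.backward P) J := by
  constructor <;> intro t ht <;>
    simp only [LinModel.backward, h.A ht, h.B ht, h.C ht, h.D ht, hP t ht]

end KalmanCascade

theorem mainTheorem1 {Ω : Type*} [MeasurableSpace Ω] (ℙ : Measure Ω) [IsProbabilityMeasure ℙ]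
    {n m p : ℕ} (T : ℝ) (hT : 0 < T)
    (S : LinModel n m p) (hS : S.IsContinuousOn T) (hR : ∀ t ∈ Icc 0 T, (S.R t).PosDef)
    (w : ℝ → Fin p → RV ℙ) (x : ℝ → Fin n → RV ℙ) (y : ℝ → Fin m → RV ℙ)
    (hsys : IsLinearSystem S T w x y)
    (hnorm : ∀ t ∈ Icc 0 T, stateCov x t = 1)
    (O : ObsPattern T) :
    (∀ t ∈ Icc 0 T,
      backwardState x t = x t ∧
      (forwardErrCov O x y t).PosDef ∧ (backwardErrCov O x y t).PosDef ∧
      (smoothErrCov O x y t).PosDef ∧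
      smoothEst O x y t = smoothErrCov O x y t ⊛
        ((forwardErrCov O x y t)⁻¹ ⊛ forwardEst O x y t
          + (backwardErrCov O x y t)⁻¹ ⊛ backwardEst O x y t) ∧
      (smoothErrCov O x y t)⁻¹ =
        (forwardErrCov O x y t)⁻¹ + (backwardErrCov O x y t)⁻¹ - 1) ∧
    (∀ t ∈ Icc 0 T, (∀ i, O.mode i = .increment → t ∉ Ioo (O.left i) (O.right i)) →
      obsPast O y t ⊔ obsFuture O y t = obsSpace O y) ∧
    ForwardCascade S O y 1 (forwardEst O x y) (forwardErrCov O x y) ∧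
    BackwardCascade (S.backward (stateCov x)) O y 1 (backwardEst O x y) (backwardErrCov O x y) := by
  have hS' := S.clamp_agreeOn T
  have hx : ∀ t ∈ Icc 0 T, x (clamp T t) = x t := fun t ht => by rw [clamp_of_mem ht]
  have hy : EqOn (fun t => y (clamp T t)) y (Icc 0 T) := fun t ht => by simp only [clamp_of_mem ht]
  have hcore := hsys.core hT.le hS hR hnorm
  have hback : ∀ t ∈ Icc 0 T, backwardState x t = x t := fun t ht => by
    ext1 i
    simp [backwardState, hnorm t ht, matAct, Matrix.one_apply]
  have hpast : ∀ t ∈ Icc 0 T, obsPast O (fun t => y (clamp T t)) t = obsPast O y t :=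
    fun t ht => obsPast_congr O hy ht.2
  have hfut : ∀ t ∈ Icc 0 T, obsFuture O (fun t => y (clamp T t)) t = obsFuture O y t :=
    fun t ht => obsFuture_congr O hy ht.1
  have hfe : EqOn (forwardEst O (fun t => x (clamp T t)) fun t => y (clamp T t))
      (forwardEst O x y) (Icc 0 T) := fun t ht => by
    rw [forwardEst, forwardEst, hpast t ht, hx t ht]
  have hfc : EqOn (forwardErrCov O (fun t => x (clamp T t)) fun t => y (clamp T t))
      (forwardErrCov O x y) (Icc 0 T) := fun t ht => by
    rw [forwardErrCov, forwardErrCov, hfe ht, hx t ht]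
  have hbe : EqOn (fun t => estimate (obsFuture O (fun t => y (clamp T t)) t) (x (clamp T t)))
      (backwardEst O x y) (Icc 0 T) := fun t ht => by
    simp only [backwardEst, hfut t ht, hx t ht, hback t ht]
  have hbc : EqOn (fun t =>
      covMat (x (clamp T t) - estimate (obsFuture O (fun t => y (clamp T t)) t) (x (clamp T t)))
        (x (clamp T t) - estimate (obsFuture O (fun t => y (clamp T t)) t) (x (clamp T t))))
      (backwardErrCov O x y) (Icc 0 T) := fun t ht => by
    simp only [backwardErrCov, backwardEst, hfut t ht, hx t ht, hback t ht]
  refine ⟨fun t ht => ?_, fun t ht => obsPast_sup_obsFuture O hT ht,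
    (hcore.taggedCascade hT O).forwardCascade hT.le hS' hy hfe hfc,
    (hcore.taggedBackCascade hT O).backwardCascade hT.le
      (LinModel.backward_agreeOn hS' hnorm) hy hbe hbc⟩
  have hp₁ : (forwardErrCov O x y t).PosDef := by
    rw [← hfc ht]
    exact hcore.posDef_forwardErrCov hT.le O ht
  have hp₂ : (backwardErrCov O x y t).PosDef := by
    rw [← hbc ht]
    exact hcore.posDef_errCov_future hT O ht
  have hsplit : IsSplitting (x t) (obsPast O y t) (obsFuture O y t) := by
    have h1 : IsSplitting (x (clamp T t)) (obsPast O (fun t => y (clamp T t)) t)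
        (obsFuture O (fun t => y (clamp T t)) t) :=
      (hcore.isSplitting_incrSpace ht.1).mono inf_le_right inf_le_right
    rwa [hpast t ht, hfut t ht, hx t ht] at h1
  obtain ⟨h1, h2, h3⟩ := hsplit.estimate_sup (hnorm t ht) (Q₁ := forwardErrCov O x y t)
    (Q₂ := backwardErrCov O x y t) (Q := smoothErrCov O x y t) rfl
    (by rw [backwardErrCov, backwardEst, hback t ht]) rfl hp₁ hp₂
  refine ⟨hback t ht, hp₁, hp₂, h1, ?_, h3⟩
  rw [backwardEst, hback t ht]
  exact h2
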